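/- The TH-pentagon is the convex pentagon $ABCDE$ made of two equilateral triangles $ABD$ and $BCD$ with a common side $BD$ and an isosceles triangle $ADE$ with apex $E$, lying on the other side of $AD$ from $B$ and having one third of the area of $ABD$; take $AB=1$. Its angles at $A,B,C,D,E$ are $90^\circ,120^\circ,60^\circ,150^\circ,120^\circ$. A tiling by TH-pentagons is a set of congruent copies of it (reflections allowed) that have pairwise disjoint interiors and cover the plane; it need not be edge-to-edge. We say that a relation such as $A+D+E=360^\circ$ (respectively $3E=360^\circ$) holds at a point if the corners of tiles located at that point are exactly one $A$, one $D$ and one $E$ (respectively exactly three $E$). A variation of a Type 1 tiling is a tiling by TH-pentagons whose vertices are formed only by the relations $A+D+E=360^\circ$ and $B+C=180^\circ$; that is, the corners at each vertex are exactly one $A$, one $D$, one $E$, or exactly one $B$ and one $C$, or exactly two $B$ and two $C$ (the relation $B+C=180^\circ$ on both sides). Attach to each side of an equilateral triangle of side $1$ a rhombus made of two equilateral triangles of side $1$. The windmill heptiamond is obtained when the three rhombi are permuted by the rotation of the central triangle by $120^\circ$; the ship heptiamond is obtained from it by reflecting one of the rhombi in the perpendicular bisector of the side to which it is attached. (1)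 In every tiling by TH-pentagons, at each point which is the corner $E$ of some tile, $A+D+E=360^\circ$ or $3E=360^\circ$ holds. (2) The relations $A+D+E=360^\circ$ and $3E=360^\circ$ do not both occur in one tiling by TH-pentagons. (3) Hence every tiling by TH-pentagons either is a variation of a Type 1 tiling, or has $3E=360^\circ$ at all its corners $E$ and becomes a tiling by windmill and ship heptiamonds when the three tiles around each such point are united. Every tiling by TH-pentagons in which $A+D+E=360^\circ$ holds at all corners $E$ is a variation of a Type 1 tiling. Uniting the three tiles around each point with $3E=360^\circ$ is a bijection from the set of tilings by TH-pentagons in which $3E=360^\circ$ holds at all corners $E$ onto the set of tilings of the plane by congruent copies (reflections allowed) of the windmill and ship heptiamonds. (4) Tilings by TH-pentagons with $A+D+E=360^\circ$ at all corners $E$ exist, and so do tilings by TH-pentagons with $3E=360^\circ$ at all corners $E$. -/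

import Mathlib

/-! The Euclidean plane is identified with `ℂ`; a congruence (reflections allowed) is an
element of `ℂ ≃ᵢ ℂ`. -/

namespace THPentagon

/-- `S` is a tiling of the plane by congruent (possibly reflected) copies of the prototiles in
`Q`: the tiles have pairwise disjoint interiors and cover the plane. Tilings need not be
edge-to-edge. -/
def IsTiling (Q S : Set (Set ℂ)) : Prop :=
  (∀ t ∈ S, ∃ q ∈ Q, ∃ g : ℂ ≃ᵢ ℂ, g '' q = t) ∧
    (S.Pairwise fun t u => Disjoint (interior t) (interior u)) ∧
    ⋃₀ S = Set.univ

/-- The labels of the five corners of the pentagon. -/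
inductive Corner
  | A
  | B
  | C
  | D
  | E

/-- The vertices of the TH-pentagon `ABCDE` with `AB = 1`: the triangles `ABD` and `BCD` are
equilateral with side `1`, and `ADE` is isosceles with base `AD` and height `√3 / 6`, one third
of the height of `ABD`. The angles at `A, B, C, D, E` are `90°, 120°, 60°, 150°, 120°`. -/
noncomputable def vertex : Corner → ℂ
  | Corner.A => ⟨0, 0⟩
  | Corner.B => ⟨1 / 2, -(√3 / 2)⟩
  | Corner.C => ⟨3 / 2, -(√3 / 2)⟩
  | Corner.D => ⟨1, 0⟩
  | Corner.E => ⟨1 / 2, √3 / 6⟩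

/-- The TH-pentagon, as a closed convex region. -/
noncomputable def pentagon : Set ℂ := convexHull ℝ (Set.range vertex)

/-- `T` is a tiling of the plane by TH-pentagons. -/
def IsTHTiling (T : Set (Set ℂ)) : Prop := IsTiling {pentagon} T

/-- `p` is the corner labelled `k` of the tile `t`. (The TH-pentagon has no nontrivial symmetry,
so the congruence `g` is determined by `t`.) -/
def IsCorner (t : Set ℂ) (k : Corner) (p : ℂ) : Prop :=
  ∃ g : ℂ ≃ᵢ ℂ, g '' pentagon = t ∧ g (vertex k) = p

/-- The tiles of `T` that have their corner `k` at the point `p`. -/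
def tilesAt (T : Set (Set ℂ)) (k : Corner) (p : ℂ) : Set (Set ℂ) :=
  {t | t ∈ T ∧ IsCorner t k p}

/-- The corners of tiles of `T` located at `p` are exactly `a` corners `A`, `b` corners `B`,
`c` corners `C`, `d` corners `D` and `e` corners `E`. -/
def CornersAre (T : Set (Set ℂ)) (p : ℂ) (a b c d e : ℕ∞) : Prop :=
  (tilesAt T Corner.A p).encard = a ∧ (tilesAt T Corner.B p).encard = b ∧
    (tilesAt T Corner.C p).encard = c ∧ (tilesAt T Corner.D p).encard = d ∧
    (tilesAt T Corner.E p).encard = e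

/-- `p` is the corner `E` of some tile of `T`. -/
def IsEPoint (T : Set (Set ℂ)) (p : ℂ) : Prop := ∃ t ∈ T, IsCorner t Corner.E p

/-- `p` is a corner of some tile of `T`. -/
def IsVertex (T : Set (Set ℂ)) (p : ℂ) : Prop := ∃ t ∈ T, ∃ k, IsCorner t k p

/-- The concentration relation `A + D + E = 360°` at `p`. -/
def RelADE (T : Set (Set ℂ)) (p : ℂ) : Prop := CornersAre T p 1 0 0 1 1

/-- The concentration relation `3E = 360°` at `p`. -/
def RelEEE (T : Set (Set ℂ)) (p : ℂ) : Prop := CornersAre T p 0 0 0 0 3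

/-- Only the concentration relation `B + C = 180°` is used at `p`: either on one side (one `B`
and one `C`, the other side being a straight angle inside a side of another tile), or on both
sides (two `B` and two `C`; in any cyclic order these split into two adjacent pairs `B`, `C`). -/
def RelBC (T : Set (Set ℂ)) (p : ℂ) : Prop :=
  CornersAre T p 0 1 1 0 0 ∨ CornersAre T p 0 2 2 0 0

/-- Variations of Type 1 tilings: tilings whose vertices are formed only by the relations
`A + D + E = 360°` and `B + C = 180°`. -/
def IsTypeOneVariation (T : Set (Set ℂ)) : Prop :=
  IsTHTiling T ∧ ∀ p, IsVertex T p → RelADE T p ∨ RelBC T p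

/-- Tilings by TH-pentagons all of whose corners `E` are in the relation `A + D + E = 360°`. -/
def IsADETiling (T : Set (Set ℂ)) : Prop := IsTHTiling T ∧ ∀ p, IsEPoint T p → RelADE T p

/-- Tilings by TH-pentagons all of whose corners `E` are in the relation `3E = 360°`. -/
def IsEEETiling (T : Set (Set ℂ)) : Prop := IsTHTiling T ∧ ∀ p, IsEPoint T p → RelEEE T p

/-- The point `m + n ω` of the triangular lattice, where `ω = exp (π i / 3)`. -/
noncomputable def lat (m n : ℤ) : ℂ := ⟨(m : ℝ) + n / 2, n * (√3 / 2)⟩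

/-- Lattice triangles with a horizontal side at the bottom. -/
noncomputable def upTri (m n : ℤ) : Set ℂ :=
  convexHull ℝ {lat m n, lat (m + 1) n, lat m (n + 1)}

/-- Lattice triangles with a horizontal side at the top. -/
noncomputable def downTri (m n : ℤ) : Set ℂ :=
  convexHull ℝ {lat (m + 1) n, lat m (n + 1), lat (m + 1) (n + 1)}

/-- The windmill heptiamond: the central triangle `upTri 0 0` with a rhombus of two triangles on
each of its sides, the three rhombi being images of each other under rotation by `120°`. -/
noncomputable def windmill : Set ℂ :=
  upTri 0 0 ∪ (downTri 0 (-1) ∪ upTri 1 (-1)) ∪ (downTri 0 0 ∪ upTri 0 1) ∪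
    (downTri (-1) 0 ∪ upTri (-1) 0)

/-- The ship heptiamond: the windmill with one of the three rhombi reflected in the symmetry axis
of the central triangle that is perpendicular to the side the rhombus is attached to. -/
noncomputable def ship : Set ℂ :=
  upTri 0 0 ∪ (downTri 0 (-1) ∪ upTri 0 (-1)) ∪ (downTri 0 0 ∪ upTri 0 1) ∪
    (downTri (-1) 0 ∪ upTri (-1) 0)

/-- Tilings of the plane by the two heptiamonds. -/
def IsHeptiamondTiling (H : Set (Set ℂ)) : Prop := IsTiling {windmill, ship} H

/-- The regions obtained from `T` by gluing together, at each point where the relation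
`3E = 360°` holds, the three tiles that have their corner `E` there. -/
def units (T : Set (Set ℂ)) : Set (Set ℂ) :=
  {U | ∃ p, RelEEE T p ∧ U = ⋃₀ tilesAt T Corner.E p}

end THPentagon

/-!
All directions of sides in a tiling by TH-pentagons that contains the pentagon in its standard
position are powers of `ζ = exp (π i / 6)`: two tiles that meet at a point which is no corner have
parallel sides there, and the plane stays connected when the countable set of corners is removed
(`IsTHTiling.aligned`). So around every point the tiles fill twelve sectors of `30°`, and as long as
tiles are forced to touch at corners, everything happens on points with integer coordinates with
respect to `1, ζ, ζ², ζ³` in units of `1 / √3`. This turns the local analysis into a finite case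
distinction, which `check` carries out: it looks at a sector that is not yet covered and goes
through all tiles that could cover it, including a tile which has the point in the middle of a side
(a `wall`). The lists of numbers tell which sector to look at and where a candidate overlaps what is
already known. Soundness is `check_sound`.

The case distinction leaves, around the corner `E` of a tile, the relations `A + D + E = 360°`,
`3E = 360°` and `2A + C + E = 360°`. In the third case the tile next to the corner starts a half
infinite row of translates of itself, which runs into a contradiction next to the corner `C`
(`not_has_faultFans`). So the other two are the only ones.

A tile with `A + D + E = 360°` belongs to an infinite row of translates along its side `BC` with the
same relation (`has_adeFans_shift`), and so do the tiles across its short sides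
(`exists_neighbours`). The remaining neighbours lie on the other side of the line through the sides
`BC` of the row. A full line of sides leaves no choice there: such a tile has its own side `BC` on
the line and is in the relation `A + D + E = 360°` again (`row_below`). As the plane without the
corners is connected, the relation spreads from one tile to all tiles (`forall_has_adeFans`); so the
two relations exclude each other. Moreover, the corners `B`, `C` lie on the lines between rows,
which gives the relation `B + C = 180°` for variations of Type 1 tilings.

The windmill is the union of the pentagon with its images under the rotations by `120°` and `240°`
about `E`, and the ship arises by reflecting one of the three (`hept_eq_iUnion`); these are the only
ways to place three corners `E` around a point. A heptiamond determines its three pentagons, because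
congruences between heptiamonds map corners of convex hulls to corners and hence are known
explicitly (`eq_of_image_hept`). Therefore uniting and cutting are inverse to each other.

Two periodic tilings, given by coordinates, show existence.
-/

namespace THPentagon

open Corner Filter
open scoped ComplexConjugate Topology

/-! ### Directions and sectors -/

/-- The primitive twelfth root of unity `exp (π i / 6)`. -/
noncomputable def ζ : ℂ := ⟨√3 / 2, 1 / 2⟩

lemma sqrt_three_mul_self : √3 * √3 = (3 : ℝ) := Real.mul_self_sqrt (by norm_num)

lemma sqrt_three_pos : (0 : ℝ) < √3 := Real.sqrt_pos.2 (by norm_num)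

lemma ζ_sq : ζ ^ 2 = ⟨1 / 2, √3 / 2⟩ := by
  have := sqrt_three_mul_self
  apply Complex.ext <;> simp [ζ, pow_two] <;> nlinarith

lemma ζ_pow_three : ζ ^ 3 = ⟨0, 1⟩ := by
  have := sqrt_three_mul_self
  rw [pow_succ, ζ_sq]
  apply Complex.ext
  · simp [ζ]; ring
  · simp [ζ]; nlinarith

lemma ζ_pow_four : ζ ^ 4 = ⟨-1 / 2, √3 / 2⟩ := by
  have := sqrt_three_mul_self
  rw [pow_succ, ζ_pow_three]
  apply Complex.ext <;> simp [ζ]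
  ring

lemma ζ_pow_five : ζ ^ 5 = ⟨-√3 / 2, 1 / 2⟩ := by
  have := sqrt_three_mul_self
  rw [pow_succ, ζ_pow_four]
  apply Complex.ext <;> simp [ζ] <;> nlinarith

lemma ζ_pow_six : ζ ^ 6 = -1 := by
  have h : ζ ^ 6 = ζ ^ 3 * ζ ^ 3 := by ring
  rw [h, ζ_pow_three]
  apply Complex.ext <;> simp

lemma ζ_pow_twelve : ζ ^ 12 = 1 := by
  have h : ζ ^ 12 = ζ ^ 6 * ζ ^ 6 := by ring
  rw [h, ζ_pow_six]; norm_num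

lemma ζ_pow_mod (n : ℕ) : ζ ^ (n % 12) = ζ ^ n := by
  conv_rhs => rw [← Nat.div_add_mod n 12, pow_add, pow_mul, ζ_pow_twelve, one_pow, one_mul]

lemma ζ_pow_seven : ζ ^ 7 = ⟨-√3 / 2, -1 / 2⟩ := by
  have h : ζ ^ 7 = ζ ^ 6 * ζ := by ring
  rw [h, ζ_pow_six]
  apply Complex.ext <;> simp [ζ] <;> ring

lemma ζ_pow_ten : ζ ^ 10 = ⟨1 / 2, -√3 / 2⟩ := by
  have h : ζ ^ 10 = ζ ^ 6 * ζ ^ 4 := by ring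
  rw [h, ζ_pow_six, ζ_pow_four]
  apply Complex.ext <;> simp <;> ring

lemma normSq_ζ : Complex.normSq ζ = 1 := by
  have := sqrt_three_mul_self
  simp [Complex.normSq_apply, ζ]; nlinarith

lemma norm_ζ : ‖ζ‖ = 1 := by
  rw [← pow_eq_one_iff_of_nonneg (norm_nonneg _) (two_ne_zero), ← Complex.normSq_eq_norm_sq,
    normSq_ζ]

lemma norm_ζ_pow (n : ℕ) : ‖ζ ^ n‖ = 1 := by rw [norm_pow, norm_ζ, one_pow]

lemma ζ_ne_zero : ζ ≠ 0 := by
  intro h; simpa [h] using norm_ζ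

lemma conj_ζ : conj ζ = ζ ^ 11 := by
  have h : conj ζ * ζ = 1 := by rw [mul_comm, Complex.mul_conj, normSq_ζ]; simp
  have h2 : ζ ^ 11 * ζ = 1 := by rw [← pow_succ, ζ_pow_twelve]
  exact mul_right_cancel₀ ζ_ne_zero (h.trans h2.symm)

lemma conj_ζ_pow (n : ℕ) : conj (ζ ^ n) = ζ ^ (11 * n) := by
  rw [map_pow, conj_ζ, pow_mul]

lemma ζ_pow_congr {m n : ℕ} (h : m % 12 = n % 12) : ζ ^ m = ζ ^ n := by
  rw [← ζ_pow_mod m, h, ζ_pow_mod]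

/-- A vector pointing into the open sector between the directions `ζ ^ j` and `ζ ^ (j + 1)`. -/
noncomputable def mid (j : ℕ) : ℂ := ζ ^ j + ζ ^ (j + 1)

lemma mid_congr {m n : ℕ} (h : m % 12 = n % 12) : mid m = mid n := by
  unfold mid; rw [ζ_pow_congr h, ζ_pow_congr (show (m + 1) % 12 = (n + 1) % 12 by omega)]

lemma ζ_pow_mul_mid (m n : ℕ) : ζ ^ m * mid n = mid (m + n) := by
  unfold mid; ring

lemma conj_mid (n : ℕ) : conj (mid n) = mid (11 * n + 11) := by
  unfold mid
  rw [map_add, conj_ζ_pow, conj_ζ_pow, add_comm]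
  congr 1
  exact ζ_pow_congr (by omega)

lemma mid_add_six (n : ℕ) : mid (n + 6) = - mid n := by
  unfold mid
  rw [show n + 6 + 1 = (n + 1) + 6 by ring, pow_add, pow_add, ζ_pow_six]; ring

lemma im_mid_pos_aux {n : ℕ} (h : n < 6) : 0 < (mid n).im := by
  have h3 := sqrt_three_pos
  unfold mid
  interval_cases n <;>
  simp [ζ_sq, ζ_pow_three, ζ_pow_four, ζ_pow_five, ζ_pow_six, -one_div] <;>
    (try simp [ζ]) <;> positivity

lemma im_mid_pos {n : ℕ} (h : n % 12 < 6) : 0 < (mid n).im := by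
  rw [mid_congr (show n % 12 = (n % 12) % 12 by omega)]; exact im_mid_pos_aux h

lemma im_mid_neg {n : ℕ} (h : ¬ n % 12 < 6) : (mid n).im < 0 := by
  have h1 : (n + 6) % 12 < 6 := by omega
  have := im_mid_pos h1
  rw [mid_add_six] at this
  simpa using this

/-! ### The sides of the pentagon -/

/-- The edge of the pentagon starting at the corner `k` (counterclockwise) has direction
`ζ ^ dirIdx k`. -/
def dirIdx : Corner → ℕ
  | A => 10
  | B => 0
  | C => 4
  | D => 5
  | E => 7

/-- The corner preceding `k` counterclockwise. -/
def prev : Corner → Corner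
  | A => E
  | B => A
  | C => B
  | D => C
  | E => D

/-- The signed distance of a point to the line through the edge starting at the corner `k`,
positive on the side of the pentagon. -/
noncomputable def side : Corner → ℂ → ℝ
  | A, z => (√3 * z.re + z.im) / 2
  | B, z => z.im + √3 / 2
  | C, z => (√3 - √3 * z.re - z.im) / 2
  | D, z => (1 - z.re - √3 * z.im) / 2
  | E, z => (z.re - √3 * z.im) / 2

/-- The signed component of `m` orthogonal to the direction `ζ ^ n`. -/
noncomputable def slope (n : ℕ) (m : ℂ) : ℝ := (conj (ζ ^ n) * m).im

lemma slope_real_mul (n : ℕ) (r : ℝ) (m : ℂ) : slope n (r * m) = r * slope n m := by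
  unfold slope
  rw [mul_left_comm, Complex.im_ofReal_mul]

lemma slope_add (n : ℕ) (m m' : ℂ) : slope n (m + m') = slope n m + slope n m' := by
  unfold slope; rw [mul_add, Complex.add_im]

lemma slope_mid (d j : ℕ) : slope d (mid j) = (mid (11 * d + j)).im := by
  unfold slope; rw [conj_ζ_pow, ζ_pow_mul_mid]

lemma slope_mid_pos {d j : ℕ} (h : (11 * d + j) % 12 < 6) : 0 < slope d (mid j) := by
  rw [slope_mid]; exact im_mid_pos h

lemma slope_mid_neg {d j : ℕ} (h : ¬ (11 * d + j) % 12 < 6) : slope d (mid j) < 0 := by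
  rw [slope_mid]; exact im_mid_neg h

lemma slope_dirIdx (k : Corner) (m : ℂ) :
    slope (dirIdx k) m = match k with
      | A => (√3 * m.re + m.im) / 2
      | B => m.im
      | C => (- √3 * m.re - m.im) / 2
      | D => (- m.re - √3 * m.im) / 2
      | E => (m.re - √3 * m.im) / 2 := by
  cases k <;> simp [slope, dirIdx, ζ_pow_ten, ζ_pow_four, ζ_pow_five, ζ_pow_seven, -map_pow] <;>
    ring

lemma side_add (k : Corner) (z m : ℂ) : side k (z + m) = side k z + slope (dirIdx k) m := by
  rw [slope_dirIdx]
  cases k <;> simp [side] <;> ring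

lemma continuous_side (k : Corner) : Continuous (side k) := by
  cases k <;> unfold side <;> fun_prop

/-- Points in the skew coordinates in which all sides become rational. -/
lemma exists_coord (z : ℂ) : ∃ x y : ℝ, z = ⟨x, √3 * y⟩ := by
  refine ⟨z.re, z.im / √3, Complex.ext rfl ?_⟩
  have := sqrt_three_pos
  simp; field_simp

/-- The sides in the coordinates of `exists_coord`, up to positive factors. -/
def rside : Corner → ℝ → ℝ → ℝ
  | A, x, y => x + y
  | B, _, y => 2 * y + 1
  | C, x, y => 1 - x - y
  | D, x, y => 1 - x - 3 * y
  | E, x, y => x - 3 * y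

lemma side_coord (k : Corner) (x y : ℝ) :
    ∃ c : ℝ, 0 < c ∧ side k ⟨x, √3 * y⟩ = c * rside k x y := by
  have h := sqrt_three_mul_self
  have h0 := sqrt_three_pos
  cases k
  · exact ⟨√3 / 2, by positivity, by simp [side, rside]; ring⟩
  · exact ⟨√3 / 2, by positivity, by simp [side, rside]; ring⟩
  · exact ⟨√3 / 2, by positivity, by simp [side, rside]; ring⟩
  · exact ⟨1 / 2, by positivity, by simp [side, rside]; linear_combination (-y / 2) * h⟩
  · exact ⟨1 / 2, by positivity, by simp [side, rside]; linear_combination (-y / 2) * h⟩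

lemma side_nonneg_coord (k : Corner) (x y : ℝ) :
    0 ≤ side k ⟨x, √3 * y⟩ ↔ 0 ≤ rside k x y := by
  obtain ⟨c, hc, h⟩ := side_coord k x y
  rw [h]; exact mul_nonneg_iff_of_pos_left hc

lemma side_pos_coord (k : Corner) (x y : ℝ) :
    0 < side k ⟨x, √3 * y⟩ ↔ 0 < rside k x y := by
  obtain ⟨c, hc, h⟩ := side_coord k x y
  rw [h]; exact mul_pos_iff_of_pos_left hc

lemma side_eq_zero_coord (k : Corner) (x y : ℝ) :
    side k ⟨x, √3 * y⟩ = 0 ↔ rside k x y = 0 := by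
  obtain ⟨c, hc, h⟩ := side_coord k x y
  rw [h]; simp [hc.ne']

lemma vertex_coord (k : Corner) : vertex k = match k with
    | A => ⟨0, √3 * 0⟩
    | B => ⟨1 / 2, √3 * (-1 / 2)⟩
    | C => ⟨3 / 2, √3 * (-1 / 2)⟩
    | D => ⟨1, √3 * 0⟩
    | E => ⟨1 / 2, √3 * (1 / 6)⟩ := by
  cases k <;> apply Complex.ext <;> simp [vertex] <;> ring

lemma vertex_mem_pentagon (k : Corner) : vertex k ∈ pentagon :=
  subset_convexHull ℝ _ ⟨k, rfl⟩

lemma convex_side (k : Corner) : Convex ℝ {z | 0 ≤ side k z} := by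
  intro z hz w hw a b ha hb hab
  simp only [Set.mem_ofPred_eq] at *
  have e : side k (a • z + b • w) = a * side k z + b * side k w := by
    have hb' : b = 1 - a := by linarith
    subst hb'
    cases k <;> simp [side] <;> ring
  rw [e]; positivity

/-- Barycentric coordinates. -/
lemma mem_convexHull_triple {a b c z : ℂ} {r s t : ℝ} (hr : 0 ≤ r) (hs : 0 ≤ s) (ht : 0 ≤ t)
    (h1 : r + s + t = 1) (h : r * a + s * b + t * c = z) : z ∈ convexHull ℝ {a, b, c} := by
  rw [convexHull_insert (by simp), convexHull_pair]
  rw [mem_convexJoin]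
  refine ⟨a, rfl, ?_⟩
  by_cases hst : s + t = 0
  · have hs0 : s = 0 := by linarith
    have ht0 : t = 0 := by linarith
    have hr0 : r = 1 := by linarith
    subst hs0 ht0 hr0
    refine ⟨b, left_mem_segment _ _ _, ?_⟩
    simp at h; subst h; exact left_mem_segment _ _ _
  · have hpos : 0 < s + t := lt_of_le_of_ne (by positivity) (Ne.symm hst)
    refine ⟨((s / (s + t) : ℝ) : ℂ) * b + ((t / (s + t) : ℝ) : ℂ) * c,
      ⟨s / (s + t), t / (s + t), by positivity, by positivity, by field_simp, by simp⟩,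
      ⟨r, s + t, hr, hpos.le, by linarith, ?_⟩⟩
    rw [← h]
    have : ((s : ℂ) + t) ≠ 0 := by exact_mod_cast hst
    simp; field_simp; ring

lemma side_nonneg_of_mem {z : ℂ} (hz : z ∈ pentagon) (k : Corner) : 0 ≤ side k z := by
  refine convexHull_min (t := {z | 0 ≤ side k z}) ?_ (convex_side k) hz
  rintro _ ⟨k', rfl⟩
  show 0 ≤ side k _
  rw [vertex_coord]
  cases k' <;> simp only [side_nonneg_coord] <;> cases k <;> norm_num [rside]

lemma mem_triangle_of_side_nonneg {z : ℂ} (hz : ∀ k, 0 ≤ side k z) :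
    z ∈ convexHull ℝ {vertex A, vertex B, vertex D} ∨
    z ∈ convexHull ℝ {vertex B, vertex C, vertex D} ∨
    z ∈ convexHull ℝ {vertex A, vertex D, vertex E} := by
  obtain ⟨x, y, rfl⟩ := exists_coord z
  simp only [side_nonneg_coord] at hz
  have hA := hz A
  have hB := hz B
  have hC := hz C
  have hD := hz D
  have hE := hz E
  simp only [rside] at hA hB hC hD hE
  rcases le_total 0 y with hy | hy
  · right; right
    refine mem_convexHull_triple (r := 1 - x - 3 * y) (s := x - 3 * y) (t := 6 * y)
      (by linarith) (by linarith) (by linarith) (by ring) ?_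
    simp only [vertex_coord]
    apply Complex.ext <;> simp <;> ring
  · rcases le_total (x - y) 1 with h | h
    · left
      refine mem_convexHull_triple (r := 1 - x + y) (s := -2 * y) (t := x + y)
        (by linarith) (by linarith) (by linarith) (by ring) ?_
      simp only [vertex_coord]
      apply Complex.ext <;> simp <;> ring
    · right; left
      refine mem_convexHull_triple (r := 1 - x - y) (s := x - y - 1) (t := 2 * y + 1)
        (by linarith) (by linarith) (by linarith) (by ring) ?_
      simp only [vertex_coord]
      apply Complex.ext <;> simp <;> ring

lemma convexHull_triple_subset_pentagon (k l m : Corner) :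
    convexHull ℝ {vertex k, vertex l, vertex m} ⊆ pentagon := by
  apply convexHull_mono
  rintro z (rfl | rfl | rfl) <;> exact ⟨_, rfl⟩

lemma pentagon_eq_union_triangles :
    pentagon = convexHull ℝ {vertex A, vertex B, vertex D} ∪
      convexHull ℝ {vertex B, vertex C, vertex D} ∪
      convexHull ℝ {vertex A, vertex D, vertex E} := by
  apply Set.Subset.antisymm
  · intro z hz
    rcases mem_triangle_of_side_nonneg (side_nonneg_of_mem hz) with h | h | h
    · exact Or.inl (Or.inl h)
    · exact Or.inl (Or.inr h)
    · exact Or.inr h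
  · exact Set.union_subset (Set.union_subset (convexHull_triple_subset_pentagon _ _ _)
      (convexHull_triple_subset_pentagon _ _ _)) (convexHull_triple_subset_pentagon _ _ _)

lemma mem_pentagon_iff {z : ℂ} : z ∈ pentagon ↔ ∀ k, 0 ≤ side k z := by
  refine ⟨side_nonneg_of_mem, fun h => ?_⟩
  rw [pentagon_eq_union_triangles]
  rcases mem_triangle_of_side_nonneg h with h | h | h
  · exact Or.inl (Or.inl h)
  · exact Or.inl (Or.inr h)
  · exact Or.inr h

lemma mem_interior_pentagon {z : ℂ} (h : ∀ k, 0 < side k z) : z ∈ interior pentagon := by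
  have ho : IsOpen {z | ∀ k, 0 < side k z} := by
    have : {z | ∀ k, 0 < side k z} = {z | 0 < side A z} ∩ {z | 0 < side B z} ∩
        {z | 0 < side C z} ∩ {z | 0 < side D z} ∩ {z | 0 < side E z} := by
      ext z
      simp only [Set.mem_ofPred_eq, Set.mem_inter_iff]
      exact ⟨fun h => ⟨⟨⟨⟨h A, h B⟩, h C⟩, h D⟩, h E⟩,
        fun h k => by cases k; exacts [h.1.1.1.1, h.1.1.1.2, h.1.1.2, h.1.2, h.2]⟩
    rw [this]
    have hk := fun k => isOpen_lt (continuous_const (y := (0 : ℝ))) (continuous_side k)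
    exact ((((hk A).inter (hk B)).inter (hk C)).inter (hk D)).inter (hk E)
  refine interior_maximal (fun w hw => mem_pentagon_iff.2 fun k => (hw k).le) ho h

lemma finite_range_vertex : (Set.range vertex).Finite := by
  have : Set.range vertex = {vertex A, vertex B, vertex C, vertex D, vertex E} := by
    ext z
    constructor
    · rintro ⟨k, rfl⟩; cases k <;> simp
    · rintro (rfl | rfl | rfl | rfl | rfl) <;> exact ⟨_, rfl⟩
  rw [this]; simp

lemma isCompact_pentagon : IsCompact pentagon := finite_range_vertex.isCompact_convexHull ℝ

lemma nonempty_interior_pentagon : (interior pentagon).Nonempty := by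
  refine ⟨⟨1 / 2, √3 * (-1 / 10)⟩, mem_interior_pentagon fun k => ?_⟩
  rw [side_pos_coord]
  cases k <;> norm_num [rside]

/-! ### Sectors covered by a tile -/

/-- Near `q`, the set `t` reaches into the sector between `ζ ^ j` and `ζ ^ (j + 1)`: it contains
`q` and a further point of the ray through the middle of the sector. -/
def Cov (t : Set ℂ) (q : ℂ) (j : ℕ) : Prop := q ∈ t ∧ ∃ r : ℝ, 0 < r ∧ q + r * mid j ∈ t

lemma Cov.congr {t : Set ℂ} {q : ℂ} {i j : ℕ} (h : Cov t q i) (hij : i % 12 = j % 12) :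
    Cov t q j := by
  rwa [Cov, mid_congr hij] at h

/-- The condition on the sides of the pentagon that describes `Cov pentagon`. -/
def SideCov (w : ℂ) (j : ℕ) : Prop :=
  ∀ k, 0 < side k w ∨ (side k w = 0 ∧ (11 * dirIdx k + j) % 12 < 6)

lemma side_add_mul (k : Corner) (w m : ℂ) (r : ℝ) :
    side k (w + r * m) = side k w + r * slope (dirIdx k) m := by
  rw [side_add, slope_real_mul]

lemma eventually_forall_corner {l : Filter ℝ} {P : Corner → ℝ → Prop}
    (h : ∀ k, ∀ᶠ r in l, P k r) : ∀ᶠ r in l, ∀ k, P k r := by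
  filter_upwards [h A, h B, h C, h D, h E] with r hA hB hC hD hE k
  cases k <;> assumption

/-- If every side vanishing at `w` increases in the direction `m`, then a short segment from `w`
in the direction `m` runs in the interior of the pentagon. -/
lemma eventually_side_pos {w m : ℂ}
    (h : ∀ k, 0 < side k w ∨ (side k w = 0 ∧ 0 < slope (dirIdx k) m)) :
    ∀ᶠ r : ℝ in 𝓝[>] 0, ∀ k, 0 < side k (w + r * m) := by
  refine eventually_forall_corner fun k => ?_
  rcases h k with hk | ⟨hk, hs⟩
  · have hc : ContinuousAt (fun r : ℝ => side k (w + r * m)) 0 :=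
      ((continuous_side k).comp (by fun_prop)).continuousAt
    have h0 : 0 < (fun r : ℝ => side k (w + r * m)) 0 := by simpa using hk
    exact nhdsWithin_le_nhds (hc.eventually_const_lt h0)
  · filter_upwards [self_mem_nhdsWithin] with r hr
    rw [side_add_mul, hk, zero_add]
    exact mul_pos hr hs

lemma SideCov.eventually {w : ℂ} {j : ℕ} (h : SideCov w j) :
    ∀ᶠ r : ℝ in 𝓝[>] 0, ∀ k, 0 < side k (w + r * mid j) :=
  eventually_side_pos fun k => (h k).imp_right fun h => ⟨h.1, slope_mid_pos h.2⟩

lemma cov_pentagon_iff {w : ℂ} {j : ℕ} : Cov pentagon w j ↔ SideCov w j := by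
  constructor
  · rintro ⟨hw, r, hr, h⟩ k
    have h0 := mem_pentagon_iff.1 hw k
    have h1 := mem_pentagon_iff.1 h k
    rcases h0.lt_or_eq with h0 | h0
    · exact Or.inl h0
    · refine Or.inr ⟨h0.symm, ?_⟩
      by_contra hlt
      have := slope_mid_neg hlt
      rw [side_add_mul, ← h0, zero_add] at h1
      nlinarith
  · intro h
    refine ⟨mem_pentagon_iff.2 fun k => (h k).elim le_of_lt fun h => h.1.ge, ?_⟩
    obtain ⟨r, hr, h0⟩ := (h.eventually.and self_mem_nhdsWithin).exists
    exact ⟨r, h0, mem_pentagon_iff.2 fun k => (hr k).le⟩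

/-! ### Congruences of the plane -/

/-- Complex conjugation if `σ`, the identity otherwise. -/
noncomputable def flip (σ : Bool) (z : ℂ) : ℂ := bif σ then conj z else z

lemma flip_add (σ : Bool) (z w : ℂ) : flip σ (z + w) = flip σ z + flip σ w := by
  cases σ <;> simp [flip]

lemma flip_sub (σ : Bool) (z w : ℂ) : flip σ (z - w) = flip σ z - flip σ w := by
  cases σ <;> simp [flip]

lemma flip_real_mul (σ : Bool) (r : ℝ) (z : ℂ) : flip σ (r * z) = r * flip σ z := by
  cases σ <;> simp [flip]

lemma flip_flip (σ : Bool) (z : ℂ) : flip σ (flip σ z) = z := by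
  cases σ <;> simp [flip]

lemma norm_flip (σ : Bool) (z : ℂ) : ‖flip σ z‖ = ‖z‖ := by
  cases σ <;> simp [flip]

/-- The congruence `z ↦ x + a z`, or `z ↦ x + a z̄` if `σ`. -/
noncomputable def motion (x : ℂ) (a : ℂ) (ha : ‖a‖ = 1) (σ : Bool) : ℂ ≃ᵢ ℂ :=
  IsometryEquiv.mk' (fun z => x + a * flip σ z) (fun w => flip σ (a⁻¹ * (w - x)))
    (fun w => by
      have : a ≠ 0 := by rintro rfl; simp at ha
      simp only [flip_flip]; field_simp; ring)
    (Isometry.of_dist_eq fun z w => by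
      rw [dist_add_left, dist_eq_norm, dist_eq_norm, ← mul_sub, ← flip_sub, norm_mul, ha,
        one_mul, norm_flip])

lemma motion_apply (x a : ℂ) (ha : ‖a‖ = 1) (σ : Bool) (z : ℂ) :
    motion x a ha σ z = x + a * flip σ z := rfl

lemma exists_motion (g : ℂ ≃ᵢ ℂ) : ∃ x a, ∃ (ha : ‖a‖ = 1), ∃ σ, g = motion x a ha σ := by
  set f := g.trans (IsometryEquiv.addRight (-(g 0))) with hf
  have h0 : f 0 = 0 := by simp [hf]
  obtain ⟨a, ha⟩ := linear_isometry_complex (f.toRealLinearIsometryEquivOfMapZero h0)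
  have hg : ∀ z, g z = g 0 + f z := fun z => by simp [hf]
  rcases ha with ha | ha
  · refine ⟨g 0, a, Circle.norm_coe a, false, IsometryEquiv.ext fun z => ?_⟩
    have : f z = a * z := by
      have := congrArg (fun e => e z) ha
      simpa using this
    rw [hg, this]; rfl
  · refine ⟨g 0, a, Circle.norm_coe a, true, IsometryEquiv.ext fun z => ?_⟩
    have : f z = a * conj z := by
      have := congrArg (fun e => e z) ha
      simpa using this
    rw [hg, this]; rfl

lemma motion_add (x a : ℂ) (ha : ‖a‖ = 1) (σ : Bool) (z m : ℂ) :
    motion x a ha σ (z + m) = motion x a ha σ z + a * flip σ m := by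
  simp only [motion_apply, flip_add]; ring

/-- The congruences whose linear part is a symmetry of the twelve directions `ζ ^ j`. -/
noncomputable def frame (x : ℂ) (n : ℕ) (σ : Bool) : ℂ ≃ᵢ ℂ :=
  motion x (ζ ^ n) (norm_ζ_pow n) σ

lemma frame_apply (x : ℂ) (n : ℕ) (σ : Bool) (z : ℂ) :
    frame x n σ z = x + ζ ^ n * flip σ z := rfl

lemma frame_add (x : ℂ) (n : ℕ) (σ : Bool) (z m : ℂ) :
    frame x n σ (z + m) = frame x n σ z + ζ ^ n * flip σ m := motion_add _ _ _ _ _ _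

/-- The sector which `frame x n σ` carries to the sector `j`. -/
def localSec (n : ℕ) (σ : Bool) (j : ℕ) : ℕ := bif σ then n + 11 * j + 11 else j + 11 * n

lemma ζ_pow_mul_flip_mid (n : ℕ) (σ : Bool) (j : ℕ) :
    ζ ^ n * flip σ (mid (localSec n σ j)) = mid j := by
  cases σ
  · simp only [flip, localSec, cond_false, ζ_pow_mul_mid]
    exact mid_congr (by omega)
  · simp only [flip, localSec, cond_true, conj_mid, ζ_pow_mul_mid]
    exact mid_congr (by omega)

lemma frame_add_mid (x : ℂ) (n : ℕ) (σ : Bool) (w : ℂ) (r : ℝ) (j : ℕ) :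
    frame x n σ (w + r * mid (localSec n σ j)) = frame x n σ w + r * mid j := by
  rw [frame_add, flip_real_mul, mul_left_comm, ζ_pow_mul_flip_mid]

lemma cov_frame {x : ℂ} {n : ℕ} {σ : Bool} {t : Set ℂ} {w : ℂ} {j : ℕ} :
    Cov (frame x n σ '' t) (frame x n σ w) j ↔ Cov t w (localSec n σ j) := by
  unfold Cov
  simp only [← frame_add_mid, (frame x n σ).injective.mem_set_image]

/-- A tile is aligned if its sides have directions `ζ ^ j`. -/
def Aligned (t : Set ℂ) : Prop := ∃ x n σ, t = frame x n σ '' pentagon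

lemma aligned_pentagon : Aligned pentagon := ⟨0, 0, false, by
  have : ⇑(frame 0 0 false) = id := by ext z; simp [frame_apply, flip]
  rw [this, Set.image_id]⟩

lemma Aligned.eventually_mem_interior {t : Set ℂ} (ht : Aligned t) {q : ℂ} {j : ℕ}
    (h : Cov t q j) : ∀ᶠ r : ℝ in 𝓝[>] 0, q + r * mid j ∈ interior t := by
  obtain ⟨x, n, σ, rfl⟩ := ht
  obtain ⟨w, hw, rfl⟩ := h.1
  rw [cov_frame, cov_pentagon_iff] at h
  filter_upwards [h.eventually] with r hr
  rw [← frame_add_mid, ← IsometryEquiv.coe_toHomeomorph, ← Homeomorph.image_interior]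
  exact ⟨_, mem_interior_pentagon hr, rfl⟩

/-- The last sector covered by the pentagon at the corner `k`. -/
def lastIdx (k : Corner) : ℕ := dirIdx (prev k) + 5

/-- Two sides vanish at a point of the pentagon only at the corners. -/
lemma eq_vertex_of_side_eq_zero {w : ℂ} (hw : ∀ k, 0 ≤ side k w) {k l : Corner} (hkl : l ≠ k)
    (hk : side k w = 0) (hl : side l w = 0) :
    (w = vertex k ∧ l = prev k) ∨ (w = vertex l ∧ k = prev l) := by
  obtain ⟨x, y, rfl⟩ := exists_coord w
  simp only [side_nonneg_coord] at hw
  rw [side_eq_zero_coord] at hk hl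
  have hA := hw A
  have hB := hw B
  have hC := hw C
  have hD := hw D
  have hE := hw E
  have key : ∀ a b : ℝ, x = a → y = b → (⟨x, √3 * y⟩ : ℂ) = ⟨a, √3 * b⟩ := by
    rintro a b rfl rfl; rfl
  simp only [rside] at hA hB hC hD hE
  cases k <;> cases l <;> simp only [rside] at hk hl <;> first
    | exact absurd rfl hkl
    | (exfalso; linarith)
    | exact Or.inl ⟨by rw [vertex_coord]; exact key _ _ (by linarith) (by linarith), rfl⟩
    | exact Or.inr ⟨by rw [vertex_coord]; exact key _ _ (by linarith) (by linarith), rfl⟩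

lemma SideCov.first {w : ℂ} {j : ℕ} (h : SideCov w j) (h' : ¬ SideCov w (j + 11)) :
    (∃ k, w = vertex k ∧ j % 12 = dirIdx k) ∨
      ∃ k, side k w = 0 ∧ j % 12 = dirIdx k ∧ ∀ l, l ≠ k → 0 < side l w := by
  have hw : ∀ k, 0 ≤ side k w := fun k => (h k).elim le_of_lt fun h => h.1.ge
  simp only [SideCov, not_forall, not_or, not_and] at h'
  obtain ⟨k, hk1, hk2⟩ := h'
  obtain ⟨hk, hj⟩ := (h k).resolve_left hk1
  have hj2 := hk2 hk
  have hjd : j % 12 = dirIdx k := by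
    have : dirIdx k < 12 := by cases k <;> decide
    omega
  by_cases hl : ∀ l, l ≠ k → 0 < side l w
  · exact Or.inr ⟨k, hk, hjd, hl⟩
  · push Not at hl
    obtain ⟨l, hlk, hl⟩ := hl
    obtain ⟨hl0, hlj⟩ := (h l).resolve_left hl.not_gt
    rcases eq_vertex_of_side_eq_zero hw hlk hk hl0 with ⟨h1, -⟩ | ⟨-, rfl⟩
    · exact Or.inl ⟨k, h1, hjd⟩
    · exfalso; cases l <;> simp only [dirIdx, prev] at hjd hlj <;> omega

lemma SideCov.last {w : ℂ} {j : ℕ} (h : SideCov w j) (h' : ¬ SideCov w (j + 1)) :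
    (∃ k, w = vertex k ∧ j % 12 = lastIdx k % 12) ∨
      ∃ k, side k w = 0 ∧ j % 12 = (dirIdx k + 5) % 12 ∧ ∀ l, l ≠ k → 0 < side l w := by
  have hw : ∀ k, 0 ≤ side k w := fun k => (h k).elim le_of_lt fun h => h.1.ge
  simp only [SideCov, not_forall, not_or, not_and] at h'
  obtain ⟨k, hk1, hk2⟩ := h'
  obtain ⟨hk, hj⟩ := (h k).resolve_left hk1
  have hj2 := hk2 hk
  have hjd : j % 12 = (dirIdx k + 5) % 12 := by omega
  by_cases hl : ∀ l, l ≠ k → 0 < side l w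
  · exact Or.inr ⟨k, hk, hjd, hl⟩
  · push Not at hl
    obtain ⟨l, hlk, hl⟩ := hl
    obtain ⟨hl0, hlj⟩ := (h l).resolve_left hl.not_gt
    rcases eq_vertex_of_side_eq_zero hw hlk hk hl0 with ⟨-, rfl⟩ | ⟨h1, rfl⟩
    · exfalso; cases k <;> simp only [dirIdx, prev] at hjd hlj <;> omega
    · exact Or.inl ⟨l, h1, hjd⟩

/-- The first sector covered by `frame x n σ '' pentagon` at the image of the corner `k`. -/
def startSec (k : Corner) (n : ℕ) (σ : Bool) : ℕ :=
  bif σ then n + 6 + 11 * dirIdx (prev k) else n + dirIdx k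

lemma slope_congr {m n : ℕ} (h : m % 12 = n % 12) (z : ℂ) : slope m z = slope n z := by
  rw [slope, slope, ζ_pow_congr h]

lemma slope_ζ_pow_mul (n d : ℕ) (m : ℂ) : slope (n + d) (ζ ^ n * m) = slope d m := by
  have h : ζ ^ (11 * (n + d)) * (ζ ^ n * m) = ζ ^ (11 * d) * m := by
    rw [← mul_assoc, ← pow_add]
    congr 1
    exact ζ_pow_congr (by omega)
  rw [slope, slope, conj_ζ_pow, conj_ζ_pow, h]

lemma slope_conj (d : ℕ) (m : ℂ) : slope (6 + 11 * d) (conj m) = slope d m := by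
  have h : conj (ζ ^ (6 + 11 * d)) * conj m = - conj (conj (ζ ^ d) * m) := by
    rw [pow_add, ζ_pow_six, ← conj_ζ_pow]
    simp
  rw [slope, slope, h, Complex.neg_im, Complex.conj_im, neg_neg]

/-- A tile that covers the sector `j` at `q` but not the preceding sector either has a corner at
`q`, starting with the sector `j`, or it has `q` inside an edge of direction `ζ ^ j`. -/
lemma cov_frame_cases {x : ℂ} {n : ℕ} {σ : Bool} {q : ℂ} {j : ℕ}
    (h : Cov (frame x n σ '' pentagon) q j) (h' : ¬ Cov (frame x n σ '' pentagon) q (j + 11)) :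
    (∃ k, frame x n σ (vertex k) = q ∧ startSec k n σ % 12 = j % 12) ∨
      ((∀ z ∈ frame x n σ '' pentagon, 0 ≤ slope j (z - q)) ∧
        ∀ i, Cov (frame x n σ '' pentagon) q i ↔ (11 * j + i) % 12 < 6) := by
  obtain ⟨w, hw, rfl⟩ := h.1
  simp only [cov_frame, cov_pentagon_iff] at h h' ⊢
  have hsub : ∀ z, frame x n σ z - frame x n σ w = ζ ^ n * flip σ (z - w) := fun z => by
    simp only [frame_apply, flip_sub]; ring
  cases σ
  · simp only [localSec, cond_false] at h h' ⊢
    have h'' : ¬ SideCov w (j + 11 * n + 11) := by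
      rwa [show j + 11 * n + 11 = j + 11 + 11 * n by ring]
    rcases h.first h'' with ⟨k, rfl, hk⟩ | ⟨k, hk, hj, hl⟩
    · exact Or.inl ⟨k, rfl, by simp only [startSec, cond_false]; omega⟩
    · refine Or.inr ⟨?_, fun i => ⟨fun hi => ?_, fun hi l => ?_⟩⟩
      · rintro _ ⟨z, hz, rfl⟩
        rw [hsub, slope_congr (show j % 12 = (n + dirIdx k) % 12 by omega)]
        simp only [flip, cond_false, slope_ζ_pow_mul]
        have := mem_pentagon_iff.1 hz k
        rw [show z = w + (z - w) by ring, side_add, hk, zero_add] at this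
        exact this
      · have := ((hi k).resolve_left (by simp [hk])).2
        omega
      · by_cases hlk : l = k
        · subst hlk; exact Or.inr ⟨hk, by omega⟩
        · exact Or.inl (hl l hlk)
  · simp only [localSec, cond_true] at h h' ⊢
    have h'' : ¬ SideCov w (n + 11 * j + 11 + 1) := by
      intro h3
      apply h'
      rw [← cov_pentagon_iff] at h3 ⊢
      exact h3.congr (by omega)
    have hsum : ∀ k i, (n + 11 * j + 11) % 12 = (dirIdx k + 5) % 12 →
        ((11 * dirIdx k + (n + 11 * i + 11)) + (11 * j + i)) % 12 = 5 := by
      intro k i hj; omega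
    have aux : ∀ {X Y : ℕ}, (X + Y) % 12 = 5 → X % 12 < 6 → Y % 12 < 6 := by
      intro X Y; omega
    rcases h.last h'' with ⟨k, rfl, hk⟩ | ⟨k, hk, hj, hl⟩
    · exact Or.inl ⟨k, rfl, by simp only [startSec, cond_true, lastIdx] at hk ⊢; omega⟩
    · refine Or.inr ⟨?_, fun i => ⟨fun hi => ?_, fun hi l => ?_⟩⟩
      · rintro _ ⟨z, hz, rfl⟩
        rw [hsub, slope_congr (show j % 12 = (n + (6 + 11 * dirIdx k)) % 12 by omega)]
        simp only [flip, cond_true, slope_ζ_pow_mul, slope_conj]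
        have := mem_pentagon_iff.1 hz k
        rw [show z = w + (z - w) by ring, side_add, hk, zero_add] at this
        exact this
      · exact aux (hsum k i hj) ((hi k).resolve_left (by simp [hk])).2
      · by_cases hlk : l = k
        · subst hlk
          exact Or.inr ⟨hk, aux ((congrArg (· % 12) (Nat.add_comm _ _)).trans (hsum l i hj)) hi⟩
        · exact Or.inl (hl l hlk)

/-! ### The pentagon has no symmetries -/

/-- A point of the convex hull of a set that lies on a circle enclosing the set belongs to the
set. -/
lemma mem_of_mem_sphere {S : Set ℂ} {w : ℂ} {M : ℝ} (hS : S ⊆ Metric.closedBall w M) {z : ℂ}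
    (hz : z ∈ convexHull ℝ S) (h : M ≤ dist z w) : z ∈ S := by
  have h2 := convexHull_min hS (convex_closedBall w M)
  have h3 : z ∈ Metric.sphere w M := le_antisymm (h2 hz) h
  rw [← StrictConvexSpace.extremePoints_closedBall_eq_sphere] at h3
  exact extremePoints_convexHull_subset
    (inter_extremePoints_subset_extremePoints_of_subset h2 ⟨hz, h3⟩)

/-- The most distant pairs of points of the convex hull of a set are pairs of points of the
set. -/
lemma mem_of_dist_max {S : Set ℂ} {M : ℝ} (hS : ∀ a ∈ S, ∀ b ∈ S, dist a b ≤ M)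
    {z w : ℂ} (hz : z ∈ convexHull ℝ S) (hw : w ∈ convexHull ℝ S) (h : M ≤ dist z w) :
    z ∈ S := by
  have h1 : ∀ a ∈ S, convexHull ℝ S ⊆ Metric.closedBall a M := fun a ha =>
    convexHull_min (fun b hb => hS b hb a ha) (convex_closedBall a M)
  exact mem_of_mem_sphere (fun a ha => Metric.mem_closedBall_comm.1 (h1 a ha hw)) hz h

lemma dist_sq_coord (x y x' y' : ℝ) :
    dist (⟨x, √3 * y⟩ : ℂ) ⟨x', √3 * y'⟩ ^ 2 = (x - x') ^ 2 + 3 * (y - y') ^ 2 := by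
  have h := sqrt_three_mul_self
  rw [dist_eq_norm, ← Complex.normSq_eq_norm_sq, Complex.normSq_apply]
  simp
  linear_combination (y - y') ^ 2 * h


lemma dist_vertex_le (k l : Corner) : dist (vertex k) (vertex l) ≤ √3 := by
  refine Real.le_sqrt_of_sq_le ?_
  rw [vertex_coord, vertex_coord]
  cases k <;> cases l <;> simp only [dist_sq_coord] <;> norm_num

lemma eq_vertex_of_dist_eq {k l : Corner} (h : dist (vertex k) (vertex l) = √3) :
    (k = A ∧ l = C) ∨ (k = C ∧ l = A) := by
  have h2 : dist (vertex k) (vertex l) ^ 2 = 3 := by rw [h]; norm_num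
  rw [vertex_coord, vertex_coord] at h2
  cases k <;> cases l <;> simp only [dist_sq_coord] at h2 <;> norm_num at h2 <;> simp

/-- The diagonal `AC` is the diameter of the pentagon, and the distances to its ends determine
the corner `E`; hence the pentagon has no nontrivial symmetry. -/
lemma eq_of_image_pentagon {g : ℂ ≃ᵢ ℂ} (hg : g '' pentagon = pentagon) (z : ℂ) : g z = z := by
  have h3 := sqrt_three_mul_self
  have hmem : ∀ k, g (vertex k) ∈ pentagon := fun k => by
    rw [← hg]; exact ⟨_, vertex_mem_pentagon k, rfl⟩
  have hS : ∀ a ∈ Set.range vertex, ∀ b ∈ Set.range vertex, dist a b ≤ √3 := by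
    rintro _ ⟨k, rfl⟩ _ ⟨l, rfl⟩; exact dist_vertex_le k l
  have hAC : dist (vertex A) (vertex C) = √3 := by
    have h : dist (vertex A) (vertex C) ^ 2 = 3 := by
      rw [vertex_coord, vertex_coord]; simp only [dist_sq_coord]; norm_num
    rw [← Real.sqrt_sq (dist_nonneg (x := vertex A)), h]
  have hd : dist (g (vertex A)) (g (vertex C)) = √3 := by rw [g.dist_eq, hAC]
  obtain ⟨k, hk⟩ := mem_of_dist_max hS (hmem A) (hmem C) hd.ge
  obtain ⟨l, hl⟩ := mem_of_dist_max hS (hmem C) (hmem A) (by rw [dist_comm]; exact hd.ge)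
  rw [← hk, ← hl] at hd
  obtain ⟨x, y, hE⟩ := exists_coord (g (vertex E))
  have hm := mem_pentagon_iff.1 (hmem E)
  have d1 : dist (g (vertex E)) (g (vertex A)) ^ 2 = 1 / 3 := by
    rw [g.dist_eq, vertex_coord, vertex_coord]; simp only [dist_sq_coord]; norm_num
  have d2 : dist (g (vertex E)) (g (vertex C)) ^ 2 = 7 / 3 := by
    rw [g.dist_eq, vertex_coord, vertex_coord]; simp only [dist_sq_coord]; norm_num
  rw [hE, ← hk, vertex_coord] at d1
  rw [hE, ← hl, vertex_coord] at d2
  simp only [hE, side_nonneg_coord] at hm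
  have hmA := hm A
  have hmB := hm B
  have hmC := hm C
  simp only [rside] at hmA hmB hmC
  rcases eq_vertex_of_dist_eq hd with ⟨rfl, rfl⟩ | ⟨rfl, rfl⟩
  · simp only [dist_sq_coord] at d1 d2
    have hx : x = 1 / 3 + y := by linarith
    subst hx
    have hy : (6 * y - 1) * (3 * y + 1) = 0 := by linarith
    have hy6 : y = 1 / 6 := by
      rcases mul_eq_zero.1 hy with h | h <;> linarith
    subst hy6
    have hgE : g (vertex E) = vertex E := by
      rw [hE]; apply Complex.ext <;> simp [vertex] <;> ring
    obtain ⟨x₀, a, ha, σ, rfl⟩ := exists_motion g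
    simp only [motion_apply] at hk hl hgE ⊢
    have hx₀ : x₀ = 0 := by
      have : vertex A = 0 := rfl
      rw [this] at hk
      cases σ <;> simpa [flip] using hk.symm
    subst hx₀
    have hEne : vertex E ≠ 0 := fun h => by
      have := congrArg Complex.re h; simp [vertex] at this
    cases σ
    · simp only [flip, cond_false, zero_add] at hgE ⊢
      rw [mul_eq_right₀ hEne] at hgE
      rw [hgE, one_mul]
    · simp only [flip, cond_true, zero_add] at hgE hl ⊢
      exfalso
      have e : vertex C * conj (vertex E) = vertex E * conj (vertex C) := by
        linear_combination conj (vertex E) * hl + conj (vertex C) * hgE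
      have := congrArg Complex.im e
      simp [vertex] at this
      nlinarith [sqrt_three_pos]
  · exfalso
    simp only [dist_sq_coord] at d1 d2
    have hx : x = 5 / 3 + y := by linarith
    subst hx
    nlinarith

lemma congr_of_image_pentagon_eq {g g' : ℂ ≃ᵢ ℂ} (h : g '' pentagon = g' '' pentagon) :
    g = g' := by
  refine IsometryEquiv.ext fun z => ?_
  have h1 : (g.trans g'.symm) '' pentagon = pentagon := by
    rw [show ⇑(g.trans g'.symm) = g'.symm ∘ g from rfl, Set.image_comp, h, ← Set.image_comp]
    simp
  have h2 := eq_of_image_pentagon h1 z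
  rw [IsometryEquiv.trans_apply] at h2
  rw [← g'.symm.injective.eq_iff, h2, g'.symm_apply_apply]

lemma isCorner_image {g : ℂ ≃ᵢ ℂ} {k : Corner} {p : ℂ} :
    IsCorner (g '' pentagon) k p ↔ g (vertex k) = p := by
  constructor
  · rintro ⟨g', h1, h2⟩
    rw [← congr_of_image_pentagon_eq h1, h2]
  · exact fun h => ⟨g, rfl, h⟩

lemma vertex_injective : Function.Injective vertex := by
  intro k l h
  have h1 := congrArg Complex.re h
  have h2 := congrArg Complex.im h
  have := sqrt_three_pos
  cases k <;> cases l <;> simp [vertex] at h1 h2 <;> first | rfl | (exfalso; linarith)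

/-! ### Tilings by the pentagon -/

lemma image_interior_congr (g : ℂ ≃ᵢ ℂ) (s : Set ℂ) : interior (g '' s) = g '' interior s :=
  (g.toHomeomorph.image_interior s).symm

namespace IsTHTiling

variable {T : Set (Set ℂ)}

lemma exists_congr (hT : IsTHTiling T) {t : Set ℂ} (ht : t ∈ T) :
    ∃ g : ℂ ≃ᵢ ℂ, t = g '' pentagon := by
  obtain ⟨_, rfl, g, hg⟩ := hT.1 t ht
  exact ⟨g, hg.symm⟩

lemma isClosed (hT : IsTHTiling T) {t : Set ℂ} (ht : t ∈ T) : IsClosed t := by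
  obtain ⟨g, rfl⟩ := hT.exists_congr ht
  exact (isCompact_pentagon.image g.continuous).isClosed

lemma nonempty_interior (hT : IsTHTiling T) {t : Set ℂ} (ht : t ∈ T) :
    (interior t).Nonempty := by
  obtain ⟨g, rfl⟩ := hT.exists_congr ht
  rw [image_interior_congr]
  exact nonempty_interior_pentagon.image g

lemma eq_of_mem_interior (hT : IsTHTiling T) {t u : Set ℂ} (ht : t ∈ T) (hu : u ∈ T) {z : ℂ}
    (hzt : z ∈ interior t) (hzu : z ∈ interior u) : t = u := by
  by_contra h
  exact Set.disjoint_left.1 (hT.2.1 ht hu h) hzt hzu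

lemma exists_mem (hT : IsTHTiling T) (z : ℂ) : ∃ t ∈ T, z ∈ t := by
  have : z ∈ ⋃₀ T := by rw [hT.2.2]; trivial
  exact this

lemma countable (hT : IsTHTiling T) : T.Countable :=
  Set.PairwiseDisjoint.countable_of_isOpen (s := interior) hT.2.1
    (fun _ _ => isOpen_interior) (fun _ h => hT.nonempty_interior h)

/-- Tiles contain disjoint disks of a fixed radius, so only finitely many of them meet a given
disk. -/
lemma finite_meet_ball (hT : IsTHTiling T) (p : ℂ) :
    {t | t ∈ T ∧ (t ∩ Metric.ball p 1).Nonempty}.Finite := by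
  obtain ⟨c, hc⟩ := nonempty_interior_pentagon
  obtain ⟨ρ, hρ, hball⟩ := Metric.isOpen_iff.1 isOpen_interior c hc
  obtain ⟨R, hR⟩ := isCompact_pentagon.isBounded.subset_closedBall c
  choose! g hg using fun t (ht : t ∈ T) => hT.exists_congr ht
  obtain ⟨F, -, hF, hcov⟩ := (isCompact_closedBall p (1 + R)).finite_cover_balls
    (half_pos hρ)
  have hin : ∀ t ∈ T, ∀ z, dist z (g t c) < ρ → z ∈ interior t := by
    intro t ht z hz
    rw [hg t ht, image_interior_congr]
    refine ⟨(g t).symm z, hball ?_, by simp⟩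
    rw [Metric.mem_ball, ← (g t).dist_eq]; simpa using hz
  have hex : ∀ t ∈ {t | t ∈ T ∧ (t ∩ Metric.ball p 1).Nonempty},
      ∃ y ∈ F, dist (g t c) y < ρ / 2 := by
    rintro t ⟨ht, z, hzt, hzp⟩
    have h1 : g t c ∈ Metric.closedBall p (1 + R) := by
      rw [hg t ht] at hzt
      obtain ⟨w, hw, rfl⟩ := hzt
      have h2 := hR hw
      rw [Metric.mem_closedBall, ← (g t).dist_eq] at h2
      rw [Metric.mem_ball] at hzp
      rw [Metric.mem_closedBall]
      have h3 := dist_triangle (g t c) (g t w) p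
      rw [dist_comm (g t c) (g t w)] at h3
      linarith
    have := hcov h1
    simp only [Set.mem_iUnion, Metric.mem_ball, exists_prop] at this
    exact this
  choose! y hyF hy using hex
  refine Set.Finite.of_finite_image (hF.subset (Set.image_subset_iff.2 hyF)) (f := y) ?_
  intro t ht u hu htu
  refine hT.eq_of_mem_interior ht.1 hu.1 (z := g t c) (hin t ht.1 _ (by simpa using hρ))
    (hin u hu.1 _ ?_)
  have h1 := hy t ht
  have h2 := hy u hu
  rw [← htu] at h2
  have h3 := dist_triangle_right (g t c) (g u c) (y t)
  linarith

lemma locallyFinite (hT : IsTHTiling T) : LocallyFinite (fun t : T => (t : Set ℂ)) := by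
  intro p
  refine ⟨Metric.ball p 1, Metric.ball_mem_nhds p one_pos, ?_⟩
  refine Set.Finite.of_finite_image ((hT.finite_meet_ball p).subset ?_)
    Subtype.val_injective.injOn
  rintro _ ⟨t, ht, rfl⟩
  exact ⟨t.2, ht⟩

lemma exists_segment (hT : IsTHTiling T) (p m : ℂ) :
    ∃ t ∈ T, p ∈ t ∧ ∃ r : ℝ, 0 < r ∧ p + r * m ∈ t := by
  set F := {t | t ∈ T ∧ (t ∩ Metric.ball p 1).Nonempty} with hF
  have htend : Tendsto (fun r : ℝ => p + r * m) (𝓝[>] 0) (𝓝 p) := by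
    have : Continuous (fun r : ℝ => p + r * m) := by fun_prop
    have h := (this.tendsto 0).mono_left (nhdsWithin_le_nhds (s := Set.Ioi 0))
    simpa using h
  have key : ∃ t ∈ F, ∃ᶠ r : ℝ in 𝓝[>] 0, p + r * m ∈ t := by
    by_contra hcon
    push Not at hcon
    have h1 := (eventually_all_finite (hT.finite_meet_ball p)).2 hcon
    have h2 := htend.eventually (Metric.ball_mem_nhds p one_pos)
    obtain ⟨r, hr1, hr2⟩ := (h1.and h2).exists
    obtain ⟨t, ht, hmem⟩ := hT.exists_mem (p + r * m)
    exact hr1 t ⟨ht, _, hmem, hr2⟩ hmem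
  obtain ⟨t, ht, hfr⟩ := key
  refine ⟨t, ht.1, ?_, ?_⟩
  · rw [← (hT.isClosed ht.1).closure_eq]
    exact mem_closure_of_frequently_of_tendsto hfr htend
  · obtain ⟨r, hr, h0⟩ := (hfr.and_eventually self_mem_nhdsWithin).exists
    exact ⟨r, h0, hr⟩

lemma exists_cov (hT : IsTHTiling T) (p : ℂ) (j : ℕ) : ∃ t ∈ T, Cov t p j := by
  obtain ⟨t, ht, h⟩ := hT.exists_segment p (mid j)
  exact ⟨t, ht, h⟩

lemma eq_of_cov (hT : IsTHTiling T) {t u : Set ℂ} (ht : t ∈ T) (hu : u ∈ T)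
    (hat : Aligned t) (hau : Aligned u) {p : ℂ} {j : ℕ} (h1 : Cov t p j) (h2 : Cov u p j) :
    t = u := by
  obtain ⟨r, hr1, hr2⟩ :=
    ((hat.eventually_mem_interior h1).and (hau.eventually_mem_interior h2)).exists
  exact hT.eq_of_mem_interior ht hu hr1 hr2

lemma countable_vertices (hT : IsTHTiling T) : {p | IsVertex T p}.Countable := by
  choose! g hg using fun t (ht : t ∈ T) => hT.exists_congr ht
  refine (hT.countable.biUnion (t := fun t _ => g t '' Set.range vertex) fun t _ =>
    (finite_range_vertex.image _).countable).mono ?_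
  rintro p ⟨t, ht, k, hk⟩
  rw [hg t ht, isCorner_image] at hk
  exact Set.mem_biUnion ht ⟨_, ⟨k, rfl⟩, hk⟩

/-- A property of tiles that is inherited by neighbours holds for all tiles, if it holds for one:
the complement of the countable set of vertices is connected, and it is covered by the closed union
of the tiles with the property and the closed union of the other ones. -/
lemma forall_of_neighbours (hT : IsTHTiling T) {P : Set ℂ → Prop} {t₀ : Set ℂ} (h₀ : t₀ ∈ T)
    (hP₀ : P t₀)
    (hP : ∀ t ∈ T, ∀ u ∈ T, P t → ∀ q ∈ t, q ∈ u → ¬ IsVertex T q → P u) : ∀ t ∈ T, P t := by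
  by_contra hcon
  push Not at hcon
  obtain ⟨t₁, h₁, hP₁⟩ := hcon
  have hclosed : ∀ R : Set ℂ → Prop, IsClosed (⋃ t : {t : T // R t}, (t.1 : Set ℂ)) := fun R =>
    (hT.locallyFinite.comp_injective Subtype.val_injective).isClosed_iUnion
      (fun t => hT.isClosed t.1.2)
  have hrank : 1 < Module.rank ℝ ℂ := by rw [Complex.rank_real_complex]; norm_num
  have hconn := (hT.countable_vertices.isConnected_compl_of_one_lt_rank hrank).isPreconnected
  have hdense := hT.countable_vertices.dense_compl ℝ
  have hmeet : ∀ t ∈ T, ({p | IsVertex T p}ᶜ ∩ t).Nonempty := fun t ht => by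
    obtain ⟨z, hz1, hz2⟩ := hdense.inter_open_nonempty _ isOpen_interior (hT.nonempty_interior ht)
    exact ⟨z, hz2, interior_subset hz1⟩
  obtain ⟨q, hq, hqU, hqV⟩ := isPreconnected_closed_iff.1 hconn _ _ (hclosed P)
    (hclosed fun t => ¬ P t)
    (fun z _ => by
      obtain ⟨t, ht, hz⟩ := hT.exists_mem z
      by_cases h : P t
      · exact Or.inl (Set.mem_iUnion.2 ⟨⟨⟨t, ht⟩, h⟩, hz⟩)
      · exact Or.inr (Set.mem_iUnion.2 ⟨⟨⟨t, ht⟩, h⟩, hz⟩))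
    (by
      obtain ⟨z, hz1, hz2⟩ := hmeet t₀ h₀
      exact ⟨z, hz1, Set.mem_iUnion.2 ⟨⟨⟨t₀, h₀⟩, hP₀⟩, hz2⟩⟩)
    (by
      obtain ⟨z, hz1, hz2⟩ := hmeet t₁ h₁
      exact ⟨z, hz1, Set.mem_iUnion.2 ⟨⟨⟨t₁, h₁⟩, hP₁⟩, hz2⟩⟩)
  obtain ⟨⟨⟨t, ht⟩, hPt⟩, hqt⟩ := Set.mem_iUnion.1 hqU
  obtain ⟨⟨⟨u, hu⟩, hPu⟩, hqu⟩ := Set.mem_iUnion.1 hqV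
  exact hPu (hP t ht u hu hPt q hqt hqu hq)

end IsTHTiling

/-- At a point of the pentagon that is not a corner at most one side vanishes. -/
lemma exists_side_of_ne_vertex {w : ℂ} (hw : w ∈ pentagon) (hv : ∀ k, w ≠ vertex k) :
    ∃ k, ∀ l, l ≠ k → 0 < side l w := by
  have hw' := mem_pentagon_iff.1 hw
  by_cases h : ∃ k, side k w = 0
  · obtain ⟨k, hk⟩ := h
    refine ⟨k, fun l hl => (hw' l).lt_of_ne' fun h0 => ?_⟩
    rcases eq_vertex_of_side_eq_zero hw' hl hk h0 with ⟨h1, -⟩ | ⟨h1, -⟩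
    · exact hv _ h1
    · exact hv _ h1
  · push Not at h
    exact ⟨A, fun l _ => (hw' l).lt_of_ne' (h l)⟩

lemma slope_eq_re (d : ℕ) (m : ℂ) : slope d m = (conj (ζ ^ (d + 3)) * m).re := by
  rw [slope, pow_add, map_mul, ζ_pow_three]
  simp; ring

/-- Near a point that is no corner, a tile contains a half plane, whose inner normal makes an angle
with the linear part of the congruence that is a multiple of `30°`. -/
lemma exists_normal {x a : ℂ} (ha : ‖a‖ = 1) (σ : Bool) {w : ℂ} (hw : w ∈ pentagon)
    (hv : ∀ k, w ≠ vertex k) : ∃ v : ℕ, ∀ m : ℂ, 0 < (conj (a * ζ ^ v) * m).re →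
      ∀ᶠ r : ℝ in 𝓝[>] 0, motion x a ha σ w + r * m ∈ interior (motion x a ha σ '' pentagon) := by
  obtain ⟨k, hk⟩ := exists_side_of_ne_vertex hw hv
  have haa : a * conj a = 1 := by rw [Complex.mul_conj, Complex.normSq_eq_norm_sq, ha]; simp
  refine ⟨bif σ then 11 * (dirIdx k + 3) else dirIdx k + 3, fun m hm => ?_⟩
  have hs : 0 < slope (dirIdx k) (flip σ (conj a * m)) := by
    rw [slope_eq_re]
    cases σ
    · simp only [flip, cond_false] at hm ⊢
      convert hm using 2
      simp only [map_mul]; ring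
    · simp only [flip, cond_true] at hm ⊢
      rw [← Complex.conj_re]
      convert hm using 2
      simp only [map_mul, conj_ζ_pow, Complex.conj_conj]
      rw [ζ_pow_congr (show (11 * (11 * (dirIdx k + 3))) % 12 = (dirIdx k + 3) % 12 by omega)]
      ring
  have hsides := mem_pentagon_iff.1 hw
  have h1 := eventually_side_pos (w := w) (m := flip σ (conj a * m)) fun l => by
    by_cases hl : l = k
    · subst hl
      rcases (hsides l).lt_or_eq with h | h
      · exact Or.inl h
      · exact Or.inr ⟨h.symm, hs⟩
    · exact Or.inl (hk l hl)
  filter_upwards [h1] with r hr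
  rw [image_interior_congr]
  refine ⟨_, mem_interior_pentagon hr, ?_⟩
  rw [motion_add, flip_real_mul, flip_flip]
  linear_combination (r * m) * haa

/-- All tiles of a tiling that contains the pentagon itself are aligned. -/
lemma IsTHTiling.aligned {T : Set (Set ℂ)} (hT : IsTHTiling T) (h₀ : pentagon ∈ T) :
    ∀ t ∈ T, Aligned t := by
  refine hT.forall_of_neighbours h₀ aligned_pentagon ?_
  rintro t ht u hu ⟨x, n, σ, rfl⟩ q hqt hqu hq
  by_cases htu : frame x n σ '' pentagon = u
  · exact ⟨x, n, σ, htu.symm⟩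
  obtain ⟨g, rfl⟩ := hT.exists_congr hu
  obtain ⟨y, a, ha, τ, rfl⟩ := exists_motion g
  obtain ⟨w, hw, rfl⟩ := hqt
  obtain ⟨w', hw', hww⟩ := hqu
  obtain ⟨v, hv⟩ := exists_normal (x := x) (norm_ζ_pow n) σ hw fun k hk =>
    hq ⟨_, ht, k, isCorner_image.2 (by rw [hk])⟩
  obtain ⟨v', hv'⟩ := exists_normal (x := y) ha τ hw' fun k hk =>
    hq ⟨_, hu, k, isCorner_image.2 (by rw [← hww, hk])⟩
  rw [hww] at hv'
  set N := ζ ^ n * ζ ^ v with hN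
  set N' := a * ζ ^ v' with hN'
  have hN1 : ‖N‖ = 1 := by rw [hN, norm_mul, norm_ζ_pow, norm_ζ_pow, one_mul]
  have hN1' : ‖N'‖ = 1 := by rw [hN', norm_mul, ha, norm_ζ_pow, one_mul]
  have hopp : N' = -N := by
    by_contra hne
    have hpos : 0 < ‖N + N'‖ := norm_pos_iff.2 fun h => hne (eq_neg_of_add_eq_zero_right h)
    have h2 : ‖N + N'‖ ^ 2 = 2 + 2 * (conj N * N').re := by
      rw [← Complex.normSq_eq_norm_sq, Complex.normSq_add, Complex.normSq_eq_norm_sq,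
        Complex.normSq_eq_norm_sq, hN1, hN1', ← Complex.conj_re (N * _)]
      simp; ring
    have e1 : conj N * N = 1 := by
      rw [mul_comm, Complex.mul_conj, Complex.normSq_eq_norm_sq, hN1]; simp
    have e2 : conj N' * N' = 1 := by
      rw [mul_comm, Complex.mul_conj, Complex.normSq_eq_norm_sq, hN1']; simp
    have e3 : (conj N' * N).re = (conj N * N').re := by
      rw [← Complex.conj_re]; simp; ring
    have p1 : 0 < (conj N * (N + N')).re := by
      rw [mul_add, e1, Complex.add_re, Complex.one_re]; nlinarith
    have p2 : 0 < (conj N' * (N + N')).re := by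
      rw [mul_add, e2, Complex.add_re, Complex.one_re, e3]; nlinarith
    obtain ⟨r, hr1, hr2⟩ := ((hv _ p1).and (hv' _ p2)).exists
    exact htu (hT.eq_of_mem_interior ht hu hr1 hr2)
  have haζ : a = ζ ^ (6 + n + v + 11 * v') := by
    have h1 : ζ ^ v' * ζ ^ (11 * v') = 1 := by
      rw [← pow_add, ← ζ_pow_mod, show (v' + 11 * v') % 12 = 0 by omega, pow_zero]
    rw [pow_add, pow_add, pow_add, ζ_pow_six]
    linear_combination ζ ^ (11 * v') * hopp - a * h1
  exact ⟨y, 6 + n + v + 11 * v', τ, by subst haζ; rfl⟩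

/-! ### Lattice points -/

/-- Integer coordinates with respect to the powers `1, ζ, ζ², ζ³`, in units of the short side
`1 / √3` of the pentagon. -/
structure Pt where
  a : ℤ
  b : ℤ
  c : ℤ
  d : ℤ
deriving DecidableEq

namespace Pt

/-- The point with the given coordinates. -/
noncomputable def ev (w : Pt) : ℂ :=
  (1 / √3 : ℝ) * (w.a + w.b * ζ + w.c * ζ ^ 2 + w.d * ζ ^ 3)

/-- Addition of coordinates. -/
def add (v w : Pt) : Pt := ⟨v.a + w.a, v.b + w.b, v.c + w.c, v.d + w.d⟩

/-- Subtraction of coordinates. -/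
def sub (v w : Pt) : Pt := ⟨v.a - w.a, v.b - w.b, v.c - w.c, v.d - w.d⟩

/-- Multiplication by `ζ`. -/
def mulζ (w : Pt) : Pt := ⟨-w.d, w.a, w.b + w.d, w.c⟩

/-- Multiplication by `ζ ^ n`. -/
def rot (n : ℕ) (w : Pt) : Pt := mulζ^[n % 12] w

/-- Complex conjugation if `σ`. -/
def flip (σ : Bool) (w : Pt) : Pt :=
  bif σ then ⟨w.a + w.c, w.b, -w.c, -w.b - w.d⟩ else w

lemma ζ_four_eq : ζ ^ 4 = ζ ^ 2 - 1 := by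
  rw [ζ_pow_four, ζ_sq]; apply Complex.ext <;> simp; norm_num

lemma ev_add (v w : Pt) : (v.add w).ev = v.ev + w.ev := by
  simp only [ev, add]; push_cast; ring

lemma ev_sub (v w : Pt) : (v.sub w).ev = v.ev - w.ev := by
  simp only [ev, sub]; push_cast; ring

lemma ev_mulζ (w : Pt) : w.mulζ.ev = ζ * w.ev := by
  simp only [ev, mulζ]; push_cast
  linear_combination (-(1 / (√3 : ℂ)) * w.d) * ζ_four_eq

lemma ev_rot (n : ℕ) (w : Pt) : (w.rot n).ev = ζ ^ n * w.ev := by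
  have h : ∀ m, (mulζ^[m] w).ev = ζ ^ m * w.ev := fun m => by
    induction m with
    | zero => simp
    | succ m ih => rw [Function.iterate_succ_apply', ev_mulζ, ih, pow_succ]; ring
  rw [rot, h, ζ_pow_mod]

lemma ev_flip (σ : Bool) (w : Pt) : (w.flip σ).ev = THPentagon.flip σ w.ev := by
  cases σ
  · rfl
  · have h1 : conj ζ = ζ - ζ ^ 3 := by
      rw [ζ_pow_three, ζ]; apply Complex.ext <;> simp; norm_num
    have h2 : conj ζ ^ 2 = 1 - ζ ^ 2 := by
      rw [← map_pow, ζ_sq]; apply Complex.ext <;> simp; norm_num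
    have h3 : conj ζ ^ 3 = - ζ ^ 3 := by
      rw [← map_pow, ζ_pow_three]; apply Complex.ext <;> simp
    simp only [flip, THPentagon.flip, cond_true, ev, map_mul, map_add, Complex.conj_ofReal,
      map_intCast, map_pow, h2, h3]
    rw [h1]
    push_cast; ring

/-- The coordinates of the corners of the pentagon. -/
def vtx : Corner → Pt
  | A => ⟨0, 0, 0, 0⟩
  | B => ⟨0, 1, 0, -2⟩
  | C => ⟨0, 3, 0, -3⟩
  | D => ⟨0, 2, 0, -1⟩
  | E => ⟨0, 1, 0, 0⟩

lemma ev_re (w : Pt) : w.ev.re = 1 / √3 * (w.a + w.b * (√3 / 2) + w.c / 2) := by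
  rw [ev, Complex.re_ofReal_mul, ζ_sq, ζ_pow_three]
  simp [ζ]; ring

lemma ev_im (w : Pt) : w.ev.im = 1 / √3 * (w.b / 2 + w.c * (√3 / 2) + w.d) := by
  rw [ev, Complex.im_ofReal_mul, ζ_sq, ζ_pow_three]
  simp [ζ]; ring

lemma ev_vtx (k : Corner) : (vtx k).ev = vertex k := by
  have h := sqrt_three_mul_self
  have h0 := sqrt_three_pos
  cases k <;> apply Complex.ext <;> simp only [ev_re, ev_im, vtx, vertex] <;> push_cast <;>
    field_simp <;> nlinarith

/-- The sides at `w` are `(p + q √3) / (2 √3)` with these integers `p`, `q`. -/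
def side : Corner → Pt → ℤ × ℤ
  | A, w => (2 * w.b + w.d, w.a + w.c)
  | B, w => (w.b + 2 * w.d + 3, w.c)
  | C, w => (3 - 2 * w.b - w.d, - w.a - w.c)
  | D, w => (- w.a - 2 * w.c, 1 - w.b - w.d)
  | E, w => (w.a - w.c, - w.d)

lemma side_ev (k : Corner) (w : Pt) :
    THPentagon.side k w.ev = 1 / (2 * √3) * ((side k w).1 + (side k w).2 * √3) := by
  have h := sqrt_three_mul_self
  have h0 := sqrt_three_pos
  cases k <;> simp only [THPentagon.side, side, ev_re, ev_im] <;> push_cast <;> field_simp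
  · linear_combination w.b * h
  · nlinarith
  · linear_combination (2 - w.b) * h
  · linear_combination (-w.c) * h
  · linear_combination (-w.c) * h

/-- Decides `0 < p + q √3`. -/
def pos (p q : ℤ) : Bool :=
  if q = 0 then decide (0 < p)
  else if 0 < q then decide (0 ≤ p) || decide (p * p < 3 * (q * q))
  else decide (0 < p) && decide (3 * (q * q) < p * p)

lemma pos_iff (p q : ℤ) : pos p q = true ↔ (0 : ℝ) < p + q * √3 := by
  have h := sqrt_three_mul_self
  have h0 := sqrt_three_pos
  have key : ((p : ℝ) + q * √3) * (p - q * √3) = p * p - 3 * (q * q) := by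
    linear_combination (-(q * q : ℝ)) * h
  unfold pos
  split_ifs with h1 h2
  · simp [h1]
  · have hq : (0 : ℝ) < q := by exact_mod_cast h2
    have hq3 : 0 < q * √3 := by positivity
    simp only [Bool.or_eq_true, decide_eq_true_eq]
    constructor
    · rintro (hp | hp)
      · have : (0 : ℝ) ≤ p := by exact_mod_cast hp
        positivity
      · have hp' : (p * p : ℝ) < 3 * (q * q) := by exact_mod_cast hp
        by_contra hn
        nlinarith
    · intro hp
      by_contra! hcon
      have h3 : (p : ℝ) < 0 := by exact_mod_cast hcon.1
      have h4 : (3 * (q * q) : ℝ) ≤ p * p := by exact_mod_cast hcon.2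
      nlinarith
  · have hq : (q : ℝ) < 0 := by exact_mod_cast lt_of_le_of_ne (not_lt.1 h2) h1
    have hq3 : q * √3 < 0 := mul_neg_of_neg_of_pos hq h0
    simp only [Bool.and_eq_true, decide_eq_true_eq]
    constructor
    · rintro ⟨hp, hp2⟩
      have h3 : (0 : ℝ) < p := by exact_mod_cast hp
      have h4 : (3 * (q * q) : ℝ) < p * p := by exact_mod_cast hp2
      by_contra hn
      nlinarith
    · intro hp
      have h3 : (0 : ℝ) < p := by linarith
      refine ⟨by exact_mod_cast h3, ?_⟩
      have : (3 * (q * q) : ℝ) < p * p := by nlinarith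
      exact_mod_cast this

lemma eq_zero_iff (p q : ℤ) : (p = 0 ∧ q = 0) ↔ (p : ℝ) + q * √3 = 0 := by
  have h := sqrt_three_mul_self
  refine ⟨fun ⟨h1, h2⟩ => by simp [h1, h2], fun h1 => ?_⟩
  have hirr : Irrational √3 := by
    simpa using (Nat.Prime.irrational_sqrt (show Nat.Prime 3 by norm_num))
  have hq : q = 0 := by
    by_contra hq
    apply hirr
    have hq' : (q : ℝ) ≠ 0 := by exact_mod_cast hq
    refine ⟨-p / q, ?_⟩
    push_cast
    field_simp
    linarith
  subst hq
  simpa using h1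

/-- Decides `SideCov`. -/
def sideCov (w : Pt) (j : ℕ) : Bool :=
  [A, B, C, D, E].all fun k =>
    pos (side k w).1 (side k w).2 ||
      (decide ((side k w).1 = 0) && decide ((side k w).2 = 0) &&
        decide ((11 * dirIdx k + j) % 12 < 6))

lemma sideCov_iff (w : Pt) (j : ℕ) : w.sideCov j = true ↔ SideCov w.ev j := by
  have h0 : (0 : ℝ) < 1 / (2 * √3) := by have := sqrt_three_pos; positivity
  have hk : ∀ k, (pos (side k w).1 (side k w).2 || (decide ((side k w).1 = 0) &&
      decide ((side k w).2 = 0) && decide ((11 * dirIdx k + j) % 12 < 6))) = true ↔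
      (0 < THPentagon.side k w.ev ∨ (THPentagon.side k w.ev = 0 ∧
        (11 * dirIdx k + j) % 12 < 6)) := fun k => by
    rw [side_ev, mul_pos_iff_of_pos_left h0, mul_eq_zero_iff_left h0.ne', ← pos_iff,
      ← eq_zero_iff]
    simp only [Bool.or_eq_true, Bool.and_eq_true, decide_eq_true_eq]
  simp only [sideCov, List.all_cons, List.all_nil, Bool.and_true, Bool.and_eq_true, hk, SideCov]
  exact ⟨fun h k => by cases k; exacts [h.1, h.2.1, h.2.2.1, h.2.2.2.1, h.2.2.2.2],
    fun h => ⟨h A, h B, h C, h D, h E⟩⟩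

/-- Decides whether `w` or a point close to it in the sector `j` lies to the left of the line
through `0` with direction `ζ ^ d`. -/
def leftOf (w : Pt) (d j : ℕ) : Bool :=
  let v := w.rot (11 * d)
  pos (v.b + 2 * v.d) v.c ||
    (decide (v.b + 2 * v.d = 0) && decide (v.c = 0) && decide ((11 * d + j) % 12 < 6))

lemma leftOf_of_slope {w : Pt} {d j : ℕ} {r : ℝ} (hr : 0 < r) (h : 0 ≤ slope d w.ev)
    (h' : 0 ≤ slope d (w.ev + r * mid j)) : w.leftOf d j = true := by
  have h0 : (0 : ℝ) < 1 / (2 * √3) := by have := sqrt_three_pos; positivity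
  set v := w.rot (11 * d) with hv
  have hs : slope d w.ev = 1 / (2 * √3) * ((v.b + 2 * v.d : ℤ) + v.c * √3) := by
    rw [slope, conj_ζ_pow, ← ev_rot, ← hv, ev_im]
    push_cast
    have := sqrt_three_pos
    field_simp; ring
  rw [slope_add, slope_real_mul] at h'
  unfold leftOf
  simp only [← hv, Bool.or_eq_true, Bool.and_eq_true, decide_eq_true_eq, pos_iff]
  rcases h.lt_or_eq with h | h
  · left
    rwa [hs, mul_pos_iff_of_pos_left h0] at h
  · right
    have hz := h.symm
    rw [hs, mul_eq_zero_iff_left h0.ne', ← eq_zero_iff] at hz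
    refine ⟨hz, ?_⟩
    by_contra hlt
    have := slope_mid_neg hlt
    nlinarith

end Pt

/-! ### Placements of the pentagon on lattice points -/

/-- The placement `frame x n σ` of the pentagon at the lattice point `x`. -/
structure Placement where
  x : Pt
  n : ℕ
  σ : Bool
deriving DecidableEq

namespace Placement

/-- The congruence of a placement. -/
noncomputable def toFrame (P : Placement) : ℂ ≃ᵢ ℂ := frame P.x.ev P.n P.σ

/-- The tile of a placement. -/
noncomputable def tile (P : Placement) : Set ℂ := P.toFrame '' pentagon

lemma aligned (P : Placement) : Aligned P.tile := ⟨_, _, _, rfl⟩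

/-- The coordinates of a point with respect to a placement. -/
def loc (P : Placement) (q : Pt) : Pt := ((q.sub P.x).rot (11 * P.n)).flip P.σ

lemma toFrame_loc (P : Placement) (q : Pt) : P.toFrame (P.loc q).ev = q.ev := by
  have h : ζ ^ P.n * ζ ^ (11 * P.n) = 1 := by
    rw [← pow_add, ← ζ_pow_mod, show (P.n + 11 * P.n) % 12 = 0 by omega, pow_zero]
  rw [toFrame, frame_apply, loc, Pt.ev_flip, flip_flip, Pt.ev_rot, Pt.ev_sub, ← mul_assoc, h]
  ring

/-- Decides `Cov`. -/
def cov (P : Placement) (q : Pt) (j : ℕ) : Bool := (P.loc q).sideCov (localSec P.n P.σ j)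

lemma cov_iff {P : Placement} {q : Pt} {j : ℕ} : P.cov q j = true ↔ Cov P.tile q.ev j := by
  rw [cov, Pt.sideCov_iff, ← cov_pentagon_iff, tile, ← toFrame_loc P q, toFrame, cov_frame]

/-- The corners of a placement. -/
def corner (P : Placement) (k : Corner) : Pt := P.x.add (((Pt.vtx k).flip P.σ).rot P.n)

lemma ev_corner (P : Placement) (k : Corner) : (P.corner k).ev = P.toFrame (vertex k) := by
  rw [corner, Pt.ev_add, Pt.ev_rot, Pt.ev_flip, Pt.ev_vtx]; rfl

/-- The placement with the corner `k` at `q` whose first sector there is `j`. -/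
def mkAt (q : Pt) (j : ℕ) (k : Corner) (σ : Bool) : Placement :=
  let n := (bif σ then j + 6 + dirIdx (prev k) else j + 11 * dirIdx k) % 12
  ⟨q.sub (((Pt.vtx k).flip σ).rot n), n, σ⟩

lemma tile_mkAt {x : ℂ} {n : ℕ} {σ : Bool} {q : Pt} {k : Corner} {j : ℕ}
    (h : frame x n σ (vertex k) = q.ev) (hj : startSec k n σ % 12 = j % 12) :
    frame x n σ '' pentagon = (mkAt q j k σ).tile := by
  have hn : ζ ^ n = ζ ^ (mkAt q j k σ).n := by
    refine ζ_pow_congr ?_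
    cases σ
    · simp only [startSec, cond_false, mkAt] at hj ⊢; omega
    · simp only [startSec, cond_true, mkAt] at hj ⊢; omega
  have hx : (mkAt q j k σ).x.ev = x := by
    have : (mkAt q j k σ).x =
      q.sub (((Pt.vtx k).flip σ).rot (mkAt q j k σ).n) := rfl
    rw [this, Pt.ev_sub, Pt.ev_rot, Pt.ev_flip, Pt.ev_vtx, ← h, frame_apply, hn]
    ring
  have hσ : (mkAt q j k σ).σ = σ := rfl
  have : frame x n σ = (mkAt q j k σ).toFrame := by
    refine IsometryEquiv.ext fun z => ?_
    rw [toFrame, frame_apply, frame_apply, hn, hx, hσ]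
  rw [this, tile]

/-- The placement of the pentagon itself. -/
def base : Placement := ⟨⟨0, 0, 0, 0⟩, 0, false⟩

lemma toFrame_base : base.toFrame = IsometryEquiv.refl ℂ := by
  refine IsometryEquiv.ext fun z => ?_
  have : base.x.ev = 0 := by simp [base, Pt.ev]
  rw [toFrame, frame_apply, this]
  simp [base, flip]
  rfl

lemma tile_base : base.tile = pentagon := by
  rw [tile, toFrame_base]; exact Set.image_id _

/-- Composition of placements. -/
def comp (P Q : Placement) : Placement :=
  ⟨P.x.add ((Q.x.flip P.σ).rot P.n), (P.n + bif P.σ then 11 * Q.n else Q.n) % 12, xor P.σ Q.σ⟩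

lemma toFrame_comp (P Q : Placement) (z : ℂ) :
    (P.comp Q).toFrame z = P.toFrame (Q.toFrame z) := by
  obtain ⟨x, n, σ⟩ := P
  obtain ⟨y, m, τ⟩ := Q
  simp only [toFrame, comp, frame_apply, Pt.ev_add, Pt.ev_rot, Pt.ev_flip, flip_add, ζ_pow_mod,
    pow_add]
  cases σ <;> cases τ <;> simp [flip, conj_ζ_pow, -map_pow] <;> ring

lemma tile_comp (P Q : Placement) : (P.comp Q).tile = P.toFrame '' Q.tile := by
  simp only [tile, Set.image_image, toFrame_comp]

/-- The translation of a placement of the pentagon by the vector `AD`, in its own frame. -/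
def shift (r : ℤ) : Placement := ⟨⟨0, 2 * r, 0, -r⟩, 0, false⟩

end Placement

/-! ### Verified case analysis -/

/-- What is known about a tiling near the base tile: a placement whose tile belongs to the tiling,
or the fact that at `q` the six sectors to the left of the direction `ζ ^ d` are covered by tiles
that lie in the half plane to the left of the line through `q` with that direction. -/
inductive Item
  | tile (P : Placement)
  | wall (q : Pt) (d : ℕ)
deriving DecidableEq

namespace Item

/-- The item holds in the tiling `T`. -/
def Holds (T : Set (Set ℂ)) : Item → Prop
  | tile P => P.tile ∈ T
  | wall q d => ∀ i, (11 * d + i) % 12 < 6 →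
      ∃ u ∈ T, Cov u q.ev i ∧ ∀ z ∈ u, 0 ≤ slope d (z - q.ev)

/-- The sector `j` at `q` is covered by the tiles of the item. -/
def cov : Item → Pt → ℕ → Bool
  | tile P, q, j => P.cov q j
  | wall q' d, q, j => decide (q' = q) && decide ((11 * d + j) % 12 < 6)

/-- The sector `j` at `q` might be covered by the tiles of the item. -/
def mayCov : Item → Pt → ℕ → Bool
  | tile P, q, j => P.cov q j
  | wall q' d, q, j => (q.sub q').leftOf d j

/-- The points at which clashes with the item are looked for. -/
def point : Item → ℕ → Pt
  | tile P, 0 => P.corner A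
  | tile P, 1 => P.corner B
  | tile P, 2 => P.corner C
  | tile P, 3 => P.corner D
  | tile P, _ => P.corner E
  | wall q _, _ => q

/-- The tile `N` plays the part of the item. -/
def IsTile (N : Set ℂ) : Item → Prop
  | tile P => N = P.tile
  | wall q d => (∀ z ∈ N, 0 ≤ slope d (z - q.ev)) ∧
      ∀ i, Cov N q.ev i ↔ (11 * d + i) % 12 < 6

lemma IsTile.holds {T : Set (Set ℂ)} {N : Set ℂ} {e : Item} (h : e.IsTile N) (hN : N ∈ T) :
    e.Holds T := by
  cases e with
  | tile P => rw [Holds, ← show N = P.tile from h]; exact hN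
  | wall q d => exact fun i hi => ⟨N, hN, (h.2 i).2 hi, h.1⟩

lemma IsTile.cov {N : Set ℂ} {e : Item} (h : e.IsTile N) {q : Pt} {j : ℕ}
    (hc : e.cov q j = true) : Cov N q.ev j := by
  cases e with
  | tile P => exact (show N = P.tile from h) ▸ Placement.cov_iff.1 hc
  | wall q' d =>
    simp only [Item.cov, Bool.and_eq_true, decide_eq_true_eq] at hc
    obtain ⟨rfl, hj⟩ := hc
    exact (h.2 j).2 hj

/-- The candidates for a tile whose first sector at `q` is `j`. -/
def candidates (q : Pt) (j : ℕ) : List Item :=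
  [A, B, C, D, E].flatMap (fun k =>
    [tile (Placement.mkAt q j k false), tile (Placement.mkAt q j k true)]) ++ [wall q j]

lemma exists_candidate {N : Set ℂ} (hN : Aligned N) {q : Pt} {j : ℕ} (h : Cov N q.ev j)
    (h' : ¬ Cov N q.ev (j + 11)) : ∃ c ∈ candidates q j, c.IsTile N := by
  obtain ⟨x, n, σ, rfl⟩ := hN
  rcases cov_frame_cases h h' with ⟨k, hk, hj⟩ | hw
  · refine ⟨tile (Placement.mkAt q j k σ), ?_, Placement.tile_mkAt hk hj⟩
    cases k <;> cases σ <;> simp [candidates]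
  · exact ⟨wall q j, by simp [candidates], hw⟩

/-- An item and a tile that share a sector somewhere share all of them. -/
lemma mayCov_of_cov {T : Set (Set ℂ)} (hT : IsTHTiling T) (hal : ∀ t ∈ T, Aligned t) {e : Item}
    (he : e.Holds T) {N : Set ℂ} (hN : N ∈ T) {q p : Pt} {i j : ℕ} (hp : e.cov p i = true)
    (hNp : Cov N p.ev i) (hNq : Cov N q.ev j) : e.mayCov q j = true := by
  cases e with
  | tile P =>
    have : N = P.tile := hT.eq_of_cov hN he (hal N hN) P.aligned hNp (Placement.cov_iff.1 hp)
    exact Placement.cov_iff.2 (this ▸ hNq)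
  | wall q' d =>
    simp only [Item.cov, Bool.and_eq_true, decide_eq_true_eq] at hp
    obtain ⟨rfl, hi⟩ := hp
    obtain ⟨u, hu, hc, hs⟩ := he i hi
    obtain rfl : N = u := hT.eq_of_cov hN hu (hal N hN) (hal u hu) hNp hc
    obtain ⟨hq, r, hr, hqr⟩ := hNq
    refine Pt.leftOf_of_slope hr ?_ ?_
    · rw [Pt.ev_sub]; exact hs _ hq
    · rw [Pt.ev_sub, show q.ev - q'.ev + r * mid j = q.ev + r * mid j - q'.ev by ring]
      exact hs _ hqr

end Item

open Item

/-- The sector `i` at `p` shows that a tile covering the sector `j` at `q` and playing the part of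
`c` is incompatible with `e`. -/
def clash (e c : Item) (q : Pt) (j : ℕ) (p : Pt) : Bool :=
  !e.mayCov q j && (List.range 12).any fun i => e.cov p i && c.cov p i

/-- The points of two items at which they may clash. -/
def clashPoint (e c : Item) (v : ℕ) : Pt := if v < 5 then e.point v else c.point (v - 5)

/-- Works through the candidates `cs` for the tile covering the sector `j` at `q`, guided by the
certificate `ts`. If `i ≠ 0`, then the sector `j + i` is known to be occupied, and candidates that
cover it are discarded. For the other ones, `m + 1, v` stands for a clash with the item number `m`
at `clashPoint _ _ v`, and `0` is followed by a certificate, to be read by `rec`, for the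
configuration enlarged by the candidate. -/
def checkCandidates (rec : List Item → List ℕ → Option (List ℕ)) (cfg : List Item) (q : Pt)
    (j i : ℕ) : List Item → List ℕ → Option (List ℕ)
  | [], ts => some ts
  | c :: cs, ts =>
    if c.cov q (j + i) && decide (i ≠ 0) then checkCandidates rec cfg q j i cs ts else
      match ts with
      | 0 :: ts =>
        match rec (cfg ++ [c]) ts with
        | some ts => checkCandidates rec cfg q j i cs ts
        | none => none
      | (m + 1) :: v :: ts =>
        match cfg[m]? with
        | some e =>
          if clash e c q j (clashPoint e c v) then
            checkCandidates rec cfg q j i cs ts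
          else none
        | none => none
      | _ => none

/-- Checks a certificate (read from the front of a list of numbers, the rest of which is
returned) for the statement that every tiling with the properties `cfg` contains all tiles of one of
the `goals`. The certificate is `0, g`, if the goal number `g` is contained in `cfg`; or
`1, m, v, j, s, f, i`, followed by the input of `checkCandidates` for the sector `j` at the point
number `v` of the item number `m`, where the items `s` and `f` cover the preceding sector and,
unless `i = 0`, the sector `j + i`. The first argument bounds the depth of the recursion. -/
def check (goals : List (List Placement)) : ℕ → List Item → List ℕ → Option (List ℕ)
  | 0, _, _ => none
  | n + 1, cfg, ts =>
    match ts with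
    | 0 :: g :: ts =>
      match goals[g]? with
      | some G => if G.all fun P => cfg.contains (.tile P) then some ts else none
      | none => none
    | 1 :: m :: v :: j :: s :: f :: i :: ts =>
      match cfg[m]?, cfg[s]?, cfg[f]? with
      | some em, some es, some ef =>
        let q := em.point v
        if es.cov q (j + 11) && !es.mayCov q j &&
            (decide (i = 0) || (ef.cov q (j + i) && !ef.mayCov q j)) then
          checkCandidates (check goals n) cfg q j i (candidates q j) ts
        else none
      | _, _, _ => none
    | _ => none

section soundness

variable {T : Set (Set ℂ)} {goals : List (List Placement)}

/-- One of the candidates is realized by a tile `N` of the tiling. A clash would make `N` equal to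
the tile it clashes with, which does not cover the sector in question; so the certificate leads to a
valid larger configuration. -/
lemma checkCandidates_sound (hT : IsTHTiling T) (hal : ∀ t ∈ T, Aligned t)
    {rec : List Item → List ℕ → Option (List ℕ)} {cfg : List Item} {q : Pt} {j i : ℕ}
    (hcfg : ∀ e ∈ cfg, e.Holds T)
    (hrec : ∀ cfg ts ts', (∀ e ∈ cfg, e.Holds T) → rec cfg ts = some ts' →
      ∃ G ∈ goals, ∀ P ∈ G, P.tile ∈ T)
    {N : Set ℂ} (hN : N ∈ T) (hNq : Cov N q.ev j) (hNi : i ≠ 0 → ¬ Cov N q.ev (j + i))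
    {cs : List Item} {ts ts' : List ℕ} (hcs : ∃ c ∈ cs, c.IsTile N)
    (h : checkCandidates rec cfg q j i cs ts = some ts') :
    ∃ G ∈ goals, ∀ P ∈ G, P.tile ∈ T := by
  induction cs generalizing ts with
  | nil => simp at hcs
  | cons c cs ih =>
    have step : (c.IsTile N → ∃ G ∈ goals, ∀ P ∈ G, P.tile ∈ T) →
        ∀ ts, checkCandidates rec cfg q j i cs ts = some ts' →
        ∃ G ∈ goals, ∀ P ∈ G, P.tile ∈ T := by
      intro hc ts hts
      obtain ⟨c', hc', hN'⟩ := hcs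
      rcases List.mem_cons.1 hc' with rfl | hc'
      · exact hc hN'
      · exact ih ⟨c', hc', hN'⟩ hts
    unfold checkCandidates at h
    split at h
    · rename_i hc
      simp only [Bool.and_eq_true, decide_eq_true_eq] at hc
      exact step (fun hcN => absurd (hcN.cov hc.1) (hNi hc.2)) _ h
    · split at h
      · split at h
        · rename_i _ _ _ heq
          refine step (fun hcN => hrec _ _ _ ?_ heq) _ h
          intro e he
          rcases List.mem_append.1 he with he | he
          · exact hcfg e he
          · rw [List.mem_singleton.1 he]; exact hcN.holds hN
        · simp at h
      · split at h
        · rename_i _ _ _ _ e he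
          split at h
          · rename_i hcl
            refine step (fun hcN => ?_) _ h
            exfalso
            simp only [clash, Bool.and_eq_true, Bool.not_eq_true', List.any_eq_true] at hcl
            obtain ⟨h1, l, -, hl1, hl2⟩ := hcl
            have := mayCov_of_cov hT hal (hcfg e (List.mem_of_getElem? he)) hN hl1
              (hcN.cov hl2) hNq
            rw [h1] at this
            exact Bool.false_ne_true this
          · simp at h
        · simp at h
      · simp at h

/-- A tiling with the properties `cfg` contains all tiles of one of the `goals` if `check` accepts a
certificate for this. -/
lemma check_sound (hT : IsTHTiling T) (hal : ∀ t ∈ T, Aligned t) (n : ℕ) (cfg : List Item)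
    (ts ts' : List ℕ) (hcfg : ∀ e ∈ cfg, e.Holds T) (h : check goals n cfg ts = some ts') :
    ∃ G ∈ goals, ∀ P ∈ G, P.tile ∈ T := by
  induction n generalizing cfg ts ts' with
  | zero => simp [check] at h
  | succ n ih =>
    unfold check at h
    split at h
    · split at h
      · rename_i G hG
        split at h
        · rename_i hall
          refine ⟨G, List.mem_of_getElem? hG, fun P hP => ?_⟩
          have := List.all_eq_true.1 hall P hP
          exact hcfg (.tile P) (by simpa using this)
        · simp at h
      · simp at h
    · split at h
      · rename_i _ _ _ em es ef hm hs hf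
        dsimp only at h
        split at h
        · rename_i hc
          simp only [Bool.and_eq_true, Bool.or_eq_true, Bool.not_eq_true', decide_eq_true_eq] at hc
          obtain ⟨⟨h1, h2⟩, h3⟩ := hc
          obtain ⟨N, hN, hNq⟩ := hT.exists_cov (em.point _).ev _
          have hs' : ¬ Cov N (em.point _).ev (_ + 11) := fun hc => by
            have := mayCov_of_cov hT hal (hcfg es (List.mem_of_getElem? hs)) hN h1 hc hNq
            rw [h2] at this
            exact Bool.false_ne_true this
          refine checkCandidates_sound hT hal hcfg (fun cfg ts ts' => ih cfg ts ts') hN hNq ?_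
            (exists_candidate (hal N hN) hNq hs') h
          intro hi hc
          obtain ⟨h4, h5⟩ := h3.resolve_left hi
          have := mayCov_of_cov hT hal (hcfg ef (List.mem_of_getElem? hf)) hN h4 hc hNq
          rw [h5] at this
          exact Bool.false_ne_true this
        · simp at h
      · simp at h
    · simp at h

end soundness

/-! ### The corners around a point -/

instance : DecidableEq Corner := fun k l =>
  decidable_of_iff (dirIdx k = dirIdx l)
    ⟨by cases k <;> cases l <;> simp [dirIdx], congrArg dirIdx⟩

/-- The angle at a corner, in units of `30°`. -/
def width : Corner → ℕ
  | A => 3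
  | B => 4
  | C => 2
  | D => 5
  | E => 4

/-- Tiles with consecutive corners at `q`, counterclockwise from the sector `j`; each corner comes
with the information whether its tile is reflected. -/
def fan (q : Pt) : ℕ → List (Corner × Bool) → List Placement
  | _, [] => []
  | j, (k, σ) :: l => Placement.mkAt q j k σ :: fan q (j + width k) l

/-- The base tile and further tiles at its corner `E`. -/
def fanE (l : List (Corner × Bool)) : List Placement := fan (Pt.vtx E) 7 ((E, false) :: l)

/-- The two ways to realize `A + D + E = 360°` at the corner `E` of the base tile. -/
def adeFans : List (List Placement) :=
  [fanE [(A, true), (D, true)], fanE [(D, false), (A, false)]]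

/-- The relation `2A + C + E = 360°` at the corner `E` of the base tile, which cannot be excluded by
the immediate neighbourhood of the point. -/
def faultFans : List (List Placement) :=
  [fanE [(A, true), (C, false), (A, false)], fanE [(A, true), (C, true), (A, false)]]

/-- The four ways to realize `3E = 360°` at the corner `E` of the base tile. -/
def eeeFans : List (List Placement) :=
  [fanE [(E, false), (E, false)], fanE [(E, false), (E, true)], fanE [(E, true), (E, false)],
    fanE [(E, true), (E, true)]]

/-- The configurations `Ls` around the tile `P` in place of the base tile. -/
def around (P : Placement) (Ls : List (List Placement)) : List (List Placement) :=
  Ls.map (List.map P.comp)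

/-- The tile with its corner `C` at the corner `A` of the base tile and its corner `D` at the corner
`B` of the base tile. -/
def faultTile : Placement := Placement.mkAt (Pt.vtx A) 8 C true

/-- The points at the signed distances in `l` from the corner `k` along the line through the edge
starting there, as points of a line of sides of tiles on the other side. -/
def walls (k : Corner) (l : List ℤ) : List Item :=
  l.map fun r => .wall ((Pt.vtx k).add (Pt.rot (dirIdx k) ⟨0, 2 * r, 0, -r⟩)) (dirIdx k + 6)

/-! ### Certificates -/

/-- A certificate for `check_types`. -/
def check_types_certificate : List ℕ := [
    1, 0, 4, 11, 0, 0, 0, 0, 1, 0, 3, 10, 0, 1, 1, 0, 1, 0, 0, 1, 0, 0, 0, 2, 0, 0, 1, 0, 4, 2,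
    1, 2, 1, 2, 0, 2, 0, 2, 0, 2, 0, 0, 1, 0, 4, 2, 1, 2, 1, 2, 0, 0, 1, 0, 4, 2, 1, 2, 2, 0, 0,
    2, 0, 0, 3, 0, 0, 0, 0, 1, 0, 0, 7, 2, 0, 3, 0, 1, 3, 4, 8, 3, 0, 2, 0, 1, 3, 3, 7, 3, 4, 1,
    0, 1, 3, 3, 7, 3, 4, 1, 0, 1, 3, 4, 1, 3, 3, 0, 0, 1, 0, 4, 2, 1, 0, 5, 5, 2, 5, 2, 5, 3, 5,
    2, 5, 2, 5, 2, 5, 1, 5, 1, 5, 3, 5, 2, 0, 1, 0, 4, 2, 1, 0, 5, 0, 1, 0, 4, 5, 5, 0, 2, 5, 1,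
    5, 3, 5, 3, 5, 3, 5, 3, 0, 1, 0, 4, 4, 5, 0, 3, 5, 3, 5, 3, 5, 2, 5, 1, 0, 1, 0, 4, 4, 5, 0,
    3, 5, 3, 5, 3, 5, 2, 5, 1, 5, 3, 5, 3, 5, 3, 5, 3, 0, 1, 4, 2, 1, 0, 4, 4, 2, 0, 2, 0, 2, 0,
    2, 0, 2, 0, 2, 0, 2, 0, 2, 0, 0, 1, 4, 0, 1, 0, 4, 3, 2, 0, 2, 0, 2, 0, 2, 0, 0, 1, 0, 4, 2,
    1, 0, 5, 5, 0, 5, 0, 5, 1, 5, 0, 5, 0, 5, 0, 5, 0, 5, 3, 5, 1, 5, 0, 0, 1, 0, 4, 2, 1, 0, 5,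
    5, 0, 5, 0, 5, 3, 5, 0, 5, 0, 5, 0, 5, 0, 5, 1, 5, 3, 5, 0, 0, 1, 0, 4, 2, 1, 0, 5, 0, 1, 0,
    4, 5, 5, 0, 2, 5, 0, 5, 0, 0, 1, 0, 4, 5, 5, 0, 2, 5, 0, 5, 0, 5, 0, 5, 0, 0, 1, 0, 4, 4, 5,
    0, 3, 5, 0, 5, 0, 5, 0, 5, 0, 0, 1, 0, 4, 4, 5, 0, 3, 5, 0, 5, 0, 5, 0, 5, 0, 5, 0, 5, 0, 5,
    0, 5, 0, 0, 1, 4, 2, 1, 0, 4, 4, 2, 0, 2, 0, 2, 0, 2, 0, 2, 0, 2, 0, 2, 0, 2, 0, 0, 1, 0, 4,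
    2, 1, 0, 5, 0, 1, 0, 4, 5, 5, 0, 2, 5, 0, 5, 0, 0, 1, 0, 4, 5, 5, 0, 2, 5, 0, 5, 0, 5, 1, 5,
    7, 0, 1, 0, 4, 4, 5, 0, 3, 5, 0, 5, 0, 5, 1, 5, 1, 0, 1, 0, 4, 4, 5, 0, 3, 5, 0, 5, 0, 5, 1,
    5, 1, 5, 0, 5, 0, 5, 1, 0, 1, 0, 4, 6, 5, 0, 1, 0, 1, 0, 4, 2, 1, 0, 5, 5, 2, 5, 2, 5, 1, 5,
    2, 5, 2, 5, 2, 5, 2, 5, 2, 5, 1, 5, 2, 0, 1, 3, 4, 7, 4, 3, 2, 0, 1, 3, 3, 9, 5, 3, 1, 0, 1,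
    3, 3, 9, 5, 3, 1, 0, 1, 0, 0, 9, 3, 0, 1, 0, 1, 0, 0, 9, 3, 0, 1, 0, 1, 0, 3, 10, 0, 1, 1, 0,
    1, 0, 3, 10, 0, 1, 1, 0, 1, 0, 3, 10, 0, 1, 1, 0, 1, 0, 3, 10, 0, 1, 1, 0, 1, 0, 4, 4, 1, 0,
    3, 0, 0, 1, 0, 1, 2, 4, 4, 1, 2, 2, 0, 1, 2, 3, 6, 3, 2, 1, 0, 1, 2, 3, 6, 3, 2, 1, 0, 1, 0,
    4, 6, 2, 0, 1, 0, 1, 0, 4, 6, 2, 0, 1, 0, 1, 0, 4, 4, 1, 0, 3, 0, 1, 1, 4, 2, 1, 2, 2, 0, 1,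
    1, 0, 11, 1, 3, 3, 0, 1, 3, 3, 2, 4, 3, 1, 0, 1, 3, 3, 2, 4, 3, 1, 0, 1, 1, 0, 1, 4, 3, 1, 0,
    1, 1, 0, 1, 4, 3, 1, 0, 1, 2, 1, 4, 3, 2, 2, 0, 1, 3, 3, 3, 3, 4, 1, 0, 1, 3, 3, 3, 3, 4, 1,
    0, 1, 0, 0, 7, 2, 0, 3, 0, 1, 3, 4, 8, 3, 0, 2, 0, 1, 3, 3, 7, 3, 4, 1, 0, 1, 3, 3, 7, 3, 4,
    1, 0, 1, 2, 1, 5, 2, 3, 2, 0, 1, 3, 4, 7, 4, 3, 2, 0, 1, 3, 3, 9, 5, 3, 1, 0, 1, 3, 3, 9, 5,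
    3, 1, 0, 1, 3, 4, 7, 4, 3, 2, 0, 1, 3, 3, 9, 5, 3, 1, 0, 1, 3, 3, 9, 5, 3, 1, 0, 1, 0, 0, 9,
    3, 0, 1, 0, 1, 0, 0, 9, 3, 0, 1, 0, 1, 0, 4, 6, 2, 0, 1, 0, 1, 0, 4, 6, 2, 0, 1, 0, 1, 0, 4,
    3, 1, 0, 4, 0, 1, 0, 4, 6, 2, 0, 1, 0, 1, 0, 4, 6, 2, 0, 1, 0, 1, 1, 3, 2, 1, 2, 1, 0, 1, 1,
    3, 2, 1, 2, 1, 0, 1, 1, 3, 2, 1, 2, 1, 0, 1, 1, 3, 2, 1, 2, 1, 0, 0, 4, 0, 0, 5, 0, 1, 0, 0,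
    1, 0, 0, 0, 2, 0, 0, 0, 7, 2, 4, 2, 0, 2, 0, 2, 0, 0, 0, 6, 2, 4, 0, 1, 0, 4, 3, 1, 2, 1, 2,
    0, 0, 1, 0, 0, 7, 2, 0, 3, 0, 1, 3, 4, 8, 3, 0, 2, 0, 1, 3, 3, 7, 3, 4, 1, 0, 1, 3, 3, 7, 3,
    4, 1, 0, 1, 3, 4, 1, 3, 3, 0, 0, 1, 0, 4, 3, 1, 0, 4, 5, 2, 5, 3, 5, 1, 5, 1, 5, 2, 5, 2, 5,
    1, 5, 1, 0, 1, 0, 4, 3, 1, 0, 4, 5, 3, 5, 3, 5, 3, 5, 3, 5, 3, 5, 2, 5, 3, 5, 3, 0, 1, 4, 2,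
    1, 0, 4, 4, 2, 0, 2, 0, 2, 0, 2, 0, 2, 0, 2, 0, 2, 0, 2, 0, 0, 1, 0, 4, 3, 1, 0, 4, 5, 4, 5,
    3, 5, 0, 5, 0, 5, 4, 5, 4, 5, 0, 5, 0, 2, 0, 0, 1, 0, 4, 3, 1, 0, 4, 5, 0, 5, 3, 5, 0, 5, 0,
    5, 0, 5, 0, 5, 1, 5, 1, 0, 1, 0, 4, 3, 1, 0, 4, 5, 0, 5, 0, 5, 0, 5, 0, 0, 1, 0, 4, 5, 5, 0,
    2, 5, 0, 5, 0, 0, 1, 0, 4, 5, 5, 0, 2, 5, 0, 5, 0, 5, 0, 5, 0, 0, 1, 4, 2, 1, 0, 4, 4, 2, 0,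
    2, 0, 2, 0, 2, 0, 2, 0, 2, 0, 2, 0, 2, 0, 0, 1, 0, 4, 3, 1, 0, 4, 0, 1, 0, 4, 6, 5, 0, 1, 5,
    1, 5, 0, 5, 0, 0, 1, 0, 4, 5, 5, 0, 2, 5, 0, 5, 0, 0, 1, 0, 4, 5, 5, 0, 2, 5, 0, 5, 0, 5, 0,
    0, 0, 7, 0, 1, 0, 4, 3, 1, 0, 4, 5, 2, 5, 1, 5, 2, 5, 2, 5, 2, 5, 2, 5, 0, 5, 1, 0, 1, 3, 4,
    7, 4, 3, 2, 0, 1, 3, 3, 9, 5, 3, 1, 0, 1, 3, 3, 9, 5, 3, 1, 0, 1, 0, 0, 9, 3, 0, 1, 0, 1, 0,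
    0, 9, 3, 0, 1, 0, 1, 0, 4, 5, 1, 0, 2, 0, 1, 0, 0, 7, 2, 0, 3, 0, 1, 3, 4, 8, 3, 0, 2, 0, 1,
    3, 3, 7, 3, 4, 1, 0, 1, 3, 3, 7, 3, 4, 1, 0, 1, 2, 1, 5, 2, 3, 2, 0, 1, 3, 4, 7, 4, 3, 2, 0,
    1, 3, 3, 9, 5, 3, 1, 0, 1, 3, 3, 9, 5, 3, 1, 0, 1, 3, 4, 7, 4, 3, 2, 0, 1, 3, 3, 9, 5, 3, 1,
    0, 1, 3, 3, 9, 5, 3, 1, 0, 1, 0, 0, 9, 3, 0, 1, 0, 1, 0, 0, 9, 3, 0, 1, 0, 1, 0, 0, 7, 2, 0,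
    3, 0, 1, 2, 3, 6, 2, 3, 1, 0, 1, 2, 3, 6, 2, 3, 1, 0, 1, 0, 0, 9, 3, 0, 1, 0, 1, 0, 0, 9, 3,
    0, 1]

/-- At the corner `E` of a tile, only the relations `A + D + E = 360°`, `2A + C + E = 360°` and
`3E = 360°` are possible. -/
lemma check_types :
    check (adeFans ++ faultFans ++ eeeFans) 100
      [.tile Placement.base] check_types_certificate = some [] := by
  decide +kernel

/-- A certificate for `check_next_ad`. -/
def check_next_ad_certificate : List ℕ := [
    1, 0, 3, 10, 0, 1, 3, 0, 1, 1, 3, 11, 3, 1, 3, 0, 1, 3, 3, 10, 3, 4, 1, 0, 0, 0, 0, 1, 1, 3,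
    1, 4, 1, 1, 0, 1, 1, 3, 1, 4, 1, 1, 0, 1, 1, 3, 1, 3, 1, 1, 0, 1, 0, 3, 0, 3, 1, 1, 0, 1, 0,
    3, 0, 3, 1, 1]

/-- If a tile is in the relation `A + D + E = 360°`, realized in the first way, then its translate
by the side `BC` is in this relation or in the relation `2A + C + E = 360°`. -/
lemma check_next_ad :
    check (around (.shift 1) (adeFans ++ faultFans)) 100
      ((fanE [(A, true), (D, true)]).map .tile) check_next_ad_certificate = some [] := by
  decide +kernel

/-- A certificate for `check_next_da`. -/
def check_next_da_certificate : List ℕ := [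
    1, 0, 3, 10, 0, 1, 3, 0, 1, 1, 0, 11, 3, 1, 5, 0, 1, 3, 3, 10, 3, 4, 1, 0, 1, 1, 0, 2, 4, 1,
    2, 0, 0, 2, 0, 0, 3, 0, 1, 1, 0, 3, 4, 1, 1, 0, 1, 1, 0, 3, 4, 1, 1, 0, 1, 3, 3, 10, 3, 4, 1,
    0, 1, 3, 3, 10, 3, 4, 1, 0, 0, 1, 0, 1, 4, 4, 2, 4, 1, 2, 0, 1, 4, 0, 11, 4, 5, 3, 0, 1, 5,
    3, 2, 6, 5, 1, 0, 1, 5, 3, 2, 6, 5, 1, 0, 1, 4, 0, 1, 6, 5, 1, 0, 1, 4, 0, 1, 6, 5, 1, 0, 1,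
    1, 1, 4, 5, 1, 2, 0, 1, 5, 3, 3, 5, 6, 1, 0, 1, 5, 3, 3, 5, 6, 1, 0, 1, 1, 0, 3, 4, 1, 1, 0,
    1, 1, 0, 3, 4, 1, 1, 0, 1, 3, 4, 10, 0, 3, 2, 0, 1, 3, 3, 0, 4, 3, 1, 0, 1, 3, 3, 0, 4, 3, 1,
    0, 1, 0, 3, 0, 3, 1, 1, 0, 1, 0, 3, 0, 3, 1, 1]

/-- The same as `check_next_ad` for the second way to realize `A + D + E = 360°`. -/
lemma check_next_da :
    check (around (.shift 1) (adeFans ++ faultFans)) 100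
      ((fanE [(D, false), (A, false)]).map .tile) check_next_da_certificate = some [] := by
  decide +kernel

/-- A certificate for `check_next_aca`. -/
def check_next_aca_certificate : List ℕ := [
    1, 0, 3, 10, 0, 1, 3, 0, 1, 1, 3, 11, 4, 1, 3, 0, 1, 4, 3, 10, 4, 5, 1, 0, 0, 0, 0, 1, 1, 3,
    1, 5, 1, 1, 0, 1, 1, 3, 1, 5, 1, 1, 0, 1, 1, 3, 1, 4, 1, 1, 0, 1, 0, 3, 0, 4, 1, 1, 0, 1, 0,
    3, 0, 4, 1, 1]

/-- If a tile is in the relation `2A + C + E = 360°`, then its translate by the side `BC` is in this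
relation or in the relation `A + D + E = 360°`. Here the tile at the corner `C` is not reflected. -/
lemma check_next_aca :
    check (around (.shift 1) (adeFans ++ faultFans)) 100
      ((fanE [(A, true), (C, false), (A, false)]).map .tile)
        check_next_aca_certificate = some [] := by
  decide +kernel

/-- A certificate for `check_next_aca_reflected`. -/
def check_next_aca_reflected_certificate : List ℕ := [
    1, 0, 3, 10, 0, 1, 3, 0, 1, 1, 3, 11, 4, 1, 3, 0, 1, 4, 3, 10, 4, 5, 1, 0, 0, 0, 0, 1, 1, 3,
    1, 5, 1, 1, 0, 1, 1, 3, 1, 5, 1, 1, 0, 1, 1, 3, 1, 4, 1, 1, 0, 1, 0, 3, 0, 4, 1, 1, 0, 1, 0,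
    3, 0, 4, 1, 1]

/-- The same as `check_next_aca` with a reflected tile at the corner `C`. -/
lemma check_next_aca_reflected :
    check (around (.shift 1) (adeFans ++ faultFans)) 100
      ((fanE [(A, true), (C, true), (A, false)]).map .tile)
        check_next_aca_reflected_certificate = some [] := by
  decide +kernel

/-- A certificate for `check_prev_ad`. -/
def check_prev_ad_certificate : List ℕ := [
    1, 0, 0, 5, 2, 0, 5, 0, 1, 0, 0, 8, 3, 0, 2, 0, 1, 3, 4, 6, 3, 4, 2, 0, 1, 3, 3, 5, 3, 5, 1,
    0, 1, 3, 3, 5, 3, 5, 1, 0, 1, 3, 4, 6, 3, 4, 2, 0, 1, 3, 3, 5, 3, 5, 1, 0, 1, 3, 3, 5, 3, 5,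
    1, 0, 1, 0, 0, 8, 3, 0, 2, 0, 0, 7, 0, 0, 6, 0, 1, 0, 0, 9, 3, 0, 1, 0, 1, 0, 0, 9, 3, 0, 1,
    0, 1, 2, 0, 2, 2, 3, 3, 0, 1, 3, 3, 5, 4, 3, 1, 0, 1, 3, 3, 5, 4, 3, 1, 0, 1, 2, 0, 4, 4, 3,
    1, 0, 1, 2, 0, 4, 4, 3, 1, 0, 1, 2, 0, 2, 2, 3, 3, 0, 1, 3, 1, 5, 4, 3, 2, 0, 1, 4, 4, 3, 4,
    5, 2, 0, 1, 4, 3, 2, 4, 6, 1, 0, 1, 4, 3, 2, 4, 6, 1, 0, 1, 4, 4, 3, 4, 5, 2, 0, 1, 4, 3, 2,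
    4, 6, 1, 0, 1, 4, 3, 2, 4, 6, 1, 0, 1, 4, 4, 2, 2, 4, 2, 0, 1, 4, 3, 4, 5, 4, 1, 0, 1, 4, 3,
    4, 5, 4, 1, 0, 1, 2, 0, 4, 4, 3, 1, 0, 1, 2, 0, 4, 4, 3, 1, 0, 1, 3, 0, 1, 3, 3, 0, 3, 0, 0,
    1, 2, 0, 2, 2, 4, 1, 3, 0, 3, 0, 3, 0, 3, 0, 0, 1, 2, 0, 2, 2, 4, 1, 3, 0, 0, 1, 2, 0, 2, 2,
    4, 2, 0, 0, 2, 0, 0, 3, 0, 0, 0, 0, 1, 3, 0, 7, 4, 3, 3, 0, 1, 5, 4, 8, 5, 3, 2, 0, 1, 5, 3,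
    7, 5, 6, 1, 0, 1, 5, 3, 7, 5, 6, 1, 0, 1, 5, 4, 1, 5, 5, 0, 0, 1, 2, 0, 2, 2, 3, 5, 7, 2, 7,
    2, 7, 3, 7, 2, 7, 2, 7, 2, 7, 1, 7, 1, 7, 3, 7, 2, 0, 1, 2, 0, 2, 2, 3, 5, 0, 1, 2, 0, 5, 7,
    3, 2, 7, 1, 7, 3, 7, 3, 7, 3, 7, 3, 0, 1, 2, 0, 4, 7, 3, 3, 7, 3, 7, 3, 7, 2, 7, 1, 0, 1, 2,
    0, 4, 7, 3, 3, 7, 3, 7, 3, 7, 2, 7, 1, 7, 3, 7, 3, 7, 3, 7, 3, 0, 1, 6, 2, 1, 3, 6, 4, 3, 0,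
    3, 0, 3, 0, 3, 0, 3, 0, 3, 0, 3, 0, 3, 0, 0, 1, 6, 0, 1, 3, 6, 3, 3, 0, 3, 0, 3, 0, 3, 0, 0,
    1, 2, 0, 2, 2, 3, 5, 7, 0, 7, 0, 7, 1, 7, 0, 7, 0, 7, 0, 7, 0, 7, 3, 7, 1, 7, 0, 0, 1, 2, 0,
    2, 2, 3, 5, 7, 0, 7, 0, 7, 3, 7, 0, 7, 0, 7, 0, 7, 0, 7, 1, 7, 3, 7, 0, 0, 1, 2, 0, 2, 2, 3,
    5, 0, 1, 2, 0, 5, 7, 3, 2, 7, 0, 7, 0, 0, 1, 2, 0, 5, 7, 3, 2, 7, 0, 7, 0, 7, 0, 7, 0, 0, 1,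
    2, 0, 4, 7, 3, 3, 7, 0, 7, 0, 7, 0, 7, 0, 0, 1, 2, 0, 4, 7, 3, 3, 7, 0, 7, 0, 7, 0, 7, 0, 7,
    0, 7, 0, 7, 0, 7, 0, 0, 1, 6, 2, 1, 3, 6, 4, 3, 0, 3, 0, 3, 0, 3, 0, 3, 0, 3, 0, 3, 0, 3, 0,
    0, 1, 2, 0, 2, 2, 3, 5, 0, 1, 2, 0, 5, 7, 3, 2, 7, 0, 7, 0, 0, 1, 2, 0, 5, 7, 3, 2, 7, 0, 7,
    0, 7, 1, 7, 7, 0, 1, 2, 0, 4, 7, 3, 3, 7, 0, 7, 0, 7, 1, 7, 1, 0, 1, 2, 0, 4, 7, 3, 3, 7, 0,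
    7, 0, 7, 1, 7, 1, 7, 0, 7, 0, 7, 1, 0, 1, 2, 0, 6, 7, 3, 1, 0, 1, 2, 0, 2, 2, 3, 5, 7, 2, 7,
    2, 7, 1, 7, 2, 7, 2, 7, 2, 7, 2, 7, 2, 7, 1, 7, 2, 0, 1, 5, 4, 7, 6, 5, 2, 0, 1, 5, 3, 9, 7,
    5, 1, 0, 1, 5, 3, 9, 7, 5, 1, 0, 1, 3, 0, 9, 5, 3, 1, 0, 1, 3, 0, 9, 5, 3, 1, 0, 1, 3, 4, 8,
    3, 0, 2, 0, 1, 3, 0, 5, 3, 4, 3, 0, 1, 4, 3, 8, 5, 4, 1, 0, 1, 4, 3, 8, 5, 4, 1, 0, 1, 3, 0,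
    7, 5, 4, 1, 0, 1, 3, 0, 7, 5, 4, 1, 0, 1, 0, 1, 10, 4, 0, 2, 0, 1, 4, 3, 9, 4, 5, 1, 0, 1, 4,
    3, 9, 4, 5, 1, 0, 1, 0, 0, 9, 3, 0, 1, 0, 1, 0, 0, 9, 3, 0, 1]

/-- If a tile is in the relation `A + D + E = 360°`, then its translate by the side `CB` is in this
relation, unless `2A + C + E = 360°` holds for this translate or for one of the two other tiles at
the corner `E`. -/
lemma check_prev_ad :
    check (around (.shift (-1)) (adeFans ++ faultFans) ++
      around (.mkAt (Pt.vtx E) 11 A true) faultFans ++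
      around (.mkAt (Pt.vtx E) 14 D true) faultFans) 100
      ((fanE [(A, true), (D, true)]).map .tile) check_prev_ad_certificate = some [] := by
  decide +kernel

/-- A certificate for `check_prev_da`. -/
def check_prev_da_certificate : List ℕ := [
    1, 0, 0, 5, 2, 0, 5, 0, 1, 2, 3, 4, 2, 3, 1, 0, 1, 0, 0, 8, 3, 0, 2, 0, 0, 6, 0, 0, 7, 0, 1,
    0, 0, 9, 3, 0, 1, 0, 1, 2, 3, 4, 2, 3, 1, 0, 1, 2, 3, 4, 2, 3, 1, 0, 1, 2, 3, 4, 2, 3, 1, 0,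
    1, 2, 3, 4, 2, 3, 3, 0, 0, 1, 0, 1, 4, 4, 4, 2, 4, 2, 0, 1, 4, 3, 6, 5, 4, 1, 0, 1, 4, 3, 6,
    5, 4, 1, 0, 1, 2, 3, 6, 4, 3, 1, 0, 1, 2, 3, 6, 4, 3, 1, 0, 1, 2, 3, 4, 2, 3, 1, 0, 1, 0, 0,
    9, 3, 0, 1, 0, 1, 0, 0, 9, 3, 0, 1]

/-- The same as `check_prev_ad` for the second way to realize `A + D + E = 360°`. -/
lemma check_prev_da :
    check (around (.shift (-1)) (adeFans ++ faultFans) ++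
      around (.mkAt (Pt.vtx E) 11 D false) faultFans ++
      around (.mkAt (Pt.vtx E) 16 A false) faultFans) 100
      ((fanE [(D, false), (A, false)]).map .tile) check_prev_da_certificate = some [] := by
  decide +kernel

/-- A certificate for `check_neighbour_ad_first`. -/
def check_neighbour_ad_first_certificate : List ℕ := [
    1, 0, 3, 10, 0, 1, 3, 0, 0, 0, 0, 1, 1, 3, 1, 3, 1, 1, 0, 1, 0, 3, 0, 3, 1, 1, 0, 1, 0, 3, 0,
    3, 1, 1]

/-- If a tile is in the relation `A + D + E = 360°`, then the tile with the corner `A` at this point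
is, at its own corner `E`, in this relation or in the relation `2A + C + E = 360°`. -/
lemma check_neighbour_ad_first :
    check (around (.mkAt (Pt.vtx E) 11 A true) (adeFans ++ faultFans)) 100
      ((fanE [(A, true), (D, true)]).map .tile) check_neighbour_ad_first_certificate = some [] := by
  decide +kernel

/-- A certificate for `check_neighbour_ad_second`. -/
def check_neighbour_ad_second_certificate : List ℕ := [
    1, 0, 3, 10, 0, 1, 3, 0, 1, 0, 0, 5, 2, 0, 5, 0, 1, 0, 0, 8, 4, 0, 2, 0, 1, 4, 4, 6, 4, 5, 2,
    0, 1, 5, 3, 8, 6, 5, 1, 0, 1, 5, 3, 8, 6, 5, 1, 0, 1, 4, 4, 6, 4, 5, 2, 0, 1, 4, 3, 5, 4, 6,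
    1, 0, 1, 4, 3, 5, 4, 6, 1, 0, 1, 0, 0, 8, 4, 0, 2, 0, 0, 3, 0, 0, 2, 0, 1, 0, 0, 9, 4, 0, 1,
    0, 1, 0, 0, 9, 4, 0, 1, 0, 1, 0, 0, 7, 4, 0, 3, 0, 1, 5, 4, 8, 5, 0, 2, 0, 1, 5, 3, 7, 5, 6,
    1, 0, 1, 5, 3, 7, 5, 6, 1, 0, 1, 5, 4, 7, 4, 5, 2, 0, 1, 5, 3, 9, 6, 5, 1, 0, 1, 5, 3, 9, 6,
    5, 1, 0, 1, 0, 0, 9, 5, 0, 1, 0, 1, 0, 0, 9, 5, 0, 1, 0, 1, 0, 0, 7, 4, 0, 3, 0, 1, 5, 4, 8,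
    5, 0, 2, 0, 1, 5, 3, 7, 5, 6, 1, 0, 1, 5, 3, 7, 5, 6, 1, 0, 1, 5, 4, 7, 4, 5, 2, 0, 1, 5, 3,
    9, 6, 5, 1, 0, 1, 5, 3, 9, 6, 5, 1, 0, 1, 0, 0, 9, 5, 0, 1, 0, 1, 0, 0, 9, 5, 0, 1, 0, 0, 0,
    0, 1, 4, 4, 8, 4, 0, 2, 0, 1, 0, 1, 10, 5, 0, 2, 0, 1, 5, 1, 8, 5, 6, 2, 0, 1, 6, 3, 10, 7,
    6, 1, 0, 1, 6, 3, 10, 7, 6, 1, 0, 1, 0, 2, 11, 6, 3, 1, 0, 1, 0, 1, 10, 5, 0, 2, 0, 1, 5, 3,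
    9, 5, 6, 1, 0, 1, 0, 2, 11, 6, 3, 1, 0, 1, 0, 0, 9, 4, 0, 1, 0, 1, 0, 0, 9, 4, 0, 1, 0, 1, 1,
    3, 1, 3, 1, 1, 0, 1, 0, 3, 0, 3, 1, 1, 0, 1, 0, 3, 0, 3, 1, 1]

/-- The same as `check_neighbour_ad_first` for the tile with the corner `D` at the point. -/
lemma check_neighbour_ad_second :
    check (around (.mkAt (Pt.vtx E) 14 D true) (adeFans ++ faultFans)) 100
      ((fanE [(A, true), (D, true)]).map .tile)
        check_neighbour_ad_second_certificate = some [] := by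
  decide +kernel

/-- A certificate for `check_neighbour_da_first`. -/
def check_neighbour_da_first_certificate : List ℕ := [
    1, 0, 3, 10, 0, 1, 3, 0, 0, 1, 0, 1, 3, 4, 10, 0, 3, 2, 0, 1, 3, 3, 0, 4, 3, 1, 0, 1, 3, 3,
    0, 4, 3, 1, 0, 1, 0, 3, 0, 3, 1, 1, 0, 1, 0, 3, 0, 3, 1, 1]

/-- The same as `check_neighbour_ad_second` for the second way to realize `A + D + E = 360°`. -/
lemma check_neighbour_da_first :
    check (around (.mkAt (Pt.vtx E) 11 D false) (adeFans ++ faultFans)) 100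
      ((fanE [(D, false), (A, false)]).map .tile)
        check_neighbour_da_first_certificate = some [] := by
  decide +kernel

/-- A certificate for `check_neighbour_da_second`. -/
def check_neighbour_da_second_certificate : List ℕ := [
    1, 0, 3, 10, 0, 1, 3, 0, 1, 0, 0, 5, 2, 0, 5, 0, 1, 2, 3, 4, 2, 4, 1, 0, 1, 0, 0, 8, 4, 0, 2,
    0, 0, 2, 0, 0, 3, 0, 1, 0, 0, 9, 4, 0, 1, 0, 1, 0, 0, 9, 4, 0, 1, 0, 1, 2, 3, 4, 2, 4, 1, 0,
    1, 2, 3, 4, 2, 4, 1, 0, 0, 1, 0, 1, 4, 4, 8, 4, 0, 2, 0, 1, 0, 1, 10, 5, 0, 2, 0, 1, 5, 1, 8,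
    5, 6, 2, 0, 1, 6, 3, 10, 7, 6, 1, 0, 1, 6, 3, 10, 7, 6, 1, 0, 1, 0, 2, 11, 6, 3, 1, 0, 1, 0,
    1, 10, 5, 0, 2, 0, 1, 5, 3, 9, 5, 6, 1, 0, 1, 0, 2, 11, 6, 3, 1, 0, 1, 0, 0, 9, 4, 0, 1, 0,
    1, 0, 0, 9, 4, 0, 1, 0, 1, 3, 4, 10, 0, 3, 2, 0, 1, 3, 3, 0, 4, 3, 1, 0, 1, 3, 3, 0, 4, 3, 1,
    0, 1, 0, 3, 0, 3, 1, 1, 0, 1, 0, 3, 0, 3, 1, 1]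

/-- The same as `check_neighbour_ad_first` for the second way to realize `A + D + E = 360°`. -/
lemma check_neighbour_da_second :
    check (around (.mkAt (Pt.vtx E) 16 A false) (adeFans ++ faultFans)) 100
      ((fanE [(D, false), (A, false)]).map .tile)
        check_neighbour_da_second_certificate = some [] := by
  decide +kernel

/-- A certificate for `check_neighbour_aca`. -/
def check_neighbour_aca_certificate : List ℕ := [
    1, 0, 3, 10, 0, 1, 3, 0, 0, 0, 0, 1, 1, 3, 1, 4, 1, 1, 0, 1, 0, 3, 0, 4, 1, 1, 0, 1, 0, 3, 0,
    4, 1, 1]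

/-- If a tile is in the relation `2A + C + E = 360°`, where the tile at the corner `C` is not
reflected, then the first tile with the corner `A` there is, at its own corner `E`, in this relation
or in the relation `A + D + E = 360°`. -/
lemma check_neighbour_aca :
    check (around (.mkAt (Pt.vtx E) 11 A true) (adeFans ++ faultFans)) 100
      ((fanE [(A, true), (C, false), (A, false)]).map .tile)
        check_neighbour_aca_certificate = some [] := by
  decide +kernel

/-- A certificate for `check_neighbour_aca_reflected`. -/
def check_neighbour_aca_reflected_certificate : List ℕ := [
    1, 0, 3, 10, 0, 1, 3, 0, 1, 0, 0, 5, 3, 0, 5, 0, 1, 3, 3, 4, 3, 5, 1, 0, 1, 0, 0, 8, 5, 0, 2,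
    0, 0, 2, 0, 0, 3, 0, 1, 0, 0, 9, 5, 0, 1, 0, 1, 0, 0, 9, 5, 0, 1, 0, 1, 3, 3, 4, 3, 5, 1, 0,
    1, 3, 3, 4, 3, 5, 1, 0, 0, 1, 0, 1, 5, 4, 8, 5, 0, 2, 0, 1, 0, 1, 10, 6, 0, 2, 0, 1, 6, 1, 8,
    6, 7, 2, 0, 1, 7, 3, 10, 8, 7, 1, 0, 1, 7, 3, 10, 8, 7, 1, 0, 1, 0, 2, 11, 7, 4, 1, 0, 1, 0,
    1, 10, 6, 0, 2, 0, 1, 6, 3, 9, 6, 7, 1, 0, 1, 0, 2, 11, 7, 4, 1, 0, 1, 0, 0, 9, 5, 0, 1, 0,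
    1, 0, 0, 9, 5, 0, 1, 0, 1, 1, 3, 1, 4, 1, 1, 0, 1, 0, 3, 0, 4, 1, 1, 0, 1, 0, 3, 0, 4, 1, 1]

/-- The same as `check_neighbour_aca` for a reflected tile at the corner `C` and the second tile
with the corner `A`. -/
lemma check_neighbour_aca_reflected :
    check (around (.mkAt (Pt.vtx E) 16 A false) (adeFans ++ faultFans)) 100
      ((fanE [(A, true), (C, true), (A, false)]).map .tile)
        check_neighbour_aca_reflected_certificate = some [] := by
  decide +kernel

/-- A certificate for `check_fault`. -/
def check_fault_certificate : List ℕ := [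
    1, 0, 1, 9, 5, 0, 3, 0, 1, 6, 4, 10, 6, 0, 2, 0, 1, 6, 3, 9, 6, 7, 1, 0, 1, 6, 3, 9, 6, 7, 1,
    0, 1, 0, 2, 10, 6, 1, 2, 0, 1, 1, 2, 10, 7, 2, 2, 0, 1, 2, 2, 10, 8, 3, 2, 0, 1, 8, 4, 5, 8,
    8, 0, 8, 0, 0, 1, 7, 4, 5, 7, 10, 3, 7, 2, 0, 1, 6, 2, 6, 6, 11, 1, 7, 2, 7, 2, 8, 0, 8, 0,
    7, 2, 8, 0, 0, 1, 7, 4, 5, 7, 10, 5, 7, 2, 0, 1, 6, 2, 6, 6, 11, 1, 0, 1, 7, 4, 9, 11, 10, 1,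
    7, 2, 7, 2, 7, 2, 0, 1, 6, 2, 6, 6, 11, 1, 0, 1, 11, 4, 8, 11, 10, 2, 0, 1, 11, 0, 5, 11, 12,
    3, 0, 1, 12, 3, 8, 13, 12, 1, 0, 1, 12, 3, 8, 13, 12, 1, 0, 1, 11, 1, 3, 11, 13, 3, 7, 3, 7,
    3, 7, 3, 7, 3, 0, 1, 11, 0, 7, 13, 12, 1, 0, 1, 10, 1, 10, 12, 10, 2, 0, 1, 12, 3, 9, 12, 13,
    1, 0, 1, 12, 3, 9, 12, 13, 1, 0, 1, 7, 4, 9, 11, 10, 1, 0, 1, 7, 4, 9, 11, 10, 1, 8, 0, 0, 1,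
    7, 0, 7, 7, 10, 1, 8, 0, 0, 1, 8, 4, 11, 10, 8, 2, 10, 3, 10, 0, 0, 1, 3, 2, 11, 9, 4, 1, 0,
    1, 2, 2, 11, 8, 3, 1, 0, 1, 1, 2, 11, 7, 2, 1, 0, 1, 0, 1, 11, 6, 0, 1, 0, 1, 0, 1, 11, 6, 0,
    1]

/-- Five consecutive tiles of a row cannot occur together with `faultTile`. -/
lemma check_fault :
    check [] 100
      [.tile .base, .tile (.shift 1), .tile (.shift 2), .tile (.shift 3), .tile (.shift 4),
        .tile faultTile] check_fault_certificate = some [] := by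
  decide +kernel

/-- A certificate for `check_line_A`. -/
def check_line_A_certificate : List ℕ := [
    1, 0, 1, 10, 5, 0, 2, 0, 1, 6, 0, 10, 6, 8, 1, 0, 1, 6, 0, 10, 6, 8, 2, 0, 1, 7, 0, 10, 7, 9,
    1, 0, 1, 8, 4, 9, 8, 8, 0, 10, 3, 0, 1, 0, 2, 11, 8, 0, 5, 11, 0, 0, 1, 8, 4, 0, 10, 11, 1,
    11, 0, 11, 0, 11, 0, 11, 0, 0, 1, 8, 4, 0, 10, 11, 1, 11, 0, 0, 1, 0, 2, 3, 11, 0, 1, 0, 1,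
    0, 2, 3, 11, 0, 1, 10, 3, 10, 3, 10, 0, 10, 3, 0, 1, 0, 2, 11, 8, 0, 5, 11, 3, 11, 2, 11, 3,
    11, 3, 11, 1, 11, 3, 11, 3, 11, 3, 0, 1, 0, 2, 3, 11, 0, 1, 11, 1, 10, 3, 0, 1, 8, 0, 11, 9,
    10, 1, 10, 0, 0, 1, 0, 2, 11, 8, 0, 5, 11, 0, 11, 0, 11, 0, 11, 0, 11, 0, 11, 0, 11, 0, 11,
    0, 11, 0, 11, 0]

/-- On the other side of a line of sides, no tile has the edge `AB` on the line. -/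
lemma check_line_A :
    check [] 100
      (.tile .base :: walls A [-3, -2, -1, 0, 1, 2, 3]) check_line_A_certificate = some [] := by
  decide +kernel

/-- A certificate for `check_line_C`. -/
def check_line_C_certificate : List ℕ := [
    1, 0, 3, 4, 3, 0, 1]

/-- On the other side of a line of sides, no tile has the edge `CD` on the line. -/
lemma check_line_C :
    check [] 100
      (.tile .base :: walls C [-1, 0, 1]) check_line_C_certificate = some [] := by
  decide +kernel

/-- A certificate for `check_line_D`. -/
def check_line_D_certificate : List ℕ := [
    1, 0, 3, 10, 0, 1, 1]

/-- On the other side of a line of sides, no tile has the edge `DE` on the line. -/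
lemma check_line_D :
    check [] 100
      (.tile .base :: walls D [0]) check_line_D_certificate = some [] := by
  decide +kernel

/-- A certificate for `check_line_E`. -/
def check_line_E_certificate : List ℕ := [
    1, 0, 4, 11, 0, 2, 2, 0, 1, 0, 3, 10, 0, 4, 1, 0, 1, 0, 3, 10, 0, 4, 1]

/-- On the other side of a line of sides, no tile has the edge `EA` on the line. -/
lemma check_line_E :
    check [] 100
      (.tile .base :: walls E [-1, 0, 1]) check_line_E_certificate = some [] := by
  decide +kernel

/-- A certificate for `check_line_B_ee`. -/
def check_line_B_ee_certificate : List ℕ := [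
    1, 0, 1, 4, 0, 4, 2, 3, 2, 0, 1, 3, 0, 5, 6, 3, 1]

/-- A tile whose edge `BC` is on a line of sides of tiles on the other side is not in the relation
`3E = 360°`; this and the following three lemmas treat the ways to realize this relation. -/
lemma check_line_B_ee :
    check [] 100
      (((fanE [(E, false), (E, false)]).map .tile) ++ walls B [-1, 0, 1])
        check_line_B_ee_certificate = some [] := by
  decide +kernel

/-- A certificate for `check_line_B_ee_right`. -/
def check_line_B_ee_right_certificate : List ℕ := [
    1, 0, 1, 4, 0, 4, 2, 0, 1, 0, 0, 4, 2, 6, 1, 0, 1, 3, 0, 5, 6, 3, 1]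

lemma check_line_B_ee_right :
    check [] 100
      (((fanE [(E, false), (E, true)]).map .tile) ++ walls B [-1, 0, 1])
        check_line_B_ee_right_certificate = some [] := by
  decide +kernel

/-- A certificate for `check_line_B_ee_left`. -/
def check_line_B_ee_left_certificate : List ℕ := [
    1, 0, 1, 4, 0, 4, 2, 3, 2, 0, 1, 3, 0, 5, 6, 3, 1]

lemma check_line_B_ee_left :
    check [] 100
      (((fanE [(E, true), (E, false)]).map .tile) ++ walls B [-1, 0, 1])
        check_line_B_ee_left_certificate = some [] := by
  decide +kernel

/-- A certificate for `check_line_B_ee_both`. -/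
def check_line_B_ee_both_certificate : List ℕ := [
    1, 0, 1, 4, 0, 4, 2, 0, 1, 0, 0, 4, 2, 6, 1, 0, 1, 3, 0, 5, 6, 3, 1]

lemma check_line_B_ee_both :
    check [] 100
      (((fanE [(E, true), (E, true)]).map .tile) ++ walls B [-1, 0, 1])
        check_line_B_ee_both_certificate = some [] := by
  decide +kernel

/-! ### Changing the frame of reference -/

/-- The tiling `T` in the coordinates given by the congruence `g`. -/
def pull (g : ℂ ≃ᵢ ℂ) (T : Set (Set ℂ)) : Set (Set ℂ) := {t | g '' t ∈ T}

lemma mem_pull {g : ℂ ≃ᵢ ℂ} {T : Set (Set ℂ)} {t : Set ℂ} : t ∈ pull g T ↔ g '' t ∈ T := Iff.rfl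

lemma image_symm_image (g : ℂ ≃ᵢ ℂ) (t : Set ℂ) : g '' (g.symm '' t) = t := by
  simp [Set.image_image]

lemma image_trans (g h : ℂ ≃ᵢ ℂ) (t : Set ℂ) : (g.trans h) '' t = h '' (g '' t) := by
  rw [Set.image_image]; rfl

lemma image_inj (g : ℂ ≃ᵢ ℂ) {t u : Set ℂ} : g '' t = g '' u ↔ t = u :=
  g.injective.image_injective.eq_iff

lemma pull_trans (g h : ℂ ≃ᵢ ℂ) (T : Set (Set ℂ)) : pull (g.trans h) T = pull g (pull h T) := by
  ext t; simp only [mem_pull, image_trans]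

lemma IsTHTiling.pull {T : Set (Set ℂ)} (hT : IsTHTiling T) (g : ℂ ≃ᵢ ℂ) :
    IsTHTiling (pull g T) := by
  refine ⟨fun t ht => ?_, fun t ht u hu htu => ?_, ?_⟩
  · obtain ⟨q, hq, h, hh⟩ := hT.1 _ ht
    refine ⟨q, hq, h.trans g.symm, ?_⟩
    rw [image_trans, hh, Set.image_image]; simp
  · have : Disjoint (interior (g '' t)) (interior (g '' u)) :=
      hT.2.1 ht hu (by rwa [Ne, image_inj])
    rw [image_interior_congr, image_interior_congr,
      Set.disjoint_image_iff g.injective] at this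
    exact this
  · refine Set.eq_univ_of_forall fun z => ?_
    obtain ⟨t, ht, hz⟩ := hT.exists_mem (g z)
    refine ⟨g.symm '' t, ?_, g z, hz, by simp⟩
    rwa [mem_pull, image_symm_image]

lemma isCorner_congr {g : ℂ ≃ᵢ ℂ} {t : Set ℂ} {k : Corner} {p : ℂ} :
    IsCorner (g '' t) k (g p) ↔ IsCorner t k p := by
  constructor
  · rintro ⟨h, h1, h2⟩
    refine ⟨h.trans g.symm, ?_, by rw [IsometryEquiv.trans_apply, h2, g.symm_apply_apply]⟩
    rw [image_trans, h1, Set.image_image]; simp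
  · rintro ⟨h, h1, h2⟩
    exact ⟨h.trans g, by rw [image_trans, h1], by rw [IsometryEquiv.trans_apply, h2]⟩

lemma tilesAt_pull (g : ℂ ≃ᵢ ℂ) (T : Set (Set ℂ)) (k : Corner) (p : ℂ) :
    (fun t => g '' t) '' tilesAt (pull g T) k p = tilesAt T k (g p) := by
  ext t
  constructor
  · rintro ⟨t, ⟨ht, hc⟩, rfl⟩
    exact ⟨ht, isCorner_congr.2 hc⟩
  · rintro ⟨ht, hc⟩
    refine ⟨g.symm '' t, ⟨by rwa [mem_pull, image_symm_image], ?_⟩, image_symm_image g t⟩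
    rwa [← isCorner_congr (g := g), image_symm_image]

lemma cornersAre_pull {g : ℂ ≃ᵢ ℂ} {T : Set (Set ℂ)} {p : ℂ} {a b c d e : ℕ∞} :
    CornersAre (pull g T) p a b c d e ↔ CornersAre T (g p) a b c d e := by
  simp only [CornersAre, ← tilesAt_pull, (g.injective.image_injective).encard_image]

lemma isVertex_pull {g : ℂ ≃ᵢ ℂ} {T : Set (Set ℂ)} {p : ℂ} :
    IsVertex (pull g T) p ↔ IsVertex T (g p) := by
  constructor
  · rintro ⟨t, ht, k, hk⟩
    exact ⟨_, ht, k, isCorner_congr.2 hk⟩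
  · rintro ⟨t, ht, k, hk⟩
    refine ⟨g.symm '' t, by rwa [mem_pull, image_symm_image], k, ?_⟩
    rwa [← isCorner_congr (g := g), image_symm_image]

/-! ### The corners at a point -/

/-- If the tiles `t i` fill all sectors at `p` and have the corners `c i` there (`none` stands
for a straight angle), then these are the corners at `p`. -/
lemma cornersAre_of_tiles {T : Set (Set ℂ)} (hT : IsTHTiling T) (hal : ∀ t ∈ T, Aligned t) {p : ℂ}
    {m : ℕ} {t : Fin m → Set ℂ} {c : Fin m → Option Corner} (ht : ∀ i, t i ∈ T)
    (hinj : Function.Injective t) (hcov : ∀ j < 12, ∃ i, Cov (t i) p j)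
    (hc : ∀ i k, IsCorner (t i) k p ↔ c i = some k) {n : Corner → ℕ}
    (hn : ∀ k, (Finset.univ.filter fun i => c i = some k).card = n k) :
    CornersAre T p (n A) (n B) (n C) (n D) (n E) := by
  have key : ∀ k, (tilesAt T k p).encard = n k := fun k => by
    have : tilesAt T k p = t '' (Finset.univ.filter fun i => c i = some k : Finset (Fin m)) := by
      ext u
      constructor
      · rintro ⟨hu, hk⟩
        obtain ⟨x, l, σ, rfl⟩ := hal u hu
        have hk' := isCorner_image.1 hk
        have hcovu : Cov (frame x l σ '' pentagon) p (startSec k l σ) := by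
          rw [← hk', cov_frame, cov_pentagon_iff]
          intro k'
          rcases (side_nonneg_of_mem (vertex_mem_pentagon k) k').lt_or_eq with h | h
          · exact Or.inl h
          · refine Or.inr ⟨h.symm, ?_⟩
            rw [eq_comm, vertex_coord] at h
            cases k <;> cases k' <;> simp only [side_eq_zero_coord, rside] at h <;>
              first
              | (exfalso; norm_num at h; done)
              | (cases σ <;> simp only [localSec, startSec, cond_true, cond_false, dirIdx, prev] <;>
                  omega)
        obtain ⟨i, hi⟩ := hcov (startSec k l σ % 12) (Nat.mod_lt _ (by norm_num))
        have := hT.eq_of_cov hu (ht i) (hal _ hu) (hal _ (ht i)) hcovu (hi.congr (by omega))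
        refine ⟨i, ?_, this.symm⟩
        simp only [Finset.coe_filter, Finset.mem_univ, true_and, Set.mem_ofPred_eq]
        rw [← hc, ← this]
        exact hk
      · rintro ⟨i, hi, rfl⟩
        simp only [Finset.coe_filter, Finset.mem_univ, true_and, Set.mem_ofPred_eq] at hi
        exact ⟨ht i, (hc i k).2 hi⟩
    rw [this, hinj.encard_image, Set.encard_coe_eq_coe_finsetCard, hn]
  exact ⟨key A, key B, key C, key D, key E⟩

lemma isCorner_tile {P : Placement} {k l : Corner} {q : Pt} (h : P.corner l = q) :
    IsCorner P.tile k q.ev ↔ l = k := by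
  rw [Placement.tile, isCorner_image, ← h, Placement.ev_corner]
  exact ⟨fun h => (vertex_injective (P.toFrame.injective h)).symm, fun h => by rw [h]⟩

lemma cornersAre_of_placements {T : Set (Set ℂ)} (hT : IsTHTiling T)
    (hal : ∀ t ∈ T, Aligned t) {q : Pt} {m : ℕ} {P : Fin m → Placement} {c : Fin m → Corner}
    (hP : ∀ i, (P i).tile ∈ T) (hq : ∀ i, (P i).corner (c i) = q)
    (hcov : ∀ j < 12, ∃ i, (P i).cov q j = true)
    (hinj : ∀ i i', i ≠ i' → ∃ j < 12, (P i).cov q j ≠ (P i').cov q j) {n : Corner → ℕ}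
    (hn : ∀ k, (Finset.univ.filter fun i => c i = k).card = n k) :
    CornersAre T q.ev (n A) (n B) (n C) (n D) (n E) := by
  refine cornersAre_of_tiles hT hal (t := fun i => (P i).tile) (c := fun i => some (c i)) hP ?_
    (fun j hj => (hcov j hj).imp fun i => Placement.cov_iff.1)
    (fun i k => (isCorner_tile (hq i)).trans (by simp)) (fun k => by simpa using hn k)
  intro i i' h
  by_contra hne
  obtain ⟨j, -, hj⟩ := hinj i i' hne
  apply hj
  rw [Bool.eq_iff_iff, Placement.cov_iff, Placement.cov_iff]
  simp only at h
  rw [h]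

/-- Some configuration of `Ls` occurs in `T`. -/
def Has (Ls : List (List Placement)) (T : Set (Set ℂ)) : Prop :=
  ∃ L ∈ Ls, ∀ P ∈ L, P.tile ∈ T

lemma Has.or {Ls Ms : List (List Placement)} {T : Set (Set ℂ)} (h : Has (Ls ++ Ms) T) :
    Has Ls T ∨ Has Ms T := by
  obtain ⟨L, hL, h⟩ := h
  rcases List.mem_append.1 hL with hL | hL
  exacts [Or.inl ⟨L, hL, h⟩, Or.inr ⟨L, hL, h⟩]

lemma Has.left {Ls Ms : List (List Placement)} {T : Set (Set ℂ)} (h : Has Ls T) :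
    Has (Ls ++ Ms) T := by
  obtain ⟨L, hL, h⟩ := h
  exact ⟨L, List.mem_append_left _ hL, h⟩

lemma has_around {P : Placement} {Ls : List (List Placement)} {T : Set (Set ℂ)} :
    Has (around P Ls) T ↔ Has Ls (pull P.toFrame T) := by
  simp only [Has, around, List.mem_map, exists_exists_and_eq_and, mem_pull,
    forall_exists_index, and_imp, forall_apply_eq_imp_iff₂, Placement.tile_comp]

lemma pull_comp (P Q : Placement) (T : Set (Set ℂ)) :
    pull Q.toFrame (pull P.toFrame T) = pull (P.comp Q).toFrame T := by
  rw [← pull_trans]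
  congr 1
  exact IsometryEquiv.ext fun z => (Placement.toFrame_comp P Q z).symm

lemma tile_mem_pull {P Q : Placement} {T : Set (Set ℂ)} :
    Q.tile ∈ pull P.toFrame T ↔ (P.comp Q).tile ∈ T := by
  rw [mem_pull, Placement.tile_comp]

lemma has_of_check {T : Set (Set ℂ)} (hT : IsTHTiling T) (h₀ : pentagon ∈ T)
    {Ls : List (List Placement)} {cfg : List Item} {ts : List ℕ}
    (hcfg : ∀ e ∈ cfg, e.Holds T) (h : check Ls 100 cfg ts = some []) : Has Ls T :=
  check_sound hT (hT.aligned h₀) 100 cfg ts [] hcfg h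

lemma holds_map_tile {L : List Placement} {T : Set (Set ℂ)} (h : ∀ P ∈ L, P.tile ∈ T) :
    ∀ e ∈ L.map Item.tile, e.Holds T := by
  intro e he
  obtain ⟨P, hP, rfl⟩ := List.mem_map.1 he
  exact h P hP

lemma holds_base {T : Set (Set ℂ)} (h₀ : pentagon ∈ T) : (Item.tile .base).Holds T := by
  rw [Item.Holds, Placement.tile_base]; exact h₀

section

variable {T : Set (Set ℂ)} (hT : IsTHTiling T)
include hT

lemma has_of_pentagon_mem (h₀ : pentagon ∈ T) : Has (adeFans ++ faultFans ++ eeeFans) T :=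
  has_of_check hT h₀ (by simpa using holds_base h₀) check_types

omit hT in
lemma pentagon_mem_of_fanE {l : List (Corner × Bool)} (h : ∀ P ∈ fanE l, P.tile ∈ T) :
    pentagon ∈ T := by
  rw [← Placement.tile_base]
  exact h .base (by
    have : Placement.base = Placement.mkAt (Pt.vtx E) 7 E false := by decide +kernel
    rw [this]; exact List.mem_cons_self)

omit hT in
lemma pentagon_mem_of_has {Ls : List (List Placement)} (hLs : ∀ L ∈ Ls, ∃ l, L = fanE l)
    (h : Has Ls T) : pentagon ∈ T := by
  obtain ⟨L, hL, h⟩ := h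
  obtain ⟨l, rfl⟩ := hLs L hL
  exact pentagon_mem_of_fanE h

/-- To the right of a tile in one of the two relations, there is a translate of the tile in one of
the two relations. -/
lemma has_next (h : Has (adeFans ++ faultFans) T) :
    Has (adeFans ++ faultFans) (pull (Placement.shift 1).toFrame T) := by
  rw [← has_around]
  obtain ⟨L, hL, h⟩ := h
  simp only [adeFans, faultFans, List.cons_append, List.nil_append, List.mem_cons,
    List.not_mem_nil, or_false] at hL
  rcases hL with rfl | rfl | rfl | rfl
  · exact has_of_check hT (pentagon_mem_of_fanE h) (holds_map_tile h) check_next_ad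
  · exact has_of_check hT (pentagon_mem_of_fanE h) (holds_map_tile h) check_next_da
  · exact has_of_check hT (pentagon_mem_of_fanE h) (holds_map_tile h) check_next_aca
  · exact has_of_check hT (pentagon_mem_of_fanE h) (holds_map_tile h) check_next_aca_reflected

omit hT in
lemma shift_comp_shift (r s : ℤ) :
    (Placement.shift r).comp (Placement.shift s) = Placement.shift (r + s) := by
  simp [Placement.shift, Placement.comp, Pt.flip, Pt.rot, Pt.add]
  constructor <;> ring

omit hT in
lemma pull_shift_zero : pull (Placement.shift 0).toFrame T = T := by
  have : Placement.shift 0 = Placement.base := by decide +kernel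
  rw [this, Placement.toFrame_base]
  ext t
  rw [mem_pull]
  exact iff_of_eq (congrArg (· ∈ T) (Set.image_id t))

/-- A tile in the relation `A + D + E = 360°` or `2A + C + E = 360°` starts a half infinite row of
translates. -/
lemma has_shift_nat (h : Has (adeFans ++ faultFans) T) (n : ℕ) :
    Has (adeFans ++ faultFans) (pull (Placement.shift n).toFrame T) := by
  induction n with
  | zero => simpa [pull_shift_zero] using h
  | succ n ih =>
    have := has_next (hT.pull _) ih
    rw [pull_comp, shift_comp_shift] at this
    exact_mod_cast this

omit hT in
lemma exists_fanE_of_mem : ∀ L ∈ adeFans ++ faultFans, ∃ l, L = fanE l := by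
  simp [adeFans, faultFans]

/-- A half row of tiles cannot end next to `faultTile`. -/
lemma faultTile_notMem (h : Has (adeFans ++ faultFans) T) : faultTile.tile ∉ T := by
  intro hf
  have hs : ∀ n : ℕ, (Placement.shift n).tile ∈ T := fun n =>
    pentagon_mem_of_has exists_fanE_of_mem (has_shift_nat hT h n)
  obtain ⟨L, hL, -⟩ := has_of_check hT (pentagon_mem_of_has exists_fanE_of_mem h)
    (by
      have := holds_base (pentagon_mem_of_has exists_fanE_of_mem h)
      simp only [List.mem_cons, List.not_mem_nil, or_false, forall_eq_or_imp, forall_eq]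
      exact ⟨this, hs 1, hs 2, hs 3, hs 4, hf⟩) check_fault
  simp at hL

/-- The relation `2A + C + E = 360°` does not occur: one of the tiles with the corner `A` at the
point starts a half infinite row, which leaves no room for the tile with the corner `C`. -/
lemma not_has_faultFans : ¬ Has faultFans T := by
  rintro ⟨L, hL, h⟩
  simp only [faultFans, List.mem_cons, List.not_mem_nil, or_false] at hL
  rcases hL with rfl | rfl
  · have h1 := has_of_check hT (pentagon_mem_of_fanE h) (holds_map_tile h) check_neighbour_aca
    rw [has_around] at h1
    refine faultTile_notMem (hT.pull _) h1 (tile_mem_pull.2 ?_)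
    rw [show Placement.comp (.mkAt (Pt.vtx E) 11 A true) faultTile =
      .mkAt (Pt.vtx E) 14 C false by decide +kernel]
    exact h _ (by decide +kernel)
  · have h1 := has_of_check hT (pentagon_mem_of_fanE h) (holds_map_tile h)
      check_neighbour_aca_reflected
    rw [has_around] at h1
    refine faultTile_notMem (hT.pull _) h1 (tile_mem_pull.2 ?_)
    rw [show Placement.comp (.mkAt (Pt.vtx E) 16 A false) faultTile =
      .mkAt (Pt.vtx E) 14 C true by decide +kernel]
    exact h _ (by decide +kernel)

/-- The dichotomy at the corner `E` of the pentagon in its standard position. -/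
lemma has_adeFans_or_eeeFans (h₀ : pentagon ∈ T) : Has adeFans T ∨ Has eeeFans T := by
  rcases (has_of_pentagon_mem hT h₀).or with h | h
  · exact Or.inl (h.or.resolve_right (not_has_faultFans hT))
  · exact Or.inr h

lemma has_adeFans_shift_one (h : Has adeFans T) :
    Has adeFans (pull (Placement.shift 1).toFrame T) :=
  (has_next hT h.left).or.resolve_right (not_has_faultFans (hT.pull _))

lemma has_adeFans_shift_neg_one (h : Has adeFans T) :
    Has adeFans (pull (Placement.shift (-1)).toFrame T) := by
  have key : ∀ {P Q : Placement}, Has (around (.shift (-1)) (adeFans ++ faultFans) ++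
      around P faultFans ++ around Q faultFans) T →
      Has adeFans (pull (Placement.shift (-1)).toFrame T) := by
    intro P Q h
    rcases h.or with h | h
    · rcases h.or with h | h
      · exact (has_around.1 h).or.resolve_right (not_has_faultFans (hT.pull _))
      · exact absurd (has_around.1 h) (not_has_faultFans (hT.pull _))
    · exact absurd (has_around.1 h) (not_has_faultFans (hT.pull _))
  obtain ⟨L, hL, h⟩ := h
  simp only [adeFans, List.mem_cons, List.not_mem_nil, or_false] at hL
  rcases hL with rfl | rfl
  · exact key (has_of_check hT (pentagon_mem_of_fanE h) (holds_map_tile h) check_prev_ad)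
  · exact key (has_of_check hT (pentagon_mem_of_fanE h) (holds_map_tile h) check_prev_da)

/-- A tile in the relation `A + D + E = 360°` belongs to an infinite row of such tiles, translates
of each other along the side `BC`. -/
lemma has_adeFans_shift (h : Has adeFans T) (r : ℤ) :
    Has adeFans (pull (Placement.shift r).toFrame T) := by
  induction r using Int.induction_on with
  | zero => rwa [pull_shift_zero]
  | succ n ih =>
    have := has_adeFans_shift_one (hT.pull _) ih
    rwa [pull_comp, shift_comp_shift] at this
  | pred n ih =>
    have := has_adeFans_shift_neg_one (hT.pull _) ih
    rwa [pull_comp, shift_comp_shift] at this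

omit hT in
lemma exists_fanE_of_mem_ade : ∀ L ∈ adeFans, ∃ l, L = fanE l := by
  simp [adeFans]

lemma shift_tile_mem (h : Has adeFans T) (r : ℤ) : (Placement.shift r).tile ∈ T :=
  pentagon_mem_of_has exists_fanE_of_mem_ade (has_adeFans_shift hT h r)

/-- The tiles across the two short sides of a tile in the relation `A + D + E = 360°` are in that
relation as well; the first one has its corner `E` at the corner `D`, the second one at the corner
`A`. -/
lemma exists_neighbours (h : Has adeFans T) :
    (∃ P : Placement, P.tile ∈ T ∧ P.corner E = Pt.vtx D ∧ Pt.vtx E ∈ [P.corner A, P.corner D] ∧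
      Has adeFans (pull P.toFrame T)) ∧
    (∃ P : Placement, P.tile ∈ T ∧ P.corner E = Pt.vtx A ∧ Pt.vtx E ∈ [P.corner A, P.corner D] ∧
      Has adeFans (pull P.toFrame T)) := by
  obtain ⟨L, hL, h⟩ := h
  have key : ∀ {P : Placement}, Has (around P (adeFans ++ faultFans)) T →
      Has adeFans (pull P.toFrame T) := fun h =>
    (has_around.1 h).or.resolve_right (not_has_faultFans (hT.pull _))
  simp only [adeFans, List.mem_cons, List.not_mem_nil, or_false] at hL
  have h₀ := fun l (h : ∀ P ∈ fanE l, P.tile ∈ T) => pentagon_mem_of_fanE h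
  rcases hL with rfl | rfl
  · exact ⟨⟨.mkAt (Pt.vtx E) 11 A true, h _ (by decide +kernel), by decide +kernel,
      by decide +kernel, key (has_of_check hT (h₀ _ h) (holds_map_tile h)
        check_neighbour_ad_first)⟩,
      ⟨.mkAt (Pt.vtx E) 14 D true, h _ (by decide +kernel), by decide +kernel,
      by decide +kernel, key (has_of_check hT (h₀ _ h) (holds_map_tile h)
        check_neighbour_ad_second)⟩⟩
  · exact ⟨⟨.mkAt (Pt.vtx E) 11 D false, h _ (by decide +kernel), by decide +kernel,
      by decide +kernel, key (has_of_check hT (h₀ _ h) (holds_map_tile h)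
        check_neighbour_da_first)⟩,
      ⟨.mkAt (Pt.vtx E) 16 A false, h _ (by decide +kernel), by decide +kernel,
      by decide +kernel, key (has_of_check hT (h₀ _ h) (holds_map_tile h)
        check_neighbour_da_second)⟩⟩

/-- The corners at the corner `E` of a tile with `A + D + E = 360°`. -/
lemma relADE_of_has (h : Has adeFans T) : RelADE T (vertex E) := by
  have hal := hT.aligned (pentagon_mem_of_has exists_fanE_of_mem_ade h)
  obtain ⟨L, hL, h⟩ := h
  simp only [adeFans, List.mem_cons, List.not_mem_nil, or_false] at hL
  rw [← Pt.ev_vtx]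
  have hn : ∀ k, (Finset.univ.filter fun i => ![E, A, D] i = k).card =
      (fun k => match k with | A => 1 | B => 0 | C => 0 | D => 1 | E => 1 : Corner → ℕ) k := by
    intro k; cases k <;> decide
  have hn' : ∀ k, (Finset.univ.filter fun i => ![E, D, A] i = k).card =
      (fun k => match k with | A => 1 | B => 0 | C => 0 | D => 1 | E => 1 : Corner → ℕ) k := by
    intro k; cases k <;> decide
  rcases hL with rfl | rfl
  · have := cornersAre_of_placements hT hal (q := Pt.vtx E) (P := ![.mkAt (Pt.vtx E) 7 E false,
      .mkAt (Pt.vtx E) 11 A true, .mkAt (Pt.vtx E) 14 D true]) (c := ![E, A, D])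
      (by simp only [Fin.forall_fin_succ]; exact ⟨h _ (by decide +kernel), h _ (by decide +kernel),
            h _ (by decide +kernel), fun i => i.elim0⟩)
      (by decide +kernel) (by decide +kernel) (by decide +kernel) hn
    simpa [RelADE] using this
  · have := cornersAre_of_placements hT hal (q := Pt.vtx E) (P := ![.mkAt (Pt.vtx E) 7 E false,
      .mkAt (Pt.vtx E) 11 D false, .mkAt (Pt.vtx E) 16 A false]) (c := ![E, D, A])
      (by simp only [Fin.forall_fin_succ]; exact ⟨h _ (by decide +kernel), h _ (by decide +kernel),
            h _ (by decide +kernel), fun i => i.elim0⟩)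
      (by decide +kernel) (by decide +kernel) (by decide +kernel) hn'
    simpa [RelADE] using this

/-- The corners at the corner `E` of a tile with `3E = 360°`. -/
lemma relEEE_of_has (h₀ : pentagon ∈ T) (h : Has eeeFans T) : RelEEE T (vertex E) := by
  have hal := hT.aligned h₀
  obtain ⟨L, hL, h⟩ := h
  have key : ∀ σ τ : Bool, (∀ P ∈ fanE [(E, σ), (E, τ)], P.tile ∈ T) → RelEEE T (vertex E) := by
    intro σ τ h
    rw [← Pt.ev_vtx]
    have hn : ∀ k, (Finset.univ.filter fun i => ![E, E, E] i = k).card =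
        (fun k => match k with | A => 0 | B => 0 | C => 0 | D => 0 | E => 3 : Corner → ℕ) k := by
      intro k; cases k <;> decide
    have := cornersAre_of_placements hT hal (q := Pt.vtx E) (P := ![.mkAt (Pt.vtx E) 7 E false,
      .mkAt (Pt.vtx E) 11 E σ, .mkAt (Pt.vtx E) 15 E τ]) (c := ![E, E, E])
      (by simp only [Fin.forall_fin_succ]; exact ⟨h _ (by simp [fanE, fan]),
            h _ (by simp [fanE, fan, width]), h _ (by simp [fanE, fan, width]), fun i => i.elim0⟩)
      (by cases σ <;> cases τ <;> decide +kernel) (by cases σ <;> cases τ <;> decide +kernel)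
      (by cases σ <;> cases τ <;> decide +kernel) hn
    simpa [RelEEE] using this
  simp only [eeeFans, List.mem_cons, List.not_mem_nil, or_false] at hL
  rcases hL with rfl | rfl | rfl | rfl <;> exact key _ _ h

end

/-! ### Points inside edges -/

lemma image_convexHull_congr (g : ℂ ≃ᵢ ℂ) (s : Set ℂ) :
    g '' convexHull ℝ s = convexHull ℝ (g '' s) :=
  AffineMap.image_convexHull g.toRealAffineIsometryEquiv.toAffineEquiv.toAffineMap s

lemma convex_image_pentagon (g : ℂ ≃ᵢ ℂ) : Convex ℝ (g '' pentagon) := by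
  rw [pentagon, image_convexHull_congr]; exact convex_convexHull ℝ _

lemma side_vertex (k : Corner) : side k (vertex k) = 0 := by
  rw [vertex_coord]
  cases k <;> simp only [side_eq_zero_coord, rside] <;> norm_num

lemma side_prev_vertex (k : Corner) : side (prev k) (vertex k) = 0 := by
  rw [vertex_coord]
  cases k <;> simp only [prev, side_eq_zero_coord, rside] <;> norm_num

/-- The line through the edge starting at the corner `k`. -/
lemma exists_eq_add_of_side_eq_zero {k : Corner} {w : ℂ} (h : side k w = 0) :
    ∃ s : ℝ, w = vertex k + s * ζ ^ dirIdx k := by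
  have h1 : slope (dirIdx k) (w - vertex k) = 0 := by
    have := side_add k (vertex k) (w - vertex k)
    rw [add_sub_cancel, h, side_vertex, zero_add] at this
    exact this.symm
  refine ⟨(conj (ζ ^ dirIdx k) * (w - vertex k)).re, ?_⟩
  have h2 : (((conj (ζ ^ dirIdx k) * (w - vertex k)).re : ℝ) : ℂ) =
      conj (ζ ^ dirIdx k) * (w - vertex k) := by
    apply Complex.ext
    · simp
    · rw [Complex.ofReal_im]; exact h1.symm
  have h3 : ζ ^ dirIdx k * conj (ζ ^ dirIdx k) = 1 := by
    rw [Complex.mul_conj, Complex.normSq_eq_norm_sq, norm_ζ_pow]; simp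
  rw [h2]
  linear_combination (vertex k - w) * h3

/-- The pentagon meets the line through one of its edges only in this edge. -/
lemma mem_segment_of_side_eq_zero {k : Corner} {w : ℂ} (hw : w ∈ pentagon)
    (h : side (prev k) w = 0) : w ∈ segment ℝ (vertex (prev k)) (vertex k) := by
  obtain ⟨x, y, rfl⟩ := exists_coord w
  have hw := mem_pentagon_iff.1 hw
  simp only [side_nonneg_coord] at hw
  have hA := hw A
  have hB := hw B
  have hC := hw C
  have hD := hw D
  have hE := hw E
  rw [side_eq_zero_coord] at h
  simp only [rside] at hA hB hC hD hE
  have key : ∀ s x₀ y₀ x₁ y₁ : ℝ, 0 ≤ s → s ≤ 1 → x = (1 - s) * x₀ + s * x₁ →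
      y = (1 - s) * y₀ + s * y₁ → (⟨x, √3 * y⟩ : ℂ) ∈
        segment ℝ (⟨x₀, √3 * y₀⟩ : ℂ) ⟨x₁, √3 * y₁⟩ := by
    rintro s x₀ y₀ x₁ y₁ h0 h1 rfl rfl
    refine ⟨1 - s, s, by linarith, h0, by ring, ?_⟩
    apply Complex.ext
    · simp
    · simp; ring
  rw [vertex_coord, vertex_coord]
  cases k <;> simp only [rside, prev] at h ⊢
  · exact key (1 - 2 * x) _ _ _ _ (by linarith) (by linarith) (by ring) (by linarith)
  · exact key (2 * x) _ _ _ _ (by linarith) (by linarith) (by ring) (by linarith)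
  · exact key (x - 1 / 2) _ _ _ _ (by linarith) (by linarith) (by ring) (by linarith)
  · exact key (1 + 2 * y) _ _ _ _ (by linarith) (by linarith) (by linarith) (by ring)
  · exact key (6 * y) _ _ _ _ (by linarith) (by linarith) (by linarith) (by ring)

lemma lt_six_iff {X Y : ℕ} (h : (X + Y) % 12 = 5) : X % 12 < 6 ↔ Y % 12 < 6 := by omega

/-- At a point that is no corner, an aligned tile covers all sectors, or the six sectors on one side
of a line containing one of its edges. -/
lemma cov_of_not_corner {x : ℂ} {n : ℕ} {σ : Bool} {q : ℂ} (hq : q ∈ frame x n σ '' pentagon)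
    (hc : ∀ k, ¬ IsCorner (frame x n σ '' pentagon) k q) :
    (∀ j, Cov (frame x n σ '' pentagon) q j) ∨ ∃ k w, frame x n σ w = q ∧ side k w = 0 ∧
      ∀ j, Cov (frame x n σ '' pentagon) q j ↔
        (11 * (bif σ then n + 11 * dirIdx k + 6 else n + dirIdx k) + j) % 12 < 6 := by
  obtain ⟨w, hw, rfl⟩ := hq
  obtain ⟨k, hk⟩ := exists_side_of_ne_vertex hw fun k hk => hc k (isCorner_image.2 (by rw [hk]))
  have hk0 := mem_pentagon_iff.1 hw k
  simp only [cov_frame, cov_pentagon_iff]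
  rcases hk0.lt_or_eq with h | h
  · refine Or.inl fun j l => ?_
    by_cases hl : l = k
    · subst hl; exact Or.inl h
    · exact Or.inl (hk l hl)
  · refine Or.inr ⟨k, w, rfl, h.symm, fun j => ?_⟩
    have : SideCov w (localSec n σ j) ↔ (11 * dirIdx k + localSec n σ j) % 12 < 6 := by
      refine ⟨fun hs => ((hs k).resolve_left h.not_lt).2, fun hs l => ?_⟩
      by_cases hl : l = k
      · subst hl; exact Or.inr ⟨h.symm, hs⟩
      · exact Or.inl (hk l hl)
    rw [this]
    cases σ <;> simp only [localSec, cond_true, cond_false]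
    · omega
    · exact lt_six_iff (by omega)

/-- At a point that is no corner, a tile fills at least a half plane. -/
lemma exists_half {t : Set ℂ} (ht : Aligned t) {q : ℂ} (hq : q ∈ t)
    (hc : ∀ k, ¬ IsCorner t k q) : ∃ c, ∀ j, (11 * c + j) % 12 < 6 → Cov t q j := by
  obtain ⟨x, n, σ, rfl⟩ := ht
  rcases cov_of_not_corner hq hc with h | ⟨k, w, -, -, h⟩
  · exact ⟨0, fun j _ => h j⟩
  · exact ⟨_, fun j hj => (h j).2 hj⟩

/-- Different tiles that cover six consecutive sectors each are opposite to each other. -/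
lemma IsTHTiling.opposite {T : Set (Set ℂ)} (hT : IsTHTiling T) (hal : ∀ t ∈ T, Aligned t) {q : ℂ}
    {s s' : Set ℂ} (hs : s ∈ T) (hs' : s' ∈ T) (hne : s ≠ s') {i i' : ℕ}
    (h : ∀ j, (11 * i + j) % 12 < 6 → Cov s q j)
    (h' : ∀ j, (11 * i' + j) % 12 < 6 → Cov s' q j) : i % 12 = (i' + 6) % 12 := by
  by_contra hcon
  apply hne
  have : ∃ j, (11 * i + j) % 12 < 6 ∧ (11 * i' + j) % 12 < 6 := by
    have e1 : (11 * i + i') % 12 = (12 + i' % 12 - i % 12) % 12 := by omega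
    have e2 : (11 * i' + i) % 12 = (12 + i % 12 - i' % 12) % 12 := by omega
    by_cases h6 : (11 * i + i') % 12 < 6
    · exact ⟨i', h6, by omega⟩
    · refine ⟨i, by omega, ?_⟩
      rw [e2]
      rw [e1] at h6
      have : i % 12 ≠ (i' % 12 + 6) % 12 := by omega
      have := Nat.mod_lt i (show 12 > 0 by norm_num)
      have := Nat.mod_lt i' (show 12 > 0 by norm_num)
      generalize i % 12 = a at *
      generalize i' % 12 = b at *
      omega
  obtain ⟨j, hj, hj'⟩ := this
  exact hT.eq_of_cov hs hs' (hal s hs) (hal s' hs') (h j hj) (h' j hj')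

/-- A point that is no vertex belongs to at most two tiles. -/
lemma IsTHTiling.eq_of_not_isVertex {T : Set (Set ℂ)} (hT : IsTHTiling T)
    (hal : ∀ t ∈ T, Aligned t) {q : ℂ} (hq : ¬ IsVertex T q) {t u v : Set ℂ} (ht : t ∈ T)
    (hu : u ∈ T) (hv : v ∈ T) (hqt : q ∈ t) (hqu : q ∈ u) (hqv : q ∈ v) (htu : t ≠ u)
    (htv : t ≠ v) : u = v := by
  have hc : ∀ s ∈ T, ∀ k, ¬ IsCorner s k q := fun s hs k h => hq ⟨s, hs, k, h⟩
  obtain ⟨a, ha⟩ := exists_half (hal t ht) hqt (hc t ht)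
  obtain ⟨b, hb⟩ := exists_half (hal u hu) hqu (hc u hu)
  obtain ⟨c, hc⟩ := exists_half (hal v hv) hqv (hc v hv)
  by_contra huv
  have h1 := hT.opposite hal ht hu htu ha hb
  have h2 := hT.opposite hal ht hv htv ha hc
  have h3 := hT.opposite hal hu hv huv hb hc
  omega

/-! ### Both sides of a row of tiles -/

lemma shift_apply (r : ℤ) (z : ℂ) : (Placement.shift r).toFrame z = z + r := by
  have : (Placement.shift r).x.ev = r := by
    have h3 := sqrt_three_mul_self
    have h0 := sqrt_three_pos
    apply Complex.ext <;> simp only [Placement.shift, Pt.ev_re, Pt.ev_im] <;> push_cast <;>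
      field_simp
    · simp; nlinarith
    · simp
  rw [Placement.toFrame, frame_apply, this]
  simp [Placement.shift, flip, add_comm]

section

variable {T : Set (Set ℂ)} (hT : IsTHTiling T)
include hT

/-- The tiles of a row cover the upper half plane near the line through their sides `BC`. -/
lemma exists_cov_above (h : Has adeFans T) (r : ℝ) {i : ℕ} (hi : i % 12 < 6) :
    ∃ u ∈ T, Cov u (vertex B + r) i ∧ ∀ z ∈ u, 0 ≤ side B z := by
  have hcov : ∀ n : ℤ, (0 ≤ r - n ∧ r - n < 1 ∧ i % 12 < 4) ∨ (0 < r - n ∧ r - n ≤ 1 ∧ 4 ≤ i % 12) →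
      Cov (Placement.shift n).tile (vertex B + r) i := by
    intro n hn
    have e : vertex B + (r : ℂ) = (Placement.shift n).toFrame (vertex B + ((r - n : ℝ) : ℂ)) := by
      rw [shift_apply]; push_cast; ring
    rw [e, Placement.tile, Placement.toFrame, cov_frame, cov_pentagon_iff]
    have e2 : vertex B + ((r - n : ℝ) : ℂ) = ⟨1 / 2 + (r - n), √3 * (-1 / 2)⟩ := by
      rw [vertex_coord]; apply Complex.ext <;> simp
    intro k
    rw [e2, side_pos_coord, side_eq_zero_coord]
    simp only [localSec, Placement.shift, cond_false]
    cases k <;> simp only [rside, dirIdx]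
    · rcases hn with ⟨h1, h2, h3⟩ | ⟨h1, h2, h3⟩
      · rcases h1.lt_or_eq with h | h
        · left; linarith
        · right; exact ⟨by linarith, by omega⟩
      · left; linarith
    · right; exact ⟨by ring, by omega⟩
    · rcases hn with ⟨h1, h2, h3⟩ | ⟨h1, h2, h3⟩
      · left; linarith
      · rcases h2.lt_or_eq with h | h
        · left; linarith
        · right; exact ⟨by linarith, by omega⟩
    · left; rcases hn with ⟨h1, h2, h3⟩ | ⟨h1, h2, h3⟩ <;> linarith
    · left; rcases hn with ⟨h1, h2, h3⟩ | ⟨h1, h2, h3⟩ <;> linarith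
  have hside : ∀ n : ℤ, ∀ z ∈ (Placement.shift n).tile, 0 ≤ side B z := by
    rintro n _ ⟨z, hz, rfl⟩
    have := mem_pentagon_iff.1 hz B
    rw [shift_apply, side_add, slope_dirIdx]
    simpa using this
  by_cases h4 : i % 12 < 4
  · exact ⟨_, shift_tile_mem hT h ⌊r⌋, hcov _ (Or.inl ⟨by linarith [Int.floor_le r],
      by linarith [Int.lt_floor_add_one r], h4⟩), hside _⟩
  · refine ⟨_, shift_tile_mem hT h (⌈r⌉ - 1), hcov _ (Or.inr ⟨?_, ?_, by omega⟩), hside _⟩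
    · push_cast; linarith [Int.ceil_lt_add_one r]
    · push_cast; linarith [Int.le_ceil r]

omit hT in
lemma ev_rot_dir (d : ℕ) (r : ℤ) : (Pt.rot d ⟨0, 2 * r, 0, -r⟩).ev = r * ζ ^ d := by
  have : (⟨0, 2 * r, 0, -r⟩ : Pt).ev = r := by
    have h := shift_apply r 0
    rw [Placement.toFrame, frame_apply] at h
    simpa [flip, Placement.shift] using h
  rw [Pt.ev_rot, this, mul_comm]

/-- A row of tiles, seen from a tile on the other side of the line through its sides `BC`. -/
lemma walls_hold (h : Has adeFans T) {x : ℂ} {n : ℕ} {σ : Bool} {k : Corner} {r : ℝ}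
    (hx : frame x n σ (vertex k) = vertex B + r)
    (hn : n % 12 = (bif σ then dirIdx k else 6 + 11 * dirIdx k) % 12) (l : List ℤ) :
    ∀ e ∈ walls k l, e.Holds (pull (frame x n σ) T) := by
  intro e he
  obtain ⟨s, -, rfl⟩ := List.mem_map.1 he
  set q := (Pt.vtx k).add (Pt.rot (dirIdx k) ⟨0, 2 * s, 0, -s⟩) with hq
  have hqe : q.ev = vertex k + s * ζ ^ dirIdx k := by
    rw [hq, Pt.ev_add, Pt.ev_vtx, ev_rot_dir]
  have hfq : ∃ r' : ℝ, frame x n σ q.ev = vertex B + r' := by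
    rw [hqe, frame_add, hx]
    cases σ
    · refine ⟨r - s, ?_⟩
      have : ζ ^ n * (s * ζ ^ dirIdx k) = -s := by
        rw [mul_left_comm, ← pow_add, ζ_pow_congr (show (n + dirIdx k) % 12 = 6 % 12 by
          simp only [cond_false] at hn; omega), ζ_pow_six]; ring
      simp only [flip, cond_false, this]; push_cast; ring
    · refine ⟨r + s, ?_⟩
      have : ζ ^ n * conj (s * ζ ^ dirIdx k) = s := by
        rw [map_mul, conj_ζ_pow, mul_left_comm, ← pow_add, ζ_pow_congr
          (show (n + 11 * dirIdx k) % 12 = 0 % 12 by simp only [cond_true] at hn; omega)]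
        simp
      simp only [flip, cond_true, this]; push_cast; ring
  obtain ⟨r', hr'⟩ := hfq
  intro i hi
  obtain ⟨j, hj, hji⟩ : ∃ j, j % 12 < 6 ∧ localSec n σ j % 12 = i % 12 := by
    cases σ
    · simp only [cond_false] at hn
      exact ⟨i + n, by omega, by simp only [localSec, cond_false]; omega⟩
    · simp only [cond_true] at hn
      exact ⟨n + 11 + 11 * i, (lt_six_iff (by omega)).1 hi,
        by simp only [localSec, cond_true]; omega⟩
  obtain ⟨u, hu, hcov, hs⟩ := exists_cov_above hT h r' hj
  refine ⟨(frame x n σ).symm '' u, ?_, ?_, ?_⟩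
  · rwa [mem_pull, image_symm_image]
  · refine Cov.congr ?_ hji
    rw [← cov_frame (x := x), image_symm_image, hr']
    exact hcov
  · rintro _ ⟨z, hz, rfl⟩
    have h1 := hs z hz
    have h2 : side B z = slope 0 (z - frame x n σ q.ev) := by
      have := side_add B (frame x n σ q.ev) (z - frame x n σ q.ev)
      rw [add_sub_cancel] at this
      rw [this, hr', side_add, side_vertex, slope_dirIdx]
      simp [dirIdx]
    have h3 : z - frame x n σ q.ev = ζ ^ n * flip σ ((frame x n σ).symm z - q.ev) := by
      conv_lhs => rw [← (frame x n σ).apply_symm_apply z]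
      simp only [frame_apply, flip_sub]; ring
    rw [h2, h3] at h1
    cases σ
    · simp only [cond_false] at hn
      rwa [slope_congr (show 0 % 12 = (n + (dirIdx k + 6)) % 12 by omega), slope_ζ_pow_mul] at h1
    · simp only [cond_true] at hn
      rwa [slope_congr (show 0 % 12 = (n + (6 + 11 * (dirIdx k + 6))) % 12 by omega),
        slope_ζ_pow_mul, flip, cond_true, slope_conj] at h1

/-- A tile with an edge on the other side of the line through the sides `BC` of a row has its side
`BC` there, and it belongs to a row itself. -/
lemma row_below (h : Has adeFans T) {x : ℂ} {n : ℕ} {σ : Bool} {k : Corner} {r : ℝ}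
    (hx : frame x n σ (vertex k) = vertex B + r)
    (hn : n % 12 = (bif σ then dirIdx k else 6 + 11 * dirIdx k) % 12)
    (hf : frame x n σ '' pentagon ∈ T) : k = B ∧ Has adeFans (pull (frame x n σ) T) := by
  have hT' := hT.pull (frame x n σ)
  have h₀ : pentagon ∈ pull (frame x n σ) T := hf
  have hw := walls_hold hT h hx hn
  have hb := holds_base h₀
  have none : ∀ {cfg : List Item} {ts : List ℕ}, (∀ e ∈ cfg, e.Holds (pull (frame x n σ) T)) →
      check [] 100 cfg ts ≠ some [] := fun hcfg hch => by
    obtain ⟨L, hL, -⟩ := has_of_check hT' h₀ hcfg hch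
    simp at hL
  have cons : ∀ l, ∀ e ∈ Item.tile .base :: walls k l, e.Holds (pull (frame x n σ) T) := by
    intro l e he
    rcases List.mem_cons.1 he with rfl | he
    exacts [hb, hw l e he]
  cases k
  · exact absurd check_line_A (none (cons _))
  · refine ⟨rfl, (has_adeFans_or_eeeFans hT' h₀).resolve_right ?_⟩
    have key : ∀ {L : List Placement} {ts : List ℕ}, (∀ P ∈ L, P.tile ∈ pull (frame x n σ) T) →
        check [] 100 (L.map .tile ++ walls B [-1, 0, 1]) ts ≠ some [] := by
      intro L ts hL
      refine none fun e he => ?_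
      rcases List.mem_append.1 he with he | he
      exacts [holds_map_tile hL e he, hw _ e he]
    rintro ⟨L, hL, hP⟩
    simp only [eeeFans, List.mem_cons, List.not_mem_nil, or_false] at hL
    rcases hL with rfl | rfl | rfl | rfl
    exacts [key hP check_line_B_ee, key hP check_line_B_ee_right, key hP check_line_B_ee_left,
      key hP check_line_B_ee_both]
  · exact absurd check_line_C (none (cons _))
  · exact absurd check_line_D (none (cons _))
  · exact absurd check_line_E (none (cons _))

/-! ### Propagation of the relation `A + D + E = 360°` -/

omit hT in
lemma pull_refl : pull (IsometryEquiv.refl ℂ) T = T := by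
  ext t
  rw [mem_pull]
  exact iff_of_eq (congrArg (· ∈ T) (Set.image_id t))

/-- The relation `A + D + E = 360°` passes to a neighbour. -/
lemma has_adeFans_of_neighbour (h : Has adeFans T) {u : Set ℂ} (hu : u ∈ T) {q : ℂ}
    (hq : q ∈ pentagon) (hqu : q ∈ u) (hqv : ¬ IsVertex T q) :
    ∃ f : ℂ ≃ᵢ ℂ, u = f '' pentagon ∧ Has adeFans (pull f T) := by
  have h₀ := pentagon_mem_of_has exists_fanE_of_mem_ade h
  have hal := hT.aligned h₀
  by_cases hpu : pentagon = u
  · refine ⟨IsometryEquiv.refl ℂ, by rw [← hpu]; exact (Set.image_id _).symm, ?_⟩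
    rwa [pull_refl]
  have hc : ∀ s ∈ T, ∀ k, ¬ IsCorner s k q := fun s hs k h => hqv ⟨s, hs, k, h⟩
  -- The neighbour is one of the tiles `P` as soon as `P` contains the edge with `q`.
  have key : ∀ k, side (prev k) q = 0 → (∃ P : Placement, P.tile ∈ T ∧
      (∃ l l', l ≠ l' ∧ P.corner l = Pt.vtx l') ∧ (∃ l, P.corner l = Pt.vtx (prev k)) ∧
      (∃ l, P.corner l = Pt.vtx k) ∧ Has adeFans (pull P.toFrame T)) →
      ∃ f : ℂ ≃ᵢ ℂ, u = f '' pentagon ∧ Has adeFans (pull f T) := by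
    rintro k hk ⟨P, hP, ⟨l, l', hl, hll⟩, ⟨l₁, hl₁⟩, ⟨l₂, hl₂⟩, hPa⟩
    refine ⟨P.toFrame, ?_, hPa⟩
    have hmem : ∀ {l m}, P.corner l = Pt.vtx m → vertex m ∈ P.tile := fun {l m} hl => by
      rw [← Pt.ev_vtx, ← hl, Placement.ev_corner]
      exact ⟨_, vertex_mem_pentagon l, rfl⟩
    refine hT.eq_of_not_isVertex hal hqv h₀ hu hP hq hqu ?_ hpu ?_
    · exact (convex_image_pentagon P.toFrame).segment_subset (hmem hl₁) (hmem hl₂)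
        (mem_segment_of_side_eq_zero hq hk)
    · intro heq
      have e1 : IsCorner P.tile l (Pt.vtx l').ev := (isCorner_tile hll).2 rfl
      rw [show P.tile = pentagon from heq.symm, ← Placement.tile_base, Placement.tile,
        isCorner_image, Placement.toFrame_base, Pt.ev_vtx] at e1
      exact hl (vertex_injective e1)
  obtain ⟨c, huc⟩ := exists_half (hal u hu) hqu (hc u hu)
  have hqs := mem_pentagon_iff.1 hq
  obtain ⟨k, hk⟩ := exists_side_of_ne_vertex hq fun k hk =>
    hc _ h₀ k (by
      have := isCorner_image (g := IsometryEquiv.refl ℂ) (k := k) (p := q)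
      rw [show (IsometryEquiv.refl ℂ) '' pentagon = pentagon from Set.image_id _] at this
      exact this.2 hk.symm)
  rcases (hqs k).lt_or_eq with hk0 | hk0
  · refine absurd (hT.eq_of_cov h₀ hu (hal _ h₀) (hal u hu) (j := c)
      (cov_pentagon_iff.2 fun l => Or.inl ?_) (huc c (by omega))) hpu
    by_cases hl : l = k
    · rwa [hl]
    · exact hk l hl
  have hshift : ∀ r, Has adeFans (pull (Placement.shift r).toFrame T) := has_adeFans_shift hT h
  obtain ⟨⟨P, hP, hPE, hPD, hPa⟩, ⟨Q, hQ, hQE, hQD, hQa⟩⟩ := exists_neighbours hT h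
  have hmem : ∀ {R : Placement} {p : Pt}, p ∈ [R.corner A, R.corner D] → ∃ l, R.corner l = p := by
    intro R p hp
    simp only [List.mem_cons, List.not_mem_nil, or_false] at hp
    rcases hp with rfl | rfl
    exacts [⟨A, rfl⟩, ⟨D, rfl⟩]
  cases k
  · exact key B hk0.symm ⟨.shift (-1), shift_tile_mem hT h _, ⟨C, B, by decide, by decide +kernel⟩,
      ⟨D, by decide +kernel⟩, ⟨C, by decide +kernel⟩, hshift _⟩
  · obtain ⟨s, hs⟩ := exists_eq_add_of_side_eq_zero hk0.symm
    obtain ⟨x, n, σ, rfl⟩ := hal u hu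
    rcases cov_of_not_corner hqu (hc _ hu) with hall | ⟨k, w, hw, hkw, hcov⟩
    · exact absurd (hT.eq_of_cov h₀ hu (hal _ h₀) (hal _ hu) (j := 0)
        (cov_pentagon_iff.2 fun l => by
        by_cases hl : l = B
        · subst hl; exact Or.inr ⟨hk0.symm, by decide⟩
        · exact Or.inl (hk l hl)) (hall 0)) hpu
    have hopp := hT.opposite hal h₀ hu hpu (q := q) (i := 0)
      (fun j hj => cov_pentagon_iff.2 fun l => by
        by_cases hl : l = B
        · subst hl; exact Or.inr ⟨hk0.symm, by simpa [dirIdx] using hj⟩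
        · exact Or.inl (hk l hl)) (fun j hj => (hcov j).2 hj)
    have hn : n % 12 = (bif σ then dirIdx k else 6 + 11 * dirIdx k) % 12 := by
      cases σ <;> simp only [cond_true, cond_false] at hopp ⊢ <;> omega
    obtain ⟨s', hs'⟩ := exists_eq_add_of_side_eq_zero hkw
    refine ⟨_, rfl, (row_below hT h (r := s - bif σ then s' else -s') ?_ hn hu).2⟩
    have h1 : q = frame x n σ (vertex k) + ζ ^ n * flip σ (s' * ζ ^ dirIdx k) := by
      rw [← frame_add, ← hs', hw]
    have h2 : ζ ^ n * flip σ (s' * ζ ^ dirIdx k) = ((bif σ then s' else -s' : ℝ) : ℂ) := by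
      rw [flip_real_mul, mul_left_comm]
      cases σ
      · simp only [flip, cond_false] at hn ⊢
        rw [← pow_add, ζ_pow_congr (show (n + dirIdx k) % 12 = 6 % 12 by omega), ζ_pow_six]
        simp
      · simp only [flip, cond_true] at hn ⊢
        rw [conj_ζ_pow, ← pow_add,
          ζ_pow_congr (show (n + 11 * dirIdx k) % 12 = 0 % 12 by omega)]
        simp
    rw [h2, hs] at h1
    simp only [dirIdx, pow_zero, mul_one] at h1
    rw [Complex.ofReal_sub]
    linear_combination -h1
  · exact key D hk0.symm ⟨.shift 1, shift_tile_mem hT h _, ⟨A, D, by decide, by decide +kernel⟩,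
      ⟨B, by decide +kernel⟩, ⟨A, by decide +kernel⟩, hshift _⟩
  · exact key E hk0.symm ⟨P, hP, ⟨E, D, by decide, hPE⟩, ⟨E, hPE⟩, hmem hPD, hPa⟩
  · exact key A hk0.symm ⟨Q, hQ, ⟨E, A, by decide, hQE⟩, hmem hQD, ⟨E, hQE⟩, hQa⟩

/-- If `A + D + E = 360°` holds for one tile, it holds for all tiles. -/
lemma forall_has_adeFans {g₀ : ℂ ≃ᵢ ℂ} (h₀ : g₀ '' pentagon ∈ T) (h : Has adeFans (pull g₀ T)) :
    ∀ t ∈ T, ∃ g : ℂ ≃ᵢ ℂ, t = g '' pentagon ∧ Has adeFans (pull g T) := by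
  refine hT.forall_of_neighbours h₀ ⟨g₀, rfl, h⟩ ?_
  rintro _ ht u hu ⟨g, rfl, hg⟩ q hqt hqu hqv
  obtain ⟨w, hw, rfl⟩ := hqt
  obtain ⟨f, hf, hf'⟩ := has_adeFans_of_neighbour (hT.pull g) hg (u := g.symm '' u)
    (by rwa [mem_pull, image_symm_image]) hw ⟨_, hqu, by simp⟩ (by rwa [isVertex_pull])
  refine ⟨f.trans g, ?_, by rwa [pull_trans]⟩
  rw [image_trans, ← hf, image_symm_image]

/-! ### Variations of Type 1 tilings -/

/-- The relation `B + C = 180°` at the corner `B` of a tile of a row. -/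
lemma relBC_of_has (h : Has adeFans T) : RelBC T (vertex B) := by
  have h₀ := pentagon_mem_of_has exists_fanE_of_mem_ade h
  have hal := hT.aligned h₀
  obtain ⟨u, hu, hcov⟩ := hT.exists_cov (vertex B) 6
  have hcov' : ¬ Cov u (vertex B) (6 + 11) := by
    intro h5
    obtain ⟨v, hv, hv5, hvs⟩ := exists_cov_above hT h 0 (i := 5) (by norm_num)
    rw [Complex.ofReal_zero, add_zero] at hv5
    obtain rfl := hT.eq_of_cov hu hv (hal u hu) (hal v hv) h5 (hv5.congr (by norm_num))
    obtain ⟨-, r, hr, hr'⟩ := hcov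
    have := hvs _ hr'
    rw [side_add_mul, side_vertex, zero_add] at this
    have h6 : slope (dirIdx B) (mid 6) < 0 := slope_mid_neg (by decide)
    nlinarith
  have hbase : Placement.base.tile ∈ T := by rwa [Placement.tile_base]
  have hprev := shift_tile_mem hT h (-1)
  obtain ⟨x, n, σ, rfl⟩ := hal u hu
  have hcard : ∀ (c : Fin 4 → Corner) (hc : c = ![B, C, B, C] ∨ c = ![B, C, C, B]) (k : Corner),
      (Finset.univ.filter fun i => c i = k).card =
        (fun k => match k with | A => 0 | B => 2 | C => 2 | D => 0 | E => 0 : Corner → ℕ) k := by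
    rintro c (rfl | rfl) k <;> cases k <;> decide
  rcases cov_frame_cases hcov hcov' with ⟨k, hk, hj⟩ | ⟨-, hi⟩
  · right
    have htile := Placement.tile_mkAt (hk.trans (Pt.ev_vtx B).symm) hj
    set Q := Placement.mkAt (Pt.vtx B) 6 k σ with hQ
    have hf : frame x n σ = Q.toFrame := congr_of_image_pentagon_eq htile
    rw [htile] at hu
    have hrow : ∀ s, Has adeFans (pull (frame x n σ) T) → (Q.comp (.shift s)).tile ∈ T :=
      fun s hs => by
        rw [hf] at hs
        exact tile_mem_pull.1 (shift_tile_mem (hT.pull _) hs s)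
    cases σ
    · obtain ⟨rfl, hs⟩ := row_below hT h (r := 0) (k := k) (by simpa using hk)
        (by simp only [startSec, cond_false] at hj ⊢; omega) (by rwa [htile])
      have := cornersAre_of_placements hT hal (q := Pt.vtx B)
        (P := ![.base, .shift (-1), Q, Q.comp (.shift (-1))]) (c := ![B, C, B, C])
        (by simp only [Fin.forall_fin_succ]; exact ⟨hbase, hprev, hu, hrow _ hs, fun i => i.elim0⟩)
        (by rw [hQ]; decide +kernel) (by rw [hQ]; decide +kernel) (by rw [hQ]; decide +kernel)
        (hcard _ (Or.inl rfl))
      rw [Pt.ev_vtx] at this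
      simpa using this
    · obtain ⟨s, hs⟩ := exists_eq_add_of_side_eq_zero (side_prev_vertex k)
      have hn : n % 12 = (bif true then dirIdx (prev k) else 6 + 11 * dirIdx (prev k)) % 12 := by
        simp only [startSec, cond_true] at hj ⊢; omega
      have hx : frame x n true (vertex (prev k)) = vertex B + ((-s : ℝ) : ℂ) := by
        have h1 := hk
        simp only [cond_true] at hn
        rw [hs, frame_add, flip_real_mul, mul_left_comm, flip, cond_true, conj_ζ_pow, ← pow_add,
          ζ_pow_congr (show (n + 11 * dirIdx (prev k)) % 12 = 0 % 12 by omega)] at h1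
        push_cast
        linear_combination h1
      obtain ⟨hkB, hsB⟩ := row_below hT h hx hn (by rwa [htile])
      have hkC : k = C := by cases k <;> simp_all [prev]
      subst hkC
      have := cornersAre_of_placements hT hal (q := Pt.vtx B)
        (P := ![.base, .shift (-1), Q, Q.comp (.shift 1)]) (c := ![B, C, C, B])
        (by simp only [Fin.forall_fin_succ]; exact ⟨hbase, hprev, hu, hrow _ hsB, fun i => i.elim0⟩)
        (by rw [hQ]; decide +kernel) (by rw [hQ]; decide +kernel) (by rw [hQ]; decide +kernel)
        (hcard _ (Or.inr rfl))
      rw [Pt.ev_vtx] at this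
      simpa using this
  · left
    have hbc : ∀ j, Cov Placement.base.tile (vertex B) j ↔ Placement.base.cov (Pt.vtx B) j = true :=
      fun j => by rw [← Pt.ev_vtx]; exact Placement.cov_iff.symm
    have hsc : ∀ j, Cov (Placement.shift (-1)).tile (vertex B) j ↔
        (Placement.shift (-1)).cov (Pt.vtx B) j = true :=
      fun j => by rw [← Pt.ev_vtx]; exact Placement.cov_iff.symm
    -- No corner of the pentagon is straight.
    have hstraight : ∀ k, ∀ a < 12, ¬ ((Pt.vtx k).sideCov a = true ∧
        ((Pt.vtx k).sideCov ((a + 5) % 12) = true ∨ (Pt.vtx k).sideCov ((a + 7) % 12) = true)) := by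
      intro k; cases k <;> decide +kernel
    have hnone : ∀ k, ¬ IsCorner (frame x n σ '' pentagon) k (vertex B) := by
      intro k hk
      rw [isCorner_image] at hk
      have e : ∀ j, (11 * 6 + j) % 12 < 6 → ∀ a, a % 12 = localSec n σ j % 12 →
          (Pt.vtx k).sideCov a = true := fun j hj a ha => by
        have := (hi j).2 hj
        rw [← hk, cov_frame] at this
        rw [Pt.sideCov_iff, ← cov_pentagon_iff, Pt.ev_vtx]
        exact this.congr ha.symm
      refine hstraight k (localSec n σ 6 % 12) (Nat.mod_lt _ (by norm_num))
        ⟨e 6 (by norm_num) _ (by omega), ?_⟩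
      cases σ
      · exact Or.inl (e 11 (by norm_num) _ (by simp only [localSec, cond_false]; omega))
      · exact Or.inr (e 11 (by norm_num) _ (by simp only [localSec, cond_true]; omega))
    have hcard3 : ∀ k, (Finset.univ.filter fun i => ![some B, some C, none] i = some k).card =
        (fun k => match k with | A => 0 | B => 1 | C => 1 | D => 0 | E => 0 : Corner → ℕ) k := by
      intro k; cases k <;> decide
    have := cornersAre_of_tiles hT hal (p := vertex B)
      (t := ![Placement.base.tile, (Placement.shift (-1)).tile, frame x n σ '' pentagon])
      (c := ![some B, some C, none])
      (by simp only [Fin.forall_fin_succ]; exact ⟨hbase, hprev, hu, fun i => i.elim0⟩)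
      (by
        have h0 : ∀ {a b : Set ℂ} (j : ℕ), Cov a (vertex B) j → ¬ Cov b (vertex B) j → a ≠ b := by
          rintro a b j h1 h2 rfl; exact h2 h1
        have n01 := h0 0 ((hbc 0).2 (by decide +kernel)) (mt (hsc 0).1 (by decide +kernel))
        have n02 := h0 0 ((hbc 0).2 (by decide +kernel)) (mt (hi 0).1 (by norm_num))
        have n12 := h0 5 ((hsc 5).2 (by decide +kernel)) (mt (hi 5).1 (by norm_num))
        intro i j hij
        fin_cases i <;> fin_cases j <;> first | rfl | (exfalso; simp_all))
      (fun j hj => by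
        simp only [Fin.exists_fin_succ]
        by_cases h6 : j < 6
        · have : Placement.base.cov (Pt.vtx B) j = true ∨
              (Placement.shift (-1)).cov (Pt.vtx B) j = true := by
            interval_cases j <;> decide +kernel
          rcases this with h | h
          · exact Or.inl ((hbc j).2 h)
          · exact Or.inr (Or.inl ((hsc j).2 h))
        · exact Or.inr (Or.inr (Or.inl ((hi j).2 (by omega)))))
      (by
        have e1 : ∀ k, IsCorner Placement.base.tile k (vertex B) ↔ B = k := fun k => by
          rw [← Pt.ev_vtx]; exact isCorner_tile (by decide +kernel)
        have e2 : ∀ k, IsCorner (Placement.shift (-1)).tile k (vertex B) ↔ C = k := fun k => by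
          rw [← Pt.ev_vtx]; exact isCorner_tile (by decide +kernel)
        simp only [Fin.forall_fin_succ]
        exact ⟨fun k => (e1 k).trans (by simp), fun k => (e2 k).trans (by simp),
          fun k => iff_of_false (hnone k) (by simp), fun i => i.elim0⟩)
      hcard3
    simpa using this

/-- All corners of a tile in the relation `A + D + E = 360°` are in this relation or in the relation
`B + C = 180°`. -/
lemma rel_of_has (h : Has adeFans T) (k : Corner) : RelADE T (vertex k) ∨ RelBC T (vertex k) := by
  obtain ⟨⟨P, hP, hPE, -, hPa⟩, ⟨Q, hQ, hQE, -, hQa⟩⟩ := exists_neighbours hT h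
  cases k
  · left
    have := relADE_of_has (hT.pull _) hQa
    rwa [RelADE, cornersAre_pull, ← Placement.ev_corner, hQE, Pt.ev_vtx] at this
  · exact Or.inr (relBC_of_has hT h)
  · right
    have := relBC_of_has (hT.pull _) (has_adeFans_shift hT h 1)
    have e : (Placement.shift 1).toFrame (vertex B) = vertex C := by
      rw [← Placement.ev_corner, ← Pt.ev_vtx]; congr 1
    rwa [RelBC, cornersAre_pull, cornersAre_pull, e] at this
  · left
    have := relADE_of_has (hT.pull _) hPa
    rwa [RelADE, cornersAre_pull, ← Placement.ev_corner, hPE, Pt.ev_vtx] at this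
  · exact Or.inl (relADE_of_has hT h)

/-- As the relation `A + D + E = 360°` spreads to all tiles, one tile in this relation determines
the relations at all corners. -/
lemma isTypeOneVariation_of_has {g₀ : ℂ ≃ᵢ ℂ} (h₀ : g₀ '' pentagon ∈ T)
    (h : Has adeFans (pull g₀ T)) : IsTypeOneVariation T := by
  refine ⟨hT, ?_⟩
  rintro p ⟨t, ht, k, hk⟩
  obtain ⟨g, rfl, hg⟩ := forall_has_adeFans hT h₀ h t ht
  have := rel_of_has (hT.pull g) hg k
  rw [isCorner_image] at hk
  rwa [RelADE, RelBC, cornersAre_pull, cornersAre_pull, cornersAre_pull, hk] at this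

/-! ### The two kinds of tilings -/

/-- Around the corner `E` of each tile. -/
lemma has_or_relEEE {g : ℂ ≃ᵢ ℂ} (h : g '' pentagon ∈ T) :
    Has adeFans (pull g T) ∨ (Has eeeFans (pull g T) ∧ RelEEE T (g (vertex E))) := by
  rcases has_adeFans_or_eeeFans (hT.pull g) h with h' | h'
  · exact Or.inl h'
  · exact Or.inr ⟨h', cornersAre_pull.1 (relEEE_of_has (hT.pull g) h h')⟩

omit hT in
lemma RelADE.not_relEEE {p : ℂ} (h : RelADE T p) : ¬ RelEEE T p := by
  intro h'
  have := h.2.2.2.2.symm.trans h'.2.2.2.2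
  norm_num at this

lemma relADE_or_relEEE {p : ℂ} (h : IsEPoint T p) : RelADE T p ∨ RelEEE T p := by
  obtain ⟨t, ht, hk⟩ := h
  obtain ⟨g, rfl⟩ := hT.exists_congr ht
  rw [isCorner_image] at hk
  rcases has_or_relEEE hT ht with h | h
  · left
    rw [← hk]
    exact cornersAre_pull.1 (relADE_of_has (hT.pull g) h)
  · right; rw [← hk]; exact h.2

omit hT in
lemma isEPoint_of_encard {p : ℂ} (h : (tilesAt T E p).encard ≠ 0) : IsEPoint T p := by
  obtain ⟨t, ht, hk⟩ := Set.encard_ne_zero.1 h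
  exact ⟨t, ht, hk⟩

lemma isTypeOneVariation_of_relADE {p : ℂ} (h : RelADE T p) : IsTypeOneVariation T := by
  obtain ⟨t, ht, hk⟩ := isEPoint_of_encard (T := T) (p := p) (by rw [h.2.2.2.2]; simp)
  obtain ⟨g, rfl⟩ := hT.exists_congr ht
  rw [isCorner_image] at hk
  refine isTypeOneVariation_of_has hT ht ((has_or_relEEE hT ht).resolve_right fun h' => ?_)
  rw [hk] at h'
  exact h.not_relEEE h'.2

omit hT in
lemma IsTypeOneVariation.not_relEEE (h : IsTypeOneVariation T) (p : ℂ) : ¬ RelEEE T p := by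
  intro hp
  obtain ⟨t, ht, hk⟩ := isEPoint_of_encard (T := T) (p := p) (by rw [hp.2.2.2.2]; simp)
  rcases h.2 p ⟨t, ht, E, hk⟩ with h | h | h
  · exact h.not_relEEE hp
  · have := h.2.2.2.2.symm.trans hp.2.2.2.2
    norm_num at this
  · have := h.2.2.2.2.symm.trans hp.2.2.2.2
    norm_num at this

lemma isTypeOneVariation_or_isEEETiling : IsTypeOneVariation T ∨ IsEEETiling T := by
  by_cases h : ∃ p, RelADE T p
  · obtain ⟨p, hp⟩ := h
    exact Or.inl (isTypeOneVariation_of_relADE hT hp)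
  · push Not at h
    exact Or.inr ⟨hT, fun p hp => (relADE_or_relEEE hT hp).resolve_left (h p)⟩

end

lemma IsADETiling.isTypeOneVariation {T : Set (Set ℂ)} (h : IsADETiling T) :
    IsTypeOneVariation T := by
  obtain ⟨t, ht, -⟩ := h.1.exists_mem 0
  obtain ⟨g, rfl⟩ := h.1.exists_congr ht
  exact isTypeOneVariation_of_relADE h.1 (h.2 _ ⟨_, ht, isCorner_image.2 rfl⟩)

/-! ### The heptiamonds as unions of three pentagons -/

/-- The ship if `s`, the windmill otherwise. -/
noncomputable def hept (s : Bool) : Set ℂ := bif s then ship else windmill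

/-- The three pentagons that make up `hept s`. They share their corner `E`, and exactly in the ship
the first one is reflected. -/
def piece (s : Bool) (i : Fin 3) : Placement :=
  Placement.mkAt (Pt.vtx E) (7 + 4 * i) E (s && decide (i = 0))

/-- The polygon spanned by a list of lattice points. -/
noncomputable def poly (l : List Pt) : Set ℂ := convexHull ℝ (Pt.ev '' {p | p ∈ l})

lemma poly_congr {l l' : List Pt} (h : l.Perm l') : poly l = poly l' := by
  simp only [poly, h.mem_iff]

lemma poly_triple (p q r : Pt) : poly [p, q, r] = convexHull ℝ {p.ev, q.ev, r.ev} := by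
  rw [poly]
  congr 1
  ext z
  simp [eq_comm]

/-- The coordinates of the point `lat m n`. -/
def latPt (m n : ℤ) : Pt := ⟨0, 2 * m + n, 0, n - m⟩

lemma ev_latPt (m n : ℤ) : (latPt m n).ev = lat m n := by
  have h3 : √3 ^ 2 = (3 : ℝ) := by norm_num
  have h0 := sqrt_three_pos
  apply Complex.ext <;> simp only [latPt, Pt.ev_re, Pt.ev_im, lat] <;> push_cast <;>
    field_simp
  · ring
  · rw [h3]; ring

lemma upTri_eq (m n : ℤ) :
    upTri m n = poly [latPt m n, latPt (m + 1) n, latPt m (n + 1)] := by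
  simp only [poly_triple, ev_latPt, upTri]

lemma downTri_eq (m n : ℤ) :
    downTri m n = poly [latPt (m + 1) n, latPt m (n + 1), latPt (m + 1) (n + 1)] := by
  simp only [poly_triple, ev_latPt, downTri]

lemma tile_eq_poly (P : Placement) : P.tile = poly [P.corner A, P.corner B, P.corner D] ∪
    poly [P.corner B, P.corner C, P.corner D] ∪ poly [P.corner A, P.corner D, P.corner E] := by
  simp only [poly_triple, Placement.ev_corner, Placement.tile]
  rw [pentagon_eq_union_triangles]
  simp only [Set.image_union, image_convexHull_congr, Set.image_insert_eq, Set.image_singleton]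

lemma exists_barycentric {a b c z : ℂ} (h : z ∈ convexHull ℝ {a, b, c}) :
    ∃ r s t : ℝ, 0 ≤ r ∧ 0 ≤ s ∧ 0 ≤ t ∧ r + s + t = 1 ∧ r * a + s * b + t * c = z := by
  rw [convexHull_insert (by simp), convexHull_pair, mem_convexJoin] at h
  obtain ⟨_, rfl, y, ⟨s, t, hs, ht, hst, rfl⟩, ⟨p, q, hp, hq, hpq, rfl⟩⟩ := h
  refine ⟨p, q * s, q * t, hp, by positivity, by positivity, ?_, ?_⟩
  · rw [add_assoc, ← mul_add, hst, mul_one, hpq]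
  · simp; ring

lemma convexHull_triple_eq_union_center {a b c e : ℂ} (he : a + b + c = 3 * e) :
    convexHull ℝ {a, b, c} =
      convexHull ℝ {a, b, e} ∪ convexHull ℝ {b, c, e} ∪ convexHull ℝ {c, a, e} := by
  have hmem : ∀ x ∈ ({a, b, c} : Set ℂ), x ∈ convexHull ℝ {a, b, c} := subset_convexHull ℝ _
  have hA := hmem a (by simp)
  have hB := hmem b (by simp)
  have hC := hmem c (by simp)
  have hE : e ∈ convexHull ℝ {a, b, c} :=
    mem_convexHull_triple (r := 1 / 3) (s := 1 / 3) (t := 1 / 3) (by norm_num) (by norm_num)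
      (by norm_num) (by norm_num) (by push_cast; linear_combination he / 3)
  have hsub : ∀ x y : ℂ, x ∈ convexHull ℝ {a, b, c} → y ∈ convexHull ℝ {a, b, c} →
      convexHull ℝ {x, y, e} ⊆ convexHull ℝ {a, b, c} := by
    intro x y hx hy
    refine convexHull_min ?_ (convex_convexHull ℝ _)
    rintro z (rfl | rfl | rfl) <;> assumption
  refine Set.Subset.antisymm (fun z hz => ?_)
    (Set.union_subset (Set.union_subset (hsub _ _ hA hB) (hsub _ _ hB hC)) (hsub _ _ hC hA))
  obtain ⟨r, s, t, hr, hs, ht, h1, h⟩ := exists_barycentric hz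
  -- The smallest of the three barycentric coordinates becomes that of the center.
  by_cases hrs : r ≤ s
  · by_cases hrt : r ≤ t
    · refine Or.inl (Or.inr (mem_convexHull_triple (r := s - r) (s := t - r) (t := 3 * r)
        (by linarith) (by linarith) (by linarith) (by linarith) ?_))
      push_cast; linear_combination h - r * he
    · refine Or.inl (Or.inl (mem_convexHull_triple (r := r - t) (s := s - t) (t := 3 * t)
        (by linarith) (by linarith) (by linarith) (by linarith) ?_))
      push_cast; linear_combination h - t * he
  · by_cases hst : s ≤ t
    · refine Or.inr (mem_convexHull_triple (r := t - s) (s := r - s) (t := 3 * s)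
        (by linarith) (by linarith) (by linarith) (by linarith) ?_)
      push_cast; linear_combination h - s * he
    · refine Or.inl (Or.inl (mem_convexHull_triple (r := r - t) (s := s - t) (t := 3 * t)
        (by linarith) (by linarith) (by linarith) (by linarith) ?_))
      push_cast; linear_combination h - t * he

lemma upTri_zero_zero : upTri 0 0 = poly [latPt 0 0, latPt 1 0, Pt.vtx E] ∪
    poly [latPt 1 0, latPt 0 1, Pt.vtx E] ∪ poly [latPt 0 1, latPt 0 0, Pt.vtx E] := by
  rw [upTri_eq]
  simp only [poly_triple]
  refine convexHull_triple_eq_union_center ?_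
  rw [Pt.ev_vtx, ev_latPt, ev_latPt, ev_latPt]
  apply Complex.ext <;> simp [lat, vertex] <;> ring

lemma hept_eq_iUnion (s : Bool) : hept s = ⋃ i, (piece s i).tile := by
  have h : ∀ {P : Placement} {a₁ a₂ b₁ b₂ b₃ c₁ c₂ c₃ : Pt},
      ([P.corner A, P.corner B, P.corner D].Perm [b₁, b₂, b₃] ∧
        [P.corner B, P.corner C, P.corner D].Perm [c₁, c₂, c₃] ∧
        [P.corner A, P.corner D, P.corner E].Perm [a₁, a₂, Pt.vtx E]) →
      P.tile = poly [b₁, b₂, b₃] ∪ poly [c₁, c₂, c₃] ∪ poly [a₁, a₂, Pt.vtx E] := by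
    rintro P a₁ a₂ b₁ b₂ b₃ c₁ c₂ c₃ ⟨h1, h2, h3⟩
    rw [tile_eq_poly, poly_congr h1, poly_congr h2, poly_congr h3]
  have h1 : ∀ s, (piece s 1).tile = downTri 0 0 ∪ upTri 0 1 ∪
      poly [latPt 1 0, latPt 0 1, Pt.vtx E] := fun s => by
    rw [downTri_eq, upTri_eq]; exact h (by cases s <;> decide +kernel)
  have h2 : ∀ s, (piece s 2).tile = downTri (-1) 0 ∪ upTri (-1) 0 ∪
      poly [latPt 0 1, latPt 0 0, Pt.vtx E] := fun s => by
    rw [downTri_eq, upTri_eq]; exact h (by cases s <;> decide +kernel)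
  have hU : ⋃ i, (piece s i).tile = (piece s 0).tile ∪ (piece s 1).tile ∪ (piece s 2).tile := by
    ext z
    simp [Fin.exists_fin_succ, or_assoc]
  rw [hU, h1, h2]
  cases s
  · have h0 : (piece false 0).tile = downTri 0 (-1) ∪ upTri 1 (-1) ∪
        poly [latPt 0 0, latPt 1 0, Pt.vtx E] := by
      rw [downTri_eq, upTri_eq]; exact h (by decide +kernel)
    rw [h0, hept, cond_false, windmill, upTri_zero_zero]
    ext z
    simp only [Set.mem_union]
    tauto
  · have h0 : (piece true 0).tile = downTri 0 (-1) ∪ upTri 0 (-1) ∪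
        poly [latPt 0 0, latPt 1 0, Pt.vtx E] := by
      rw [downTri_eq, upTri_eq]; exact h (by decide +kernel)
    rw [h0, hept, cond_true, ship, upTri_zero_zero]
    ext z
    simp only [Set.mem_union]
    tauto

lemma corner_piece (s : Bool) (i : Fin 3) : (piece s i).corner E = Pt.vtx E := by
  revert s i; decide +kernel

lemma piece_injective (s : Bool) : Function.Injective fun i => (piece s i).tile := by
  intro i j hij
  by_contra hne
  have h : ∀ s i j, i ≠ j → (piece s i).cov (Pt.vtx E) (7 + 4 * i) = true ∧
      (piece s j).cov (Pt.vtx E) (7 + 4 * i) = false := by decide +kernel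
  obtain ⟨h1, h2⟩ := h s i j hne
  rw [← Bool.not_eq_true, Placement.cov_iff] at h2
  rw [Placement.cov_iff] at h1
  simp only at hij
  exact h2 (hij ▸ h1)

/-- A tile lies inside the angle at its corner `E`. -/
lemma slope_nonneg_of_mem_mkAt {q : Pt} {j : ℕ} {σ : Bool} {z : ℂ}
    (hz : z ∈ (Placement.mkAt q j E σ).tile) :
    0 ≤ slope j (z - q.ev) ∧ 0 ≤ slope (j + 10) (z - q.ev) := by
  set P := Placement.mkAt q j E σ with hP
  obtain ⟨w, hw, rfl⟩ := hz
  have hq : q.ev = P.toFrame (vertex E) := by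
    rw [← Placement.ev_corner]
    congr 1
    simp [hP, Placement.corner, Placement.mkAt, Pt.add, Pt.sub]
  have hsub : P.toFrame w - q.ev = ζ ^ P.n * flip P.σ (w - vertex E) := by
    rw [hq]; simp only [Placement.toFrame, frame_apply, flip_sub]; ring
  have hside : ∀ k, side k (vertex E) = 0 → 0 ≤ slope (dirIdx k) (w - vertex E) := by
    intro k hk
    have := side_add k (vertex E) (w - vertex E)
    rw [add_sub_cancel, hk, zero_add] at this
    rw [← this]
    exact mem_pentagon_iff.1 hw k
  have hD := hside D (side_prev_vertex E)
  have hE := hside E (side_vertex E)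
  simp only [dirIdx] at hD hE
  rw [hsub]
  cases σ
  · have hn : P.n % 12 = (j + 11 * 7) % 12 := Nat.mod_mod _ _
    have hσ : P.σ = false := rfl
    rw [hσ, flip, cond_false, slope_congr (show j % 12 = (P.n + 7) % 12 by omega),
      slope_congr (show (j + 10) % 12 = (P.n + 5) % 12 by omega), slope_ζ_pow_mul, slope_ζ_pow_mul]
    exact ⟨hE, hD⟩
  · have hn : P.n % 12 = (j + 6 + 5) % 12 := Nat.mod_mod _ _
    have hσ : P.σ = true := rfl
    rw [hσ, flip, cond_true, slope_congr (show j % 12 = (P.n + (6 + 11 * 5)) % 12 by omega),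
      slope_congr (show (j + 10) % 12 = (P.n + (6 + 11 * 7)) % 12 by omega), slope_ζ_pow_mul,
      slope_ζ_pow_mul, slope_conj, slope_conj]
    exact ⟨hD, hE⟩

lemma slope_add_six (d : ℕ) (m : ℂ) : slope (d + 6) m = - slope d m := by
  rw [slope, slope, pow_add, ζ_pow_six]; simp

lemma disjoint_interior_of_slope {S S' : Set ℂ} {d : ℕ} {q : ℂ}
    (h : ∀ z ∈ S, 0 ≤ slope d (z - q)) (h' : ∀ z ∈ S', slope d (z - q) ≤ 0) :
    Disjoint (interior S) (interior S') := by
  rw [Set.disjoint_left]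
  intro z hz hz'
  have h1 : ∀ᶠ r : ℝ in 𝓝[>] 0, z + r * ζ ^ (d + 3) ∈ interior S' := by
    have hc : Continuous fun r : ℝ => z + r * ζ ^ (d + 3) := by fun_prop
    have := (hc.tendsto 0).mono_left (nhdsWithin_le_nhds (s := Set.Ioi 0))
    simp only [Complex.ofReal_zero, zero_mul, add_zero] at this
    exact this.eventually (isOpen_interior.mem_nhds hz')
  obtain ⟨r, hr, hr0⟩ := (h1.and self_mem_nhdsWithin).exists
  have h2 := h' _ (interior_subset hr)
  have h3 := h z (interior_subset hz)
  have h4 : slope d (ζ ^ (d + 3)) = 1 := by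
    have := slope_ζ_pow_mul d 0 (ζ ^ 3)
    rw [← pow_add, add_zero] at this
    rw [this, slope, ζ_pow_three]; simp
  rw [show z + r * ζ ^ (d + 3) - q = (z - q) + r * ζ ^ (d + 3) by ring, slope_add, slope_real_mul,
    h4] at h2
  have : (0 : ℝ) < r := hr0
  linarith

lemma disjoint_interior_piece (s : Bool) {i j : Fin 3} (hij : i ≠ j) :
    Disjoint (interior (piece s i).tile) (interior (piece s j).tile) := by
  have key : ∀ {i j : Fin 3}, ((7 + 4 * i : ℕ) + 4) % 12 = (7 + 4 * j : ℕ) % 12 →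
      Disjoint (interior (piece s j).tile) (interior (piece s i).tile) := by
    intro i j h
    refine disjoint_interior_of_slope (d := 7 + 4 * j) (q := (Pt.vtx E).ev)
      (fun z hz => (slope_nonneg_of_mem_mkAt hz).1) fun z hz => ?_
    have := (slope_nonneg_of_mem_mkAt hz).2
    rw [slope_congr (show (7 + 4 * i + 10 : ℕ) % 12 = (7 + 4 * j + 6 : ℕ) % 12 by omega),
      slope_add_six] at this
    linarith
  fin_cases i <;> fin_cases j <;> first
    | exact absurd rfl hij
    | exact key (by decide)
    | exact (key (by decide)).symm

/-! ### Congruences of the heptiamonds -/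

/-- The corners of the triangles of `hept s`. -/
def heptPts (s : Bool) : List (ℤ × ℤ) :=
  [(0, 0), (1, 0), (0, 1), (1, -1), (1, 1), (0, 2), (-1, 1), (-1, 0),
    bif s then (0, -1) else (2, -1)]

/-- The corners of the convex hull of `hept s`, each one with a point from which it is most
distant. -/
def heptExtreme (s : Bool) : List ((ℤ × ℤ) × (ℤ × ℤ)) :=
  bif s then [((0, -1), (-3, 6)), ((0, 2), (-6, -6)), ((1, 1), (-6, -5)), ((1, -1), (-6, 4)),
    ((-1, 0), (1, 0)), ((-1, 1), (2, -1))]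
  else [((2, -1), (-6, 0)), ((0, 2), (-6, -6)), ((-1, 0), (0, 2)), ((-1, 1), (2, -1)),
    ((1, 1), (-6, -5)), ((1, -1), (-2, 6))]

/-- The squared distance in the triangular lattice. -/
def latDist (p q : ℤ × ℤ) : ℤ :=
  (p.1 - q.1) ^ 2 + (p.1 - q.1) * (p.2 - q.2) + (p.2 - q.2) ^ 2

/-- The lists of points of `V` with the same mutual distances as the points of a list. -/
def sameDist (V : List (ℤ × ℤ)) : List (ℤ × ℤ) → List (List (ℤ × ℤ))
  | [] => [[]]
  | p :: ps => (sameDist V ps).flatMap fun l => (V.filter fun v =>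
      (ps.zip l).all fun x => decide (latDist p x.1 = latDist v x.2)).map (· :: l)

/-- The symmetries of `hept s`. -/
def heptSymm (s : Bool) : List Placement :=
  bif s then [.base] else [.base, .mkAt (Pt.vtx E) 11 E false, .mkAt (Pt.vtx E) 15 E false]

/-- The image of a point under the congruence of a placement. -/
def Placement.apply (P : Placement) (p : Pt) : Pt := P.x.add ((p.flip P.σ).rot P.n)

lemma Placement.ev_apply (P : Placement) (p : Pt) : (P.apply p).ev = P.toFrame p.ev := by
  rw [Placement.apply, Pt.ev_add, Pt.ev_rot, Pt.ev_flip]; rfl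

/-- Points of a heptiamond with the mutual distances of the points of `heptExtreme` are their images
under a symmetry, and the two heptiamonds are distinguished in this way. -/
lemma sameDist_heptPts : ∀ s s', ∀ l ∈ sameDist (heptPts s') ((heptExtreme s).map Prod.fst),
    s = s' ∧ ∃ P ∈ heptSymm s, l.map (fun p => latPt p.1 p.2) =
      (heptExtreme s).map fun p => P.apply (latPt p.1.1 p.1.2) := by
  decide +kernel

/-- A point of `heptExtreme` is as far as possible from the point listed with it. -/
lemma heptExtreme_dist : ∀ s, ∀ e ∈ heptExtreme s, e.1 ∈ heptPts s ∧
    ∀ v ∈ heptPts s, latDist v e.2 ≤ latDist e.1 e.2 := by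
  decide +kernel

/-- A symmetry of a heptiamond permutes its three pentagons. -/
lemma heptSymm_comp : ∀ s, ∀ P ∈ heptSymm s, (∀ i, ∃ j, P.comp (piece s i) = piece s j) ∧
    ∀ j, ∃ i, P.comp (piece s i) = piece s j := by
  decide +kernel

lemma dist_lat (p q : ℤ × ℤ) :
    dist (lat p.1 p.2) (lat q.1 q.2) ^ 2 = (latDist p q : ℝ) := by
  have h3 := sqrt_three_mul_self
  rw [dist_eq_norm, ← Complex.normSq_eq_norm_sq, Complex.normSq_apply]
  simp only [lat, latDist, Complex.sub_re, Complex.sub_im]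
  push_cast
  linear_combination ((p.2 - q.2 : ℝ) ^ 2 / 4) * h3

lemma mem_heptPts_iff {s : Bool} {p : ℤ × ℤ} :
    p ∈ heptPts s ↔ p = (0, 0) ∨ p = (1, 0) ∨ p = (0, 1) ∨
    p = (1, -1) ∨ p = (1, 1) ∨ p = (0, 2) ∨ p = (-1, 1) ∨ p = (-1, 0) ∨
      p = bif s then (0, -1) else (2, -1) := by
  simp [heptPts]

lemma lat_mem_hept {s : Bool} {p : ℤ × ℤ} (hp : p ∈ heptPts s) : lat p.1 p.2 ∈ hept s := by
  have hu : ∀ m n, lat m n ∈ upTri m n ∧ lat (m + 1) n ∈ upTri m n ∧ lat m (n + 1) ∈ upTri m n :=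
    fun m n => ⟨subset_convexHull ℝ _ (by simp), subset_convexHull ℝ _ (by simp),
      subset_convexHull ℝ _ (by simp)⟩
  have hd : ∀ m n, lat (m + 1) n ∈ downTri m n ∧ lat m (n + 1) ∈ downTri m n ∧
      lat (m + 1) (n + 1) ∈ downTri m n :=
    fun m n => ⟨subset_convexHull ℝ _ (by simp), subset_convexHull ℝ _ (by simp),
      subset_convexHull ℝ _ (by simp)⟩
  have u0 := hu 0 0
  have u1 := hu 0 1
  have u2 := hu (-1) 0
  have u3 := hu 1 (-1)
  have u4 := hu 0 (-1)
  have d0 := hd 0 (-1)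
  have d1 := hd 0 0
  norm_num at u0 u1 u2 u3 u4 d0 d1
  rw [mem_heptPts_iff] at hp
  cases s
  · simp only [hept, cond_false, windmill, Set.mem_union] at hp ⊢
    rcases hp with rfl | rfl | rfl | rfl | rfl | rfl | rfl | rfl | rfl <;> simp only <;> tauto
  · simp only [hept, cond_true, ship, Set.mem_union] at hp ⊢
    rcases hp with rfl | rfl | rfl | rfl | rfl | rfl | rfl | rfl | rfl <;> simp only <;> tauto

lemma hept_subset (s : Bool) :
    hept s ⊆ convexHull ℝ {z | ∃ p ∈ heptPts s, lat p.1 p.2 = z} := by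
  have hu : ∀ m n, (m, n) ∈ heptPts s → (m + 1, n) ∈ heptPts s → (m, n + 1) ∈ heptPts s →
      upTri m n ⊆ convexHull ℝ {z | ∃ p ∈ heptPts s, lat p.1 p.2 = z} := by
    intro m n h1 h2 h3
    refine convexHull_mono ?_
    rintro z (rfl | rfl | rfl)
    exacts [⟨_, h1, rfl⟩, ⟨_, h2, rfl⟩, ⟨_, h3, rfl⟩]
  have hd : ∀ m n, (m + 1, n) ∈ heptPts s → (m, n + 1) ∈ heptPts s → (m + 1, n + 1) ∈ heptPts s →
      downTri m n ⊆ convexHull ℝ {z | ∃ p ∈ heptPts s, lat p.1 p.2 = z} := by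
    intro m n h1 h2 h3
    refine convexHull_mono ?_
    rintro z (rfl | rfl | rfl)
    exacts [⟨_, h1, rfl⟩, ⟨_, h2, rfl⟩, ⟨_, h3, rfl⟩]
  cases s
  · rw [hept, cond_false, windmill]
    simp only [Set.union_subset_iff]
    refine ⟨⟨⟨hu _ _ ?_ ?_ ?_, hd _ _ ?_ ?_ ?_, hu _ _ ?_ ?_ ?_⟩, hd _ _ ?_ ?_ ?_, hu _ _ ?_ ?_ ?_⟩,
      hd _ _ ?_ ?_ ?_, hu _ _ ?_ ?_ ?_⟩ <;> decide
  · rw [hept, cond_true, ship]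
    simp only [Set.union_subset_iff]
    refine ⟨⟨⟨hu _ _ ?_ ?_ ?_, hd _ _ ?_ ?_ ?_, hu _ _ ?_ ?_ ?_⟩, hd _ _ ?_ ?_ ?_, hu _ _ ?_ ?_ ?_⟩,
      hd _ _ ?_ ?_ ?_, hu _ _ ?_ ?_ ?_⟩ <;> decide

/-- Congruences that agree at three points which are not collinear are equal. -/
lemma eq_of_three_points {g g' : ℂ ≃ᵢ ℂ} {a b c : ℂ} (ha : g a = g' a) (hb : g b = g' b)
    (hc : g c = g' c) (h : ((b - a) * conj (c - a)).im ≠ 0) : g = g' := by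
  suffices hid : ∀ z, g'.symm (g z) = z by
    refine IsometryEquiv.ext fun z => ?_
    rw [← g'.symm.injective.eq_iff, hid, g'.symm_apply_apply]
  obtain ⟨x, α, hα, σ, hm⟩ := exists_motion (g.trans g'.symm)
  have hz : ∀ z, g'.symm (g z) = x + α * flip σ z := fun z => by
    rw [← motion_apply x α hα, ← hm]; rfl
  have ha' : x + α * flip σ a = a := by rw [← hz, ha, g'.symm_apply_apply]
  have hb' : x + α * flip σ b = b := by rw [← hz, hb, g'.symm_apply_apply]
  have hc' : x + α * flip σ c = c := by rw [← hz, hc, g'.symm_apply_apply]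
  cases σ
  · simp only [flip, cond_false] at ha' hb' hc' hz
    have hba : b - a ≠ 0 := by
      intro h0; rw [h0] at h; simp at h
    have hα1 : α = 1 := mul_right_cancel₀ hba (by linear_combination hb' - ha')
    subst hα1
    intro z
    rw [hz]
    linear_combination ha'
  · exfalso
    apply h
    simp only [flip, cond_true] at ha' hb' hc'
    have e1 : α * conj (b - a) = b - a := by rw [map_sub]; linear_combination hb' - ha'
    have e2 : α * conj (c - a) = c - a := by rw [map_sub]; linear_combination hc' - ha'
    have e3 : (b - a) * conj (c - a) = conj ((b - a) * conj (c - a)) := by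
      rw [map_mul, Complex.conj_conj, mul_comm (conj _)]
      linear_combination conj (b - a) * e2 - conj (c - a) * e1
    exact Complex.conj_eq_iff_im.1 e3.symm

/-- A congruence between heptiamonds maps a corner of the convex hull to a corner. -/
lemma exists_mem_heptPts {k : ℂ ≃ᵢ ℂ} {s s' : Bool} (hk : k '' hept s = hept s')
    {e : (ℤ × ℤ) × (ℤ × ℤ)} (he : e ∈ heptExtreme s) :
    ∃ v ∈ heptPts s', k (lat e.1.1 e.1.2) = lat v.1 v.2 := by
  obtain ⟨h1, h2⟩ := heptExtreme_dist s e he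
  set q := lat e.2.1 e.2.2
  set M := dist (lat e.1.1 e.1.2) q with hM
  have hball : hept s ⊆ Metric.closedBall q M := by
    refine (hept_subset s).trans (convexHull_min ?_ (convex_closedBall q M))
    rintro _ ⟨v, hv, rfl⟩
    rw [Metric.mem_closedBall]
    refine le_of_sq_le_sq ?_ dist_nonneg
    rw [hM, dist_lat, dist_lat]
    exact_mod_cast h2 v hv
  have hmem : k (lat e.1.1 e.1.2) ∈ hept s' := by rw [← hk]; exact ⟨_, lat_mem_hept h1, rfl⟩
  have hS : {z | ∃ p ∈ heptPts s', lat p.1 p.2 = z} ⊆ Metric.closedBall (k q) M := by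
    rintro _ ⟨v, hv, rfl⟩
    have := lat_mem_hept hv
    rw [← hk] at this
    obtain ⟨y, hy, hy'⟩ := this
    rw [← hy', Metric.mem_closedBall, k.dist_eq]
    exact hball hy
  obtain ⟨v, hv, hv'⟩ := mem_of_mem_sphere hS (hept_subset s' hmem) (by rw [k.dist_eq])
  exact ⟨v, hv, hv'.symm⟩

lemma exists_mem_sameDist {k : ℂ ≃ᵢ ℂ} {V : List (ℤ × ℤ)} (ps : List (ℤ × ℤ))
    (h : ∀ p ∈ ps, ∃ v ∈ V, k (lat p.1 p.2) = lat v.1 v.2) :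
    ∃ l ∈ sameDist V ps, List.Forall₂ (fun p v => k (lat p.1 p.2) = lat v.1 v.2) ps l := by
  induction ps with
  | nil => exact ⟨[], by simp [sameDist], .nil⟩
  | cons p ps ih =>
    obtain ⟨l, hl, hf⟩ := ih fun p hp => h p (List.mem_cons_of_mem _ hp)
    obtain ⟨v, hv, hpv⟩ := h p List.mem_cons_self
    refine ⟨v :: l, ?_, .cons hpv hf⟩
    rw [sameDist, List.mem_flatMap]
    refine ⟨l, hl, List.mem_map.2 ⟨v, List.mem_filter.2 ⟨hv, ?_⟩, rfl⟩⟩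
    rw [List.all_eq_true]
    rintro ⟨p', v'⟩ hx
    have hx' := (List.forall₂_iff_zip.1 hf).2 hx
    rw [decide_eq_true_eq]
    have := dist_lat p p'
    rw [← k.dist_eq, hpv, hx', dist_lat] at this
    exact_mod_cast this.symm

/-- The congruences between heptiamonds are the symmetries in `heptSymm`. -/
lemma eq_of_image_hept {k : ℂ ≃ᵢ ℂ} {s s' : Bool} (hk : k '' hept s = hept s') :
    s = s' ∧ ∃ P ∈ heptSymm s, k = P.toFrame := by
  obtain ⟨l, hl, hf⟩ := exists_mem_sameDist (k := k) (V := heptPts s')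
    ((heptExtreme s).map Prod.fst) fun p hp => by
      obtain ⟨e, he, rfl⟩ := List.mem_map.1 hp
      exact exists_mem_heptPts hk he
  obtain ⟨rfl, P, hP, hlP⟩ := sameDist_heptPts s s' l hl
  refine ⟨rfl, P, hP, ?_⟩
  have h1 : (heptExtreme s).map (fun e => k (lat e.1.1 e.1.2)) =
      (heptExtreme s).map fun e => P.toFrame (lat e.1.1 e.1.2) := by
    have h2 : ∀ {ps l : List (ℤ × ℤ)},
        List.Forall₂ (fun p v => k (lat p.1 p.2) = lat v.1 v.2) ps l →
        ps.map (fun p => k (lat p.1 p.2)) = l.map fun v => lat v.1 v.2 := by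
      intro ps l h
      induction h with
      | nil => rfl
      | cons h _ ih => rw [List.map_cons, List.map_cons, h, ih]
    have h3 := h2 hf
    have h4 := congrArg (List.map Pt.ev) hlP
    simp only [List.map_map, Function.comp_def, ev_latPt, Placement.ev_apply] at h3 h4
    exact h3.trans h4
  rw [List.map_inj_left] at h1
  have hmem : ∀ s, (∃ q, ((0, 2), q) ∈ heptExtreme s) ∧ (∃ q, ((-1, 0), q) ∈ heptExtreme s) ∧
      (∃ q, ((1, 1), q) ∈ heptExtreme s) := by
    intro s
    cases s <;> exact ⟨⟨_, by simp [heptExtreme]; rfl⟩, ⟨_, by simp [heptExtreme]; rfl⟩,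
      ⟨_, by simp [heptExtreme]; rfl⟩⟩
  obtain ⟨⟨q, hq⟩, ⟨q', hq'⟩, ⟨q'', hq''⟩⟩ := hmem s
  refine eq_of_three_points (h1 _ hq) (h1 _ hq') (h1 _ hq'') ?_
  have := sqrt_three_pos
  simp [lat]
  nlinarith

/-- A heptiamond is a union of three pentagons in only one way. -/
lemma range_piece_eq {g g' : ℂ ≃ᵢ ℂ} {s s' : Bool} (h : g '' hept s = g' '' hept s') :
    (Set.range fun i => g '' (piece s i).tile) = Set.range fun i => g' '' (piece s' i).tile := by
  have hk : (g.trans g'.symm) '' hept s = hept s' := by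
    rw [image_trans, h, Set.image_image]; simp
  obtain ⟨rfl, P, hP, hkP⟩ := eq_of_image_hept hk
  have hg : g = P.toFrame.trans g' := by
    rw [← hkP]; ext z; simp
  have hc := heptSymm_comp s P hP
  have hi : ∀ i, g '' (piece s i).tile = g' '' (P.comp (piece s i)).tile := fun i => by
    rw [hg, image_trans, Placement.tile_comp]
  ext t
  constructor
  · rintro ⟨i, rfl⟩
    obtain ⟨j, hj⟩ := hc.1 i
    exact ⟨j, by simp only [hi, hj]⟩
  · rintro ⟨j, rfl⟩
    obtain ⟨i, hi'⟩ := hc.2 j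
    exact ⟨i, by simp only [hi, hi']⟩

/-! ### Uniting the tiles around the corners `E` -/

lemma image_piece (g : ℂ ≃ᵢ ℂ) (P : Placement) : g '' P.tile = P.toFrame.trans g '' pentagon := by
  rw [image_trans]; rfl

lemma isCorner_image_piece (g : ℂ ≃ᵢ ℂ) (s : Bool) (i : Fin 3) {p : ℂ} :
    IsCorner (g '' (piece s i).tile) E p ↔ g (vertex E) = p := by
  rw [image_piece, isCorner_image, IsometryEquiv.trans_apply, ← Placement.ev_corner, corner_piece,
    Pt.ev_vtx]

lemma image_hept (g : ℂ ≃ᵢ ℂ) (s : Bool) : g '' hept s = ⋃ i, g '' (piece s i).tile := by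
  rw [hept_eq_iUnion, Set.image_iUnion]

lemma image_piece_injective (g : ℂ ≃ᵢ ℂ) (s : Bool) :
    Function.Injective fun i => g '' (piece s i).tile :=
  g.injective.image_injective.comp (piece_injective s)

/-- If the three pentagons of a heptiamond belong to a tiling with `3E = 360°` at their common
corner, then they are all tiles with this corner. -/
lemma tilesAt_eq_range {T : Set (Set ℂ)} {g : ℂ ≃ᵢ ℂ} {s : Bool} (h : RelEEE T (g (vertex E)))
    (hg : ∀ i, g '' (piece s i).tile ∈ T) :
    tilesAt T E (g (vertex E)) = Set.range fun i => g '' (piece s i).tile := by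
  refine (Set.Finite.eq_of_subset_of_encard_le ?_ ?_ ?_).symm
  · exact Set.finite_range _
  · rintro _ ⟨i, rfl⟩
    exact ⟨hg i, (isCorner_image_piece g s i).2 rfl⟩
  · rw [h.2.2.2.2, ← Set.image_univ, (image_piece_injective g s).encard_image]
    simp

lemma sUnion_tilesAt {T : Set (Set ℂ)} {g : ℂ ≃ᵢ ℂ} {s : Bool} (h : RelEEE T (g (vertex E)))
    (hg : ∀ i, g '' (piece s i).tile ∈ T) : ⋃₀ tilesAt T E (g (vertex E)) = g '' hept s := by
  rw [tilesAt_eq_range h hg, Set.sUnion_range, image_hept]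

/-- The three tiles around a point with `3E = 360°` form a windmill or a ship. -/
lemma exists_hept_of_relEEE {T : Set (Set ℂ)} (hT : IsTHTiling T) {p : ℂ} (hp : RelEEE T p) :
    ∃ (g : ℂ ≃ᵢ ℂ) (s : Bool), g (vertex E) = p ∧ ∀ i, g '' (piece s i).tile ∈ T := by
  obtain ⟨t, ht, hk⟩ := isEPoint_of_encard (T := T) (p := p) (by rw [hp.2.2.2.2]; simp)
  obtain ⟨g, rfl⟩ := hT.exists_congr ht
  rw [isCorner_image] at hk
  subst hk
  have h := (has_adeFans_or_eeeFans (hT.pull g) ht).resolve_left fun h =>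
    RelADE.not_relEEE (cornersAre_pull.1 (relADE_of_has (hT.pull g) h)) hp
  have key : ∀ (P : Placement) (s : Bool) (L : List Placement), P.corner E = Pt.vtx E →
      (∀ i, P.comp (piece s i) ∈ L) → (∀ P ∈ L, P.tile ∈ pull g T) →
      ∃ (g' : ℂ ≃ᵢ ℂ) (s : Bool), g' (vertex E) = g (vertex E) ∧
        ∀ i, g' '' (piece s i).tile ∈ T := by
    intro P s L hE hPL hL
    refine ⟨P.toFrame.trans g, s, ?_, fun i => ?_⟩
    · rw [IsometryEquiv.trans_apply, ← Placement.ev_corner, hE, Pt.ev_vtx]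
    · rw [image_trans, ← Placement.tile_comp]
      exact hL _ (hPL i)
  obtain ⟨L, hL, hLT⟩ := h
  simp only [eeeFans, List.mem_cons, List.not_mem_nil, or_false] at hL
  rcases hL with rfl | rfl | rfl | rfl
  · exact key .base false _ (by decide +kernel) (by decide +kernel) hLT
  · exact key (.mkAt (Pt.vtx E) 15 E false) true _ (by decide +kernel) (by decide +kernel) hLT
  · exact key (.mkAt (Pt.vtx E) 11 E false) true _ (by decide +kernel) (by decide +kernel) hLT
  · exact key (.mkAt (Pt.vtx E) 7 E true) true _ (by decide +kernel) (by decide +kernel) hLT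

lemma inter_interior_nonempty {g : ℂ ≃ᵢ ℂ} {O : Set ℂ} (hO : IsOpen O) {z : ℂ} (hz : z ∈ O)
    (hzt : z ∈ g '' pentagon) : (O ∩ interior (g '' pentagon)).Nonempty := by
  have h : (interior (g '' pentagon)).Nonempty := by
    rw [image_interior_congr]; exact nonempty_interior_pentagon.image g
  have := (convex_image_pentagon g).closure_interior_eq_closure_of_nonempty_interior h
  exact mem_closure_iff.1 (this ▸ subset_closure hzt) O hO hz

/-- Two unions of tiles that have a common interior point have a common tile. -/
lemma IsTHTiling.exists_mem_inter {T S S' : Set (Set ℂ)} (hT : IsTHTiling T) (hS : S ⊆ T)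
    (hS' : S' ⊆ T) {z : ℂ} (hz : z ∈ interior (⋃₀ S)) (hz' : z ∈ interior (⋃₀ S')) :
    ∃ t ∈ S, t ∈ S' := by
  obtain ⟨t, ht, hzt⟩ := interior_subset hz
  obtain ⟨g, rfl⟩ := hT.exists_congr (hS ht)
  obtain ⟨y, hy, hyt⟩ := inter_interior_nonempty isOpen_interior hz' hzt
  obtain ⟨u, hu, hyu⟩ := interior_subset hy
  obtain ⟨g', rfl⟩ := hT.exists_congr (hS' hu)
  obtain ⟨x, hx, hxu⟩ := inter_interior_nonempty isOpen_interior hyt hyu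
  exact ⟨_, ht, by rwa [hT.eq_of_mem_interior (hS ht) (hS' hu) hx hxu]⟩

lemma hept_mem (s : Bool) : hept s ∈ ({windmill, ship} : Set (Set ℂ)) := by
  cases s <;> simp [hept]

lemma IsEEETiling.isHeptiamondTiling_units {T : Set (Set ℂ)} (h : IsEEETiling T) :
    IsHeptiamondTiling (units T) := by
  have hT := h.1
  refine ⟨?_, ?_, Set.eq_univ_of_forall fun z => ?_⟩
  · rintro _ ⟨p, hp, rfl⟩
    obtain ⟨g, s, rfl, hg⟩ := exists_hept_of_relEEE hT hp
    exact ⟨hept s, hept_mem s, g, (sUnion_tilesAt hp hg).symm⟩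
  · rintro _ ⟨p, hp, rfl⟩ _ ⟨q, hq, rfl⟩ hne
    rw [Set.disjoint_left]
    intro z hz hz'
    obtain ⟨t, ht, ht'⟩ := hT.exists_mem_inter (fun t ht => ht.1) (fun t ht => ht.1) hz hz'
    obtain ⟨g, rfl⟩ := hT.exists_congr ht.1
    apply hne
    rw [← isCorner_image.1 ht.2, ← isCorner_image.1 ht'.2]
  · obtain ⟨t, ht, hz⟩ := hT.exists_mem z
    obtain ⟨g, rfl⟩ := hT.exists_congr ht
    have hc : IsCorner (g '' pentagon) E (g (vertex E)) := isCorner_image.2 rfl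
    exact ⟨_, ⟨_, h.2 _ ⟨_, ht, hc⟩, rfl⟩, _, ⟨ht, hc⟩, hz⟩

lemma subset_of_units_eq {T T' : Set (Set ℂ)} (h : IsEEETiling T) (h' : IsEEETiling T')
    (hu : units T = units T') : T ⊆ T' := by
  intro t ht
  obtain ⟨g₀, rfl⟩ := h.1.exists_congr ht
  have hc : IsCorner (g₀ '' pentagon) E (g₀ (vertex E)) := isCorner_image.2 rfl
  have hp := h.2 _ ⟨_, ht, hc⟩
  obtain ⟨g, s, hgp, hg⟩ := exists_hept_of_relEEE h.1 hp
  rw [← hgp] at hc hp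
  have hU : ⋃₀ tilesAt T E (g (vertex E)) ∈ units T' := hu ▸ ⟨_, hp, rfl⟩
  obtain ⟨p', hp', hUp'⟩ := hU
  obtain ⟨g', s', rfl, hg'⟩ := exists_hept_of_relEEE h'.1 hp'
  rw [sUnion_tilesAt hp hg, sUnion_tilesAt hp' hg'] at hUp'
  have hmem : g₀ '' pentagon ∈ tilesAt T E (g (vertex E)) := ⟨ht, hc⟩
  rw [tilesAt_eq_range hp hg, range_piece_eq hUp', ← tilesAt_eq_range hp' hg'] at hmem
  exact hmem.1

/-- Cutting the heptiamonds of a tiling into pentagons. -/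
lemma exists_units_eq {H : Set (Set ℂ)} (hH : IsHeptiamondTiling H) :
    ∃ T, IsEEETiling T ∧ units T = H := by
  have hex : ∀ U ∈ H, ∃ (g : ℂ ≃ᵢ ℂ) (s : Bool), U = g '' hept s := by
    intro U hU
    obtain ⟨_, rfl | rfl, g, hg⟩ := hH.1 U hU
    exacts [⟨g, false, hg.symm⟩, ⟨g, true, hg.symm⟩]
  choose! g s hgs using hex
  set T := {t | ∃ U ∈ H, ∃ i, t = g U '' (piece (s U) i).tile} with hTdef
  have hmem : ∀ U ∈ H, ∀ i, g U '' (piece (s U) i).tile ∈ T := fun U hU i => ⟨U, hU, i, rfl⟩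
  have hsub : ∀ U ∈ H, ∀ i, g U '' (piece (s U) i).tile ⊆ U := fun U hU i => by
    conv_rhs => rw [hgs U hU, image_hept]
    exact Set.subset_iUnion (fun i => g U '' (piece (s U) i).tile) i
  have hT : IsTHTiling T := by
    refine ⟨?_, ?_, Set.eq_univ_of_forall fun z => ?_⟩
    · rintro _ ⟨U, hU, i, rfl⟩
      exact ⟨pentagon, rfl, _, (image_piece _ _).symm⟩
    · rintro _ ⟨U, hU, i, rfl⟩ _ ⟨V, hV, j, rfl⟩ hne
      by_cases hUV : U = V
      · subst hUV
        have hij : i ≠ j := by rintro rfl; exact hne rfl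
        simp only [image_interior_congr]
        exact (Set.disjoint_image_iff (g U).injective).2 (disjoint_interior_piece _ hij)
      · exact (hH.2.1 hU hV hUV).mono (interior_mono (hsub U hU i)) (interior_mono (hsub V hV j))
    · have hz : z ∈ ⋃₀ H := by rw [hH.2.2]; trivial
      obtain ⟨U, hU, hzU⟩ := hz
      rw [hgs U hU, image_hept] at hzU
      obtain ⟨i, hi⟩ := Set.mem_iUnion.1 hzU
      exact ⟨_, hmem U hU i, hi⟩
  have hE : ∀ U ∈ H, RelEEE T (g U (vertex E)) := by
    intro U hU
    refine (relADE_or_relEEE hT ⟨_, hmem U hU 0, (isCorner_image_piece _ _ _).2 rfl⟩).resolve_left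
      fun h => ?_
    have h1 := h.2.2.2.2.le
    rw [Set.encard_le_one_iff] at h1
    have := h1 _ _ ⟨hmem U hU 0, (isCorner_image_piece _ _ _).2 rfl⟩
      ⟨hmem U hU 1, (isCorner_image_piece _ _ _).2 rfl⟩
    exact absurd (image_piece_injective _ _ this) (by decide)
  have hP : ∀ p, IsEPoint T p → ∃ U ∈ H, g U (vertex E) = p := by
    rintro p ⟨_, ⟨U, hU, i, rfl⟩, hk⟩
    exact ⟨U, hU, (isCorner_image_piece _ _ _).1 hk⟩
  refine ⟨T, ⟨hT, fun p hp => ?_⟩, ?_⟩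
  · obtain ⟨U, hU, rfl⟩ := hP p hp
    exact hE U hU
  · have hun : ∀ U ∈ H, ⋃₀ tilesAt T E (g U (vertex E)) = U := fun U hU => by
      rw [sUnion_tilesAt (hE U hU) (hmem U hU), ← hgs U hU]
    ext V
    constructor
    · rintro ⟨p, hp, rfl⟩
      obtain ⟨U, hU, rfl⟩ := hP p (isEPoint_of_encard (by rw [hp.2.2.2.2]; simp))
      rwa [hun U hU]
    · intro hV
      exact ⟨_, hE V hV, (hun V hV).symm⟩

/-- Uniting the tiles around the corners `E` and cutting the heptiamonds are inverse to each other.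
-/
lemma bijOn_units : Set.BijOn units {T | IsEEETiling T} {H | IsHeptiamondTiling H} :=
  ⟨fun _ h => IsEEETiling.isHeptiamondTiling_units h,
    fun _ h _ h' hu => (subset_of_units_eq h h' hu).antisymm (subset_of_units_eq h' h hu.symm),
    fun _ hH => exists_units_eq hH⟩

/-! ### Existence of a tiling with `A + D + E = 360°` -/

lemma side_pos_of_mem_interior {z : ℂ} (hz : z ∈ interior pentagon) (k : Corner) :
    0 < side k z := by
  have hc : Continuous fun r : ℝ => z + r * mid (dirIdx k + 6) := by fun_prop
  have h := (hc.tendsto 0).mono_left (nhdsWithin_le_nhds (s := Set.Ioi 0))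
  simp only [Complex.ofReal_zero, zero_mul, add_zero] at h
  obtain ⟨r, hr, hr0⟩ := ((h.eventually (isOpen_interior.mem_nhds hz)).and
    self_mem_nhdsWithin).exists
  have h1 := mem_pentagon_iff.1 (interior_subset hr) k
  have h2 : slope (dirIdx k) (mid (dirIdx k + 6)) < 0 := slope_mid_neg (by omega)
  rw [side_add_mul] at h1
  have : (0 : ℝ) < r := hr0
  nlinarith

lemma frame_zero_apply (x z : ℂ) : frame x 0 false z = x + z := by
  simp [frame_apply, flip]

lemma frame_six_apply (x z : ℂ) : frame x 6 false z = x - z := by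
  simp [frame_apply, flip, ζ_pow_six]; ring

lemma mem_image_frame_zero {S : Set ℂ} {x z : ℂ} : z ∈ frame x 0 false '' S ↔ z - x ∈ S := by
  constructor
  · rintro ⟨w, hw, rfl⟩
    rwa [frame_zero_apply, add_sub_cancel_left]
  · exact fun h => ⟨_, h, by rw [frame_zero_apply, add_sub_cancel]⟩

lemma mem_image_frame_six {S : Set ℂ} {x z : ℂ} : z ∈ frame x 6 false '' S ↔ x - z ∈ S := by
  constructor
  · rintro ⟨w, hw, rfl⟩
    rwa [frame_six_apply, sub_sub_cancel]
  · exact fun h => ⟨_, h, by rw [frame_six_apply, sub_sub_cancel]⟩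

/-- The translation `a + b τ` for `τ = 1 / 2 + 7 √3 / 6 i`. -/
noncomputable def rowShift (a b : ℤ) : ℂ := ⟨a + b / 2, √3 * (7 / 6 * b)⟩

/-- A tiling with `A + D + E = 360°`: rows of translates of the pentagon and rows of translates of
its image under a half turn. -/
def rowTiling : Set (Set ℂ) :=
  {t | ∃ a b, t = frame (rowShift a b) 0 false '' pentagon ∨
    t = frame (rowShift a b + vertex E) 6 false '' pentagon}

lemma vertex_E_coord : vertex E = ⟨1 / 2, √3 * (1 / 6)⟩ := vertex_coord E

lemma sub_rowShift (x y : ℝ) (a b : ℤ) :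
    (⟨x, √3 * y⟩ - rowShift a b : ℂ) = ⟨x - a - b / 2, √3 * (y - 7 / 6 * b)⟩ := by
  apply Complex.ext <;> simp [rowShift] <;> ring

lemma rowShift_sub (x y : ℝ) (a b : ℤ) : (rowShift a b + vertex E - ⟨x, √3 * y⟩ : ℂ) =
    ⟨1 / 2 + a + b / 2 - x, √3 * (1 / 6 + 7 / 6 * b - y)⟩ := by
  rw [vertex_E_coord]
  apply Complex.ext <;> simp [rowShift] <;> ring

lemma mem_pentagon_coord {x y : ℝ} : (⟨x, √3 * y⟩ : ℂ) ∈ pentagon ↔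
    0 ≤ x + y ∧ 0 ≤ 2 * y + 1 ∧ 0 ≤ 1 - x - y ∧ 0 ≤ 1 - x - 3 * y ∧ 0 ≤ x - 3 * y := by
  rw [mem_pentagon_iff]
  simp only [side_nonneg_coord]
  exact ⟨fun h => ⟨h A, h B, h C, h D, h E⟩, fun ⟨hA, hB, hC, hD, hE⟩ k => by
    cases k <;> assumption⟩

lemma mem_interior_pentagon_coord {x y : ℝ} (hz : (⟨x, √3 * y⟩ : ℂ) ∈ interior pentagon) :
    0 < x + y ∧ 0 < 2 * y + 1 ∧ 0 < 1 - x - y ∧ 0 < 1 - x - 3 * y ∧ 0 < x - 3 * y := by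
  have h := side_pos_of_mem_interior hz
  simp only [side_pos_coord] at h
  exact ⟨h A, h B, h C, h D, h E⟩

lemma mem_interior_image_frame_zero {S : Set ℂ} {x z : ℂ} :
    z ∈ interior (frame x 0 false '' S) ↔ z - x ∈ interior S := by
  rw [image_interior_congr, mem_image_frame_zero]

lemma mem_interior_image_frame_six {S : Set ℂ} {x z : ℂ} :
    z ∈ interior (frame x 6 false '' S) ↔ x - z ∈ interior S := by
  rw [image_interior_congr, mem_image_frame_six]

lemma isTHTiling_rowTiling : IsTHTiling rowTiling := by
  refine ⟨?_, ?_, Set.eq_univ_of_forall fun z => ?_⟩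
  · rintro _ ⟨a, b, rfl | rfl⟩
    exacts [⟨_, rfl, _, rfl⟩, ⟨_, rfl, _, rfl⟩]
  · intro t ht u hu hne
    rw [Set.disjoint_left]
    intro z hz hz'
    apply hne
    obtain ⟨x, y, rfl⟩ := exists_coord z
    have hrow : ∀ {b b' : ℤ} {c : ℝ}, 7 / 6 * (b : ℝ) = 7 / 6 * b' + c → -(7 / 6) < c → c < 7 / 6 →
        b = b' := by
      intro b b' c h h1 h2
      have h3 : ((b - b' : ℤ) : ℝ) < 1 := by push_cast; linarith
      have h4 : (-1 : ℝ) < ((b - b' : ℤ) : ℝ) := by push_cast; linarith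
      have h5 : b - b' < 1 := by exact_mod_cast h3
      have h6 : -1 < b - b' := by exact_mod_cast h4
      omega
    have hcol : ∀ {a a' : ℤ}, (a : ℝ) - a' < 1 → -1 < (a : ℝ) - a' → a = a' := by
      intro a a' h1 h2
      have h5 : a - a' < 1 := by exact_mod_cast h1
      have h6 : -1 < a - a' := by exact_mod_cast h2
      omega
    have hmixed : ∀ a b a' b',
        (⟨x, √3 * y⟩ : ℂ) ∈ interior (frame (rowShift a b) 0 false '' pentagon) →
        (⟨x, √3 * y⟩ : ℂ) ∈ interior (frame (rowShift a' b' + vertex E) 6 false '' pentagon) →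
        False := by
      intro a b a' b' h h'
      rw [mem_interior_image_frame_zero, sub_rowShift] at h
      rw [mem_interior_image_frame_six, rowShift_sub] at h'
      obtain ⟨hA, hB, hC, hD, hE⟩ := mem_interior_pentagon_coord h
      obtain ⟨hA', hB', hC', hD', hE'⟩ := mem_interior_pentagon_coord h'
      have hb : b = b' := by
        have h3 : ((b' - b : ℤ) : ℝ) < 1 := by push_cast; linarith
        have h4 : (-1 : ℝ) < ((b' - b : ℤ) : ℝ) := by push_cast; linarith
        have h5 : b' - b < 1 := by exact_mod_cast h3
        have h6 : -1 < b' - b := by exact_mod_cast h4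
        omega
      subst hb
      have h3 : ((a - a' : ℤ) : ℝ) < 0 := by push_cast; linarith
      have h4 : (-1 : ℝ) < ((a - a' : ℤ) : ℝ) := by push_cast; linarith
      have h5 : a - a' < 0 := by exact_mod_cast h3
      have h6 : -1 < a - a' := by exact_mod_cast h4
      omega
    obtain ⟨a, b, rfl | rfl⟩ := ht <;> obtain ⟨a', b', rfl | rfl⟩ := hu
    · rw [mem_interior_image_frame_zero, sub_rowShift] at hz hz'
      obtain ⟨hA, hB, hC, hD, hE⟩ := mem_interior_pentagon_coord hz
      obtain ⟨hA', hB', hC', hD', hE'⟩ := mem_interior_pentagon_coord hz'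
      obtain rfl := hrow (b := b) (b' := b') (c := 7 / 6 * b - 7 / 6 * b') (by ring)
        (by linarith) (by linarith)
      obtain rfl := hcol (a := a) (a' := a') (by linarith) (by linarith)
      rfl
    · exact (hmixed _ _ _ _ hz hz').elim
    · exact (hmixed _ _ _ _ hz' hz).elim
    · rw [mem_interior_image_frame_six, rowShift_sub] at hz hz'
      obtain ⟨hA, hB, hC, hD, hE⟩ := mem_interior_pentagon_coord hz
      obtain ⟨hA', hB', hC', hD', hE'⟩ := mem_interior_pentagon_coord hz'
      obtain rfl := hrow (b := b) (b' := b') (c := 7 / 6 * b - 7 / 6 * b') (by ring)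
        (by linarith) (by linarith)
      obtain rfl := hcol (a := a) (a' := a') (by linarith) (by linarith)
      rfl
  · obtain ⟨x, y, rfl⟩ := exists_coord z
    obtain ⟨b, hb1, hb2⟩ : ∃ b : ℤ, (b : ℝ) ≤ (y + 1 / 2) * (6 / 7) ∧
        (y + 1 / 2) * (6 / 7) < b + 1 := ⟨_, Int.floor_le _, Int.lt_floor_add_one _⟩
    have up : ∀ a : ℤ, (⟨x - a - b / 2, √3 * (y - 7 / 6 * b)⟩ : ℂ) ∈ pentagon →
        (⟨x, √3 * y⟩ : ℂ) ∈ ⋃₀ rowTiling := fun a h =>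
      ⟨_, ⟨a, b, Or.inl rfl⟩, mem_image_frame_zero.2 (by rwa [sub_rowShift])⟩
    have down : ∀ a : ℤ, (⟨1 / 2 + a + b / 2 - x, √3 * (1 / 6 + 7 / 6 * b - y)⟩ : ℂ) ∈ pentagon →
        (⟨x, √3 * y⟩ : ℂ) ∈ ⋃₀ rowTiling := fun a h =>
      ⟨_, ⟨a, b, Or.inr rfl⟩, mem_image_frame_six.2 (by rwa [rowShift_sub])⟩
    simp only [mem_pentagon_coord] at up down
    obtain ⟨Y, rfl⟩ : ∃ Y, y = Y + 7 / 6 * b := ⟨y - 7 / 6 * b, by ring⟩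
    obtain ⟨X, rfl⟩ : ∃ X, x = X + b / 2 := ⟨x - b / 2, by ring⟩
    have f1 := Int.floor_le (X + Y)
    have f2 := Int.lt_floor_add_one (X + Y)
    have f3 := Int.floor_le X
    have f4 := Int.lt_floor_add_one X
    have f5 := Int.floor_le (2 / 3 - X - Y)
    have f6 := Int.lt_floor_add_one (2 / 3 - X - Y)
    by_cases h0 : Y ≤ 0
    · exact up ⌊X + Y⌋ ⟨by linarith, by linarith, by linarith, by linarith, by linarith⟩
    by_cases h1 : 1 / 6 ≤ Y
    · refine down (-⌊2 / 3 - X - Y⌋) ⟨?_, ?_, ?_, ?_, ?_⟩ <;> push_cast <;> linarith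
    by_cases h2 : 3 * Y ≤ X - ⌊X⌋
    · by_cases h3 : 3 * Y ≤ 1 - (X - ⌊X⌋)
      · exact up ⌊X⌋ ⟨by linarith, by linarith, by linarith, by linarith, by linarith⟩
      · refine down (⌊X⌋ + 1) ⟨?_, ?_, ?_, ?_, ?_⟩ <;> push_cast <;> linarith
    · exact down ⌊X⌋ ⟨by linarith, by linarith, by linarith, by linarith, by linarith⟩

lemma exists_isADETiling : ∃ T, IsADETiling T := by
  have hT := isTHTiling_rowTiling
  -- The corner `A` of a rotated tile excludes the relation `3E = 360°`.
  have h1 : RelADE rowTiling (vertex E) := by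
    refine (relADE_or_relEEE hT ⟨_, ⟨0, 0, Or.inl rfl⟩, isCorner_image.2 ?_⟩).resolve_right
      fun h => ?_
    · rw [frame_zero_apply,
        show rowShift 0 0 = 0 by apply Complex.ext <;> simp [rowShift], zero_add]
    · have h2 := Set.encard_eq_zero.1 h.1
      have h3 : frame (rowShift 0 0 + vertex E) 6 false '' pentagon ∈
          tilesAt rowTiling A (vertex E) := ⟨⟨0, 0, Or.inr rfl⟩, isCorner_image.2 (by
        rw [frame_six_apply, show rowShift 0 0 = 0 by apply Complex.ext <;> simp [rowShift],
          show vertex A = 0 from rfl]; simp)⟩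
      rw [h2] at h3
      exact h3
  have h2 := isTypeOneVariation_of_relADE hT h1
  exact ⟨_, hT, fun p hp => (relADE_or_relEEE hT hp).resolve_right (h2.not_relEEE p)⟩

/-! ### Existence of a tiling with `3E = 360°` -/

/-- The point with the coordinates `u`, `v` with respect to the triangular lattice. -/
noncomputable def skew (u v : ℝ) : ℂ := ⟨u + v / 2, v * (√3 / 2)⟩

lemma exists_skew (z : ℂ) : ∃ u v, z = skew u v := by
  have := sqrt_three_pos
  refine ⟨z.re - z.im / √3, 2 * z.im / √3, ?_⟩
  apply Complex.ext
  · simp only [skew]; ring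
  · simp only [skew]; field_simp

lemma skew_injective {u v u' v' : ℝ} (h : skew u v = skew u' v') : u = u' ∧ v = v' := by
  have h1 := congrArg Complex.re h
  have h2 := congrArg Complex.im h
  simp only [skew] at h1 h2
  have hv : v = v' := mul_right_cancel₀ (by have := sqrt_three_pos; positivity) h2
  exact ⟨by subst hv; linarith, hv⟩

lemma mem_triple_skew {u₁ v₁ u₂ v₂ u₃ v₃ u v : ℝ} :
    skew u v ∈ convexHull ℝ {skew u₁ v₁, skew u₂ v₂, skew u₃ v₃} ↔
      ∃ r s t : ℝ, 0 ≤ r ∧ 0 ≤ s ∧ 0 ≤ t ∧ r + s + t = 1 ∧ r * u₁ + s * u₂ + t * u₃ = u ∧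
        r * v₁ + s * v₂ + t * v₃ = v := by
  have e : ∀ r s t : ℝ, r * skew u₁ v₁ + s * skew u₂ v₂ + t * skew u₃ v₃ =
      skew (r * u₁ + s * u₂ + t * u₃) (r * v₁ + s * v₂ + t * v₃) := fun r s t => by
    apply Complex.ext <;> simp [skew] <;> ring
  constructor
  · intro h
    obtain ⟨r, s, t, hr, hs, ht, h1, h2⟩ := exists_barycentric h
    rw [e] at h2
    exact ⟨r, s, t, hr, hs, ht, h1, skew_injective h2⟩
  · rintro ⟨r, s, t, hr, hs, ht, h1, rfl, rfl⟩
    exact mem_convexHull_triple hr hs ht h1 (e r s t)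

lemma lat_eq_skew (m n : ℤ) : lat m n = skew m n := rfl

lemma mem_upTri {m n : ℤ} {u v : ℝ} :
    skew u v ∈ upTri m n ↔ m ≤ u ∧ n ≤ v ∧ u + v ≤ m + n + 1 := by
  rw [upTri, lat_eq_skew, lat_eq_skew, lat_eq_skew, mem_triple_skew]
  push_cast
  constructor
  · rintro ⟨r, s, t, hr, hs, ht, h1, rfl, rfl⟩
    obtain rfl : r = 1 - s - t := by linarith
    refine ⟨?_, ?_, ?_⟩ <;> ring_nf <;> linarith
  · rintro ⟨h1, h2, h3⟩
    exact ⟨1 - (u - m) - (v - n), u - m, v - n, by linarith, by linarith, by linarith, by ring,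
      by ring, by ring⟩

lemma mem_downTri {m n : ℤ} {u v : ℝ} :
    skew u v ∈ downTri m n ↔ u ≤ m + 1 ∧ v ≤ n + 1 ∧ m + n + 1 ≤ u + v := by
  rw [downTri, lat_eq_skew, lat_eq_skew, lat_eq_skew, mem_triple_skew]
  push_cast
  constructor
  · rintro ⟨r, s, t, hr, hs, ht, h1, rfl, rfl⟩
    obtain rfl : t = 1 - r - s := by linarith
    refine ⟨?_, ?_, ?_⟩ <;> ring_nf <;> linarith
  · rintro ⟨h1, h2, h3⟩
    exact ⟨n + 1 - v, m + 1 - u, u + v - m - n - 1, by linarith, by linarith, by linarith, by ring,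
      by ring, by ring⟩

/-- A tiling by windmills: translates by the vectors `lat m n` with `7 ∣ m + 3 n`, together with
their images under a half turn. -/
def windmillTiling : Set (Set ℂ) :=
  {t | ∃ m n : ℤ, (m + 3 * n) % 7 = 0 ∧ (t = frame (lat m n) 0 false '' windmill ∨
    t = frame (lat (m + 2) (n + 1)) 6 false '' windmill)}

lemma mem_windmill_translate {m n : ℤ} {z : ℂ} : z ∈ frame (lat m n) 0 false '' windmill ↔
    z ∈ upTri m n ∨ z ∈ upTri (m + 1) (n - 1) ∨ z ∈ upTri m (n + 1) ∨ z ∈ upTri (m - 1) n ∨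
      z ∈ downTri m n ∨ z ∈ downTri m (n - 1) ∨ z ∈ downTri (m - 1) n := by
  obtain ⟨u, v, rfl⟩ := exists_skew z
  rw [mem_image_frame_zero]
  have e : skew u v - lat m n = skew (u - m) (v - n) := by
    apply Complex.ext <;> simp [skew, lat] <;> ring
  rw [e]
  have hu : ∀ i j : ℤ, skew (u - m) (v - n) ∈ upTri i j ↔ skew u v ∈ upTri (m + i) (n + j) := by
    intro i j
    simp only [mem_upTri]
    push_cast
    constructor <;> rintro ⟨h1, h2, h3⟩ <;> exact ⟨by linarith, by linarith, by linarith⟩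
  have hd : ∀ i j : ℤ, skew (u - m) (v - n) ∈ downTri i j ↔ skew u v ∈ downTri (m + i) (n + j) := by
    intro i j
    simp only [mem_downTri]
    push_cast
    constructor <;> rintro ⟨h1, h2, h3⟩ <;> exact ⟨by linarith, by linarith, by linarith⟩
  simp only [windmill, Set.mem_union, hu, hd, add_zero, ← sub_eq_add_neg]
  tauto

lemma mem_windmill_rotated {m n : ℤ} {z : ℂ} :
    z ∈ frame (lat (m + 2) (n + 1)) 6 false '' windmill ↔
    z ∈ downTri (m + 1) n ∨ z ∈ downTri m (n + 1) ∨ z ∈ downTri (m + 1) (n - 1) ∨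
      z ∈ downTri (m + 2) n ∨ z ∈ upTri (m + 1) n ∨ z ∈ upTri (m + 1) (n + 1) ∨
      z ∈ upTri (m + 2) n := by
  obtain ⟨u, v, rfl⟩ := exists_skew z
  rw [mem_image_frame_six]
  have e : lat (m + 2) (n + 1) - skew u v = skew (m + 2 - u) (n + 1 - v) := by
    apply Complex.ext <;> simp [skew, lat] <;> ring
  rw [e]
  have hu : ∀ i j : ℤ, skew (m + 2 - u) (n + 1 - v) ∈ upTri i j ↔
      skew u v ∈ downTri (m + 1 - i) (n - j) := by
    intro i j
    simp only [mem_upTri, mem_downTri]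
    push_cast
    constructor <;> rintro ⟨h1, h2, h3⟩ <;> exact ⟨by linarith, by linarith, by linarith⟩
  have hd : ∀ i j : ℤ, skew (m + 2 - u) (n + 1 - v) ∈ downTri i j ↔
      skew u v ∈ upTri (m + 1 - i) (n - j) := by
    intro i j
    simp only [mem_upTri, mem_downTri]
    push_cast
    constructor <;> rintro ⟨h1, h2, h3⟩ <;> exact ⟨by linarith, by linarith, by linarith⟩
  simp only [windmill, Set.mem_union, hu, hd, sub_zero, sub_neg_eq_add, add_sub_cancel_right,
    add_assoc, show (1 : ℤ) + 1 = 2 by norm_num]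
  tauto

/-- A point on none of the lines of the triangular lattice. -/
def Generic (u v : ℝ) : Prop := ∀ k : ℤ, u ≠ k ∧ v ≠ k ∧ u + v ≠ k

lemma Generic.upTri {u v : ℝ} (h : Generic u v) {m n : ℤ} (hz : skew u v ∈ upTri m n) :
    m = ⌊u⌋ ∧ n = ⌊v⌋ ∧ u + v < ⌊u⌋ + ⌊v⌋ + 1 := by
  rw [mem_upTri] at hz
  obtain ⟨h1, h2, h3⟩ := hz
  have h3' : u + v < m + n + 1 := lt_of_le_of_ne h3 (by exact_mod_cast (h (m + n + 1)).2.2)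
  have hm : ⌊u⌋ = m := Int.floor_eq_iff.2 ⟨h1, by linarith⟩
  have hn : ⌊v⌋ = n := Int.floor_eq_iff.2 ⟨h2, by linarith⟩
  rw [hm, hn]
  exact ⟨rfl, rfl, h3'⟩

lemma Generic.downTri {u v : ℝ} (h : Generic u v) {m n : ℤ} (hz : skew u v ∈ downTri m n) :
    m = ⌊u⌋ ∧ n = ⌊v⌋ ∧ ⌊u⌋ + ⌊v⌋ + 1 < u + v := by
  rw [mem_downTri] at hz
  obtain ⟨h1, h2, h3⟩ := hz
  have h3' : (m + n + 1 : ℝ) < u + v := lt_of_le_of_ne h3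
    (Ne.symm (by exact_mod_cast (h (m + n + 1)).2.2))
  have h1' : u < m + 1 := lt_of_le_of_ne h1 (by exact_mod_cast (h (m + 1)).1)
  have h2' : v < n + 1 := lt_of_le_of_ne h2 (by exact_mod_cast (h (n + 1)).2.1)
  have hm : ⌊u⌋ = m := Int.floor_eq_iff.2 ⟨by linarith, h1'⟩
  have hn : ⌊v⌋ = n := Int.floor_eq_iff.2 ⟨by linarith, h2'⟩
  rw [hm, hn]
  exact ⟨rfl, rfl, h3'⟩

lemma exists_generic {O : Set ℂ} (hO : IsOpen O) {z : ℂ} (hz : z ∈ O) :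
    ∃ u v, Generic u v ∧ skew u v ∈ O := by
  obtain ⟨u, v, rfl⟩ := exists_skew z
  set S : Set ℝ := (Set.range fun k : ℤ => (k : ℝ) - u) ∪ (Set.range fun k : ℤ => ((k : ℝ) - v)) ∪
    Set.range fun k : ℤ => ((k : ℝ) - u - v) / 2 with hS
  have hc : S.Countable :=
    ((Set.countable_range _).union (Set.countable_range _)).union (Set.countable_range _)
  have hcont : Continuous fun r : ℝ => skew (u + r) (v + r) := by
    have : (fun r : ℝ => skew (u + r) (v + r)) = fun r : ℝ => skew u v + r * skew 1 1 := by
      ext r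
      apply Complex.ext <;> simp [skew] <;> ring
    rw [this]; fun_prop
  obtain ⟨r, hr, hrS⟩ := (hc.dense_compl ℝ).inter_open_nonempty _ (hO.preimage hcont)
    ⟨0, by simpa using hz⟩
  refine ⟨u + r, v + r, fun k => ⟨fun h => hrS ?_, fun h => hrS ?_, fun h => hrS ?_⟩, hr⟩
  · exact Or.inl (Or.inl ⟨k, by simp only; linarith⟩)
  · exact Or.inl (Or.inr ⟨k, by simp only; linarith⟩)
  · exact Or.inr ⟨k, by simp only; linarith⟩

lemma isHeptiamondTiling_windmillTiling : IsHeptiamondTiling windmillTiling := by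
  refine ⟨?_, ?_, Set.eq_univ_of_forall fun z => ?_⟩
  · rintro _ ⟨m, n, -, rfl | rfl⟩
    exacts [⟨_, Or.inl rfl, _, rfl⟩, ⟨_, Or.inl rfl, _, rfl⟩]
  · intro t ht s hs hne
    rw [Set.disjoint_left]
    intro z hz hz'
    apply hne
    obtain ⟨u, v, hg, huv, huv'⟩ := exists_generic (isOpen_interior.inter isOpen_interior)
      (Set.mem_inter hz hz')
    -- The tile is determined by the kind of the triangle at a generic point and by the residue
    -- class of its position.
    have hup : ∀ {m n : ℤ}, skew u v ∈ upTri m n → u + v < ⌊u⌋ + ⌊v⌋ + 1 ∧ m = ⌊u⌋ ∧ n = ⌊v⌋ :=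
      fun h => ⟨(hg.upTri h).2.2, (hg.upTri h).1, (hg.upTri h).2.1⟩
    have hdown : ∀ {m n : ℤ}, skew u v ∈ downTri m n →
        ¬ u + v < ⌊u⌋ + ⌊v⌋ + 1 ∧ m = ⌊u⌋ ∧ n = ⌊v⌋ :=
      fun h => ⟨(hg.downTri h).2.2.not_gt, (hg.downTri h).1, (hg.downTri h).2.1⟩
    have key : ∀ {m n : ℤ}, skew u v ∈ frame (lat m n) 0 false '' windmill →
        (u + v < ⌊u⌋ + ⌊v⌋ + 1 ∧ (m = ⌊u⌋ ∧ n = ⌊v⌋ ∨ m + 1 = ⌊u⌋ ∧ n - 1 = ⌊v⌋ ∨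
          m = ⌊u⌋ ∧ n + 1 = ⌊v⌋ ∨ m - 1 = ⌊u⌋ ∧ n = ⌊v⌋)) ∨
        (¬ u + v < ⌊u⌋ + ⌊v⌋ + 1 ∧ (m = ⌊u⌋ ∧ n = ⌊v⌋ ∨ m = ⌊u⌋ ∧ n - 1 = ⌊v⌋ ∨
          m - 1 = ⌊u⌋ ∧ n = ⌊v⌋)) := by
      intro m n h
      rcases mem_windmill_translate.1 h with h | h | h | h | h | h | h
      all_goals first
        | have := hup h; tauto
        | have := hdown h; tauto
    have key' : ∀ {m n : ℤ}, skew u v ∈ frame (lat (m + 2) (n + 1)) 6 false '' windmill →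
        (¬ u + v < ⌊u⌋ + ⌊v⌋ + 1 ∧ (m + 1 = ⌊u⌋ ∧ n = ⌊v⌋ ∨ m = ⌊u⌋ ∧ n + 1 = ⌊v⌋ ∨
          m + 1 = ⌊u⌋ ∧ n - 1 = ⌊v⌋ ∨ m + 2 = ⌊u⌋ ∧ n = ⌊v⌋)) ∨
        (u + v < ⌊u⌋ + ⌊v⌋ + 1 ∧ (m + 1 = ⌊u⌋ ∧ n = ⌊v⌋ ∨ m + 1 = ⌊u⌋ ∧ n + 1 = ⌊v⌋ ∨
          m + 2 = ⌊u⌋ ∧ n = ⌊v⌋)) := by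
      intro m n h
      rcases mem_windmill_rotated.1 h with h | h | h | h | h | h | h
      all_goals first
        | have := hup h; tauto
        | have := hdown h; tauto
    generalize ⌊u⌋ = i at key key'
    generalize ⌊v⌋ = j at key key'
    generalize (u + v < i + j + 1) = p at key key'
    have h1 := interior_subset huv
    have h2 := interior_subset huv'
    obtain ⟨m, n, hmn, rfl | rfl⟩ := ht <;> obtain ⟨m', n', hmn', rfl | rfl⟩ := hs
    · obtain ⟨rfl, rfl⟩ : m = m' ∧ n = n' := by
        rcases key h1 with ⟨hp, h1⟩ | ⟨hp, h1⟩ <;> rcases key h2 with ⟨hp', h2⟩ | ⟨hp', h2⟩ <;>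
          first | exact absurd hp hp' | exact absurd hp' hp | omega
      rfl
    · exfalso
      rcases key h1 with ⟨hp, h1⟩ | ⟨hp, h1⟩ <;> rcases key' h2 with ⟨hp', h2⟩ | ⟨hp', h2⟩ <;>
        first | exact absurd hp hp' | exact absurd hp' hp | omega
    · exfalso
      rcases key' h1 with ⟨hp, h1⟩ | ⟨hp, h1⟩ <;> rcases key h2 with ⟨hp', h2⟩ | ⟨hp', h2⟩ <;>
        first | exact absurd hp hp' | exact absurd hp' hp | omega
    · obtain ⟨rfl, rfl⟩ : m = m' ∧ n = n' := by
        rcases key' h1 with ⟨hp, h1⟩ | ⟨hp, h1⟩ <;> rcases key' h2 with ⟨hp', h2⟩ | ⟨hp', h2⟩ <;>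
          first | exact absurd hp hp' | exact absurd hp' hp | omega
      rfl
  · obtain ⟨u, v, rfl⟩ := exists_skew z
    obtain ⟨i, hi⟩ : ∃ i, i = ⌊u⌋ := ⟨_, rfl⟩
    obtain ⟨j, hj⟩ : ∃ j, j = ⌊v⌋ := ⟨_, rfl⟩
    have translate : ∀ m n : ℤ, (m + 3 * n) % 7 = 0 →
        skew u v ∈ frame (lat m n) 0 false '' windmill →
        skew u v ∈ ⋃₀ windmillTiling := fun m n h hz => ⟨_, ⟨m, n, h, Or.inl rfl⟩, hz⟩
    have rotated : ∀ m n : ℤ, (m + 3 * n) % 7 = 0 →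
        skew u v ∈ frame (lat (m + 2) (n + 1)) 6 false '' windmill →
        skew u v ∈ ⋃₀ windmillTiling := fun m n h hz => ⟨_, ⟨m, n, h, Or.inr rfl⟩, hz⟩
    simp only [mem_windmill_translate] at translate
    simp only [mem_windmill_rotated] at rotated
    have hr : (i + 3 * j) % 7 = 0 ∨ (i + 3 * j) % 7 = 1 ∨ (i + 3 * j) % 7 = 2 ∨
        (i + 3 * j) % 7 = 3 ∨ (i + 3 * j) % 7 = 4 ∨ (i + 3 * j) % 7 = 5 ∨ (i + 3 * j) % 7 = 6 := by
      omega
    have hu1 := Int.floor_le u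
    have hu2 := Int.lt_floor_add_one u
    have hv1 := Int.floor_le v
    have hv2 := Int.lt_floor_add_one v
    rw [← hi] at hu1 hu2
    rw [← hj] at hv1 hv2
    by_cases h : u + v ≤ i + j + 1
    · have hz : skew u v ∈ upTri i j := mem_upTri.2 ⟨hu1, hv1, h⟩
      rcases hr with hr | hr | hr | hr | hr | hr | hr
      · exact translate i j (by omega) (by simp [hz])
      · exact rotated (i - 1) j (by omega) (by simp [hz])
      · exact rotated (i - 2) j (by omega) (by simp [hz])
      · exact translate i (j - 1) (by omega) (by simp [hz])
      · exact rotated (i - 1) (j - 1) (by omega) (by simp [hz])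
      · exact translate (i - 1) (j + 1) (by omega) (by simp [hz])
      · exact translate (i + 1) j (by omega) (by simp [hz])
    · have hz : skew u v ∈ downTri i j := mem_downTri.2 ⟨hu2.le, hv2.le, (not_le.1 h).le⟩
      rcases hr with hr | hr | hr | hr | hr | hr | hr
      · exact translate i j (by omega) (by simp [hz])
      · exact rotated (i - 1) j (by omega) (by simp [hz])
      · exact rotated (i - 2) j (by omega) (by simp [hz])
      · exact rotated i (j - 1) (by omega) (by simp [hz])
      · exact translate i (j + 1) (by omega) (by simp [hz])
      · exact rotated (i - 1) (j + 1) (by omega) (by simp [hz])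
      · exact translate (i + 1) j (by omega) (by simp [hz])

lemma exists_isEEETiling : ∃ T, IsEEETiling T := by
  obtain ⟨T, hT, -⟩ := exists_units_eq isHeptiamondTiling_windmillTiling
  exact ⟨T, hT⟩

end THPentagon

theorem mainTheorem4 :
    (∀ T : Set (Set ℂ), THPentagon.IsTHTiling T →
      (∀ p, THPentagon.IsEPoint T p → THPentagon.RelADE T p ∨ THPentagon.RelEEE T p) ∧
      ¬ ((∃ p, THPentagon.RelADE T p) ∧ (∃ q, THPentagon.RelEEE T q)) ∧
      (THPentagon.IsTypeOneVariation T ∨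
        (THPentagon.IsEEETiling T ∧
          THPentagon.IsHeptiamondTiling (THPentagon.units T)))) ∧
    (∀ T : Set (Set ℂ), THPentagon.IsADETiling T → THPentagon.IsTypeOneVariation T) ∧
    Set.BijOn THPentagon.units {T | THPentagon.IsEEETiling T}
      {H | THPentagon.IsHeptiamondTiling H} ∧
    (∃ T : Set (Set ℂ), THPentagon.IsADETiling T) ∧
    (∃ T : Set (Set ℂ), THPentagon.IsEEETiling T) := by
  refine ⟨fun T hT => ⟨fun p hp => THPentagon.relADE_or_relEEE hT hp, ?_, ?_⟩,
    fun T hT => hT.isTypeOneVariation, THPentagon.bijOn_units, THPentagon.exists_isADETiling,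
    THPentagon.exists_isEEETiling⟩
  · rintro ⟨⟨p, hp⟩, q, hq⟩
    exact (THPentagon.isTypeOneVariation_of_relADE hT hp).not_relEEE q hq
  · exact (THPentagon.isTypeOneVariation_or_isEEETiling hT).imp_right fun h =>
      ⟨h, h.isHeptiamondTiling_units⟩
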